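/- **Theorem (heat kernel on the curvature group).** Repeated indices are summed; $a,b,\dots$ run over $1,\dots,n$ (raised and lowered with $\delta_{ab}$), $i,j,\dots$ over $1,\dots,p$, and $A=(a,i)$ over $N=n+p$ values. *Data.* Let $R_{abcd}=\beta_{ik}E^i{}_{ab}E^k{}_{cd}$ be the Riemann tensor, in an orthonormal frame at a point, of an $n$-dimensional symmetric space, where the $E^i$ are linearly independent antisymmetric real $n\times n$ matrices and $\beta$ is a symmetric nondegenerate real $p\times p$ matrix of any signature; that is, $R$ satisfies the first Bianchi identity and $$R_{fgea}R_{ebcd}-R_{fgeb}R_{eacd}+R_{fgec}R_{edab}-R_{fged}R_{ecab}=0 .$$ Put $D^a{}_{ib}=-\beta_{ik}E^k{}_{ab}$, define $F^j{}_{ik}$ by $[D_i,D_k]=F^j{}_{ik}D_j$, and set $C^i{}_{ab}=E^i{}_{ab}$, $C^a{}_{ib}=-C^a{}_{bi}=D^a{}_{ib}$, $C^i{}_{kl}=F^i{}_{kl}$, all other $C^A{}_{BC}$ being zero; $(C_A)^B{}_C=C^B{}_{AC}$, $C(k)=k^AC_A$ for $k\in\mathbb R^N$, $\gamma=\operatorname{diag}(\delta_{ab},\beta_{ik})$,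 and $R_G=-\frac14\gamma^{AB}C^C{}_{AD}C^D{}_{BC}$. Let $W$ be a finite-dimensional complex inner product space and $\mathcal F_{ab}=-\mathcal F_{ba}$ skew-adjoint operators on $W$ (a Yang–Mills curvature of a compact gauge group) satisfying $[\mathcal F_{cd},\mathcal F_{ab}]-R^f{}_{acd}\mathcal F_{fb}-R^f{}_{bcd}\mathcal F_{af}=0$. Let $q$ be the orthogonal projection of $\mathbb R^n$ onto the flat subspace $\{v: R_{abcd}v^a=0\}$, let $\mathcal B_{ab}=\mathcal F_{cd}q^c{}_aq^d{}_b$ (these operators commute with one another), and let $\mathcal B=(\mathcal B_{AB})=\operatorname{diag}(\mathcal B_{ab},0)$. Let $Y(k)=\frac{1-\exp[-C(k)]}{C(k)}$, $X=Y^{-1}$, $X_A=X_A{}^M\,\partial/\partial k^M$, and call $k\in\mathbb R^N$ regular if $Y(k)$ is invertible. On functions with values in $\operatorname{End}(W)$ let $$J_A=X_A-\tfrac12\mathcal B_{AB}k^B,\qquad J^2=\gamma^{AB}J_AJ_B .$$ Finally let $$A(t;k)=\det\left(\frac{\sinh[C(k)/2+t\mathcal B]}{C(k)/2+t\mathcal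 B}\right)^{-1/2},\qquad \Theta(t;k)=\tfrac12\langle k,\gamma\, t\mathcal B\coth(t\mathcal B)\,k\rangle ,$$ $$\Phi(t;k)=(4\pi t)^{-N/2}A(t;k)\exp\left(-\frac{\Theta(t;k)}{2t}+\frac16R_Gt\right)\in\operatorname{End}(W),$$ where the determinant is over the $N$-valued index (the entries are commuting operators on $W$), its power $-1/2$ is the positive one (for $t$ real or purely imaginary the determinant is a nonnegative self-adjoint operator), and $(4\pi t)^{-N/2}$ is the principal value. *Claim.* 1. For every $t>0$ and every regular $k$, $\Phi(t;\cdot)$ is smooth near $k$ and $\partial_t\Phi=J^2\Phi$ at $(t,k)$. The same equation holds for the continuation of $\Phi$ to $t=i\tau$, $\tau>0$, that is $\partial_\tau\Phi(i\tau;k)=i\,(J^2\Phi)(i\tau;k)$, at all $(\tau,k)$ at which the determinant in $A(i\tau;k)$ is invertible. 2. $\Phi(0;k)=|\gamma|^{-1/2}\delta(k)$ in the sense of distributions on the set of regular $k$: for every smooth compactly supported $f$ whose support consists of regular points, $$\int_{\mathbb R^N}f(k)\,\Phi(t;k)\,dk\longrightarrow|\gamma|^{-1/2}f(0)\,\mathrm{id}_W$$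 as $t\to0^+$ if $\gamma$ is positive definite, and, for $\gamma$ of any signature, as $t=i\tau$, $\tau\to0^+$. Here $|\gamma|^{-1/2}$ is the product of the principal values of $x^{-1/2}$ over the eigenvalues $x$ of $\gamma$ (so it is $(\det\gamma)^{-1/2}$ for positive definite $\gamma$). -/

import Mathlib

open scoped ContDiff Topology

namespace CurvatureGroup

/-- Components, in an orthonormal frame at a point, of the Riemann tensor of an `n`-dimensional
symmetric space, written as `R_{abcd} = ∑ β_{ik} E^i_{ab} E^k_{cd}` with linearly independent
antisymmetric matrices `E^i` and a symmetric nondegenerate matrix `β` (of any signature). -/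
structure SymmetricSpaceCurvature (n p : ℕ) where
  /-- the matrices `E^i_{ab}` -/
  E : Fin p → Matrix (Fin n) (Fin n) ℝ
  /-- the matrix `β_{ik}` -/
  β : Matrix (Fin p) (Fin p) ℝ
  E_antisymm : ∀ i, (E i).transpose = -E i
  E_linearIndependent : LinearIndependent ℝ E
  β_symm : β.transpose = β
  β_nondegenerate : β.det ≠ 0
  /-- first Bianchi identity of `R_{abcd}` -/
  bianchi : ∀ a b c d : Fin n,
    (∑ i, ∑ k, β i k * E i a b * E k c d) + (∑ i, ∑ k, β i k * E i a c * E k d b)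
      + (∑ i, ∑ k, β i k * E i a d * E k b c) = 0
  /-- integrability condition of `∇ R = 0`:
  `R_{fgea} R_{ebcd} - R_{fgeb} R_{eacd} + R_{fgec} R_{edab} - R_{fged} R_{ecab} = 0` -/
  parallel : ∀ f g a b c d : Fin n,
    ∑ e, ((∑ i, ∑ k, β i k * E i f g * E k e a) * (∑ i, ∑ k, β i k * E i e b * E k c d)
      - (∑ i, ∑ k, β i k * E i f g * E k e b) * (∑ i, ∑ k, β i k * E i e a * E k c d)
      + (∑ i, ∑ k, β i k * E i f g * E k e c) * (∑ i, ∑ k, β i k * E i e d * E k a b)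
      - (∑ i, ∑ k, β i k * E i f g * E k e d) * (∑ i, ∑ k, β i k * E i e c * E k a b)) = 0

/-- The capital index `A = (a, i)`, with `N = n + p` values. -/
abbrev Idx (n p : ℕ) : Type := Fin n ⊕ Fin p

noncomputable section

namespace SymmetricSpaceCurvature

variable {n p : ℕ} (S : SymmetricSpaceCurvature n p)

/-- The Riemann tensor `R_{abcd}`. -/
def riemann (a b c d : Fin n) : ℝ := ∑ i, ∑ k, S.β i k * S.E i a b * S.E k c d

/-- The generators `D_i` of the holonomy algebra, `D^a_{ib} = -β_{ik} E^k_{ab}`. -/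
def D (i : Fin p) : Matrix (Fin n) (Fin n) ℝ := -∑ k, S.β i k • S.E k

/-- The structure constants `F^j_{ik}` of the holonomy algebra, `F j i k`:
`[D_i, D_k] = F^j_{ik} D_j`. -/
def F : Fin p → Fin p → Fin p → ℝ :=
  Classical.epsilon fun F : Fin p → Fin p → Fin p → ℝ =>
    ∀ i k, S.D i * S.D k - S.D k * S.D i = ∑ j, F j i k • S.D j

/-- The structure constants of the curvature algebra: `structConst A B C` is `C^A_{BC}`. -/
def structConst : Idx n p → Idx n p → Idx n p → ℝ
  | .inr i, .inl a, .inl b => S.E i a b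
  | .inl a, .inr i, .inl b => S.D i a b
  | .inl a, .inl b, .inr i => -S.D i a b
  | .inr i, .inr k, .inr l => S.F i k l
  | _, _, _ => 0

/-- `C_A`, with entries `(C_A)^B_C = C^B_{AC}`. -/
def adGen (A : Idx n p) : Matrix (Idx n p) (Idx n p) ℝ :=
  Matrix.of fun B C => S.structConst B A C

/-- `C(k) = k^A C_A`. -/
def ad (k : Idx n p → ℝ) : Matrix (Idx n p) (Idx n p) ℝ := ∑ A, k A • S.adGen A

/-- `γ_{AB} = diag(δ_{ab}, β_{ik})`. -/
def γ : Matrix (Idx n p) (Idx n p) ℝ := Matrix.fromBlocks 1 0 0 S.β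

/-- `R_G = -(1/4) γ^{AB} C^C_{AD} C^D_{BC}`. -/
def scalarCurvature : ℝ :=
  -(1 / 4) * ∑ A, ∑ B, S.γ⁻¹ A B * ∑ C, ∑ D, S.structConst C A D * S.structConst D B C

/-- `Y(k) = (1 - exp(-C(k))) / C(k)`, as an everywhere convergent power series; the rows are the
group indices `A`, the columns the coordinate indices `M`. -/
def Y (k : Idx n p → ℝ) : Matrix (Idx n p) (Idx n p) ℝ :=
  ∑' m : ℕ, ((-1) ^ m / ((m + 1).factorial : ℝ)) • S.ad k ^ m

/-- The canonical coordinates `k ∈ ℝ^N` at which `Y(k)` is invertible, that is, at which the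
vector fields `X_A` are defined. -/
def regular : Set (Idx n p → ℝ) := {k | (S.Y k).det ≠ 0}

/-- The flat part `{v | R_{abcd} v^a = 0}` of the tangent space. -/
def flat : Submodule ℝ (EuclideanSpace ℝ (Fin n)) where
  carrier := {v | ∀ b c d, ∑ a, S.riemann a b c d * v a = 0}
  zero_mem' := by simp
  add_mem' := by
    intro v w hv hw b c d
    simp only [Set.mem_ofPred_eq] at hv hw
    simp [mul_add, Finset.sum_add_distrib, hv b c d, hw b c d]
  smul_mem' := by
    intro r v hv b c d
    simp only [Set.mem_ofPred_eq] at hv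
    have h : ∀ a, S.riemann a b c d * (r * v a) = r * (S.riemann a b c d * v a) := fun a => by
      ring
    simp [h, ← Finset.mul_sum, hv b c d]

/-- The matrix `q^a_b` of the orthogonal projection onto the flat part. -/
def q (a b : Fin n) : ℝ := S.flat.starProjection (EuclideanSpace.single b 1) a

end SymmetricSpaceCurvature

/-- A parallel Yang-Mills curvature at a point: an antisymmetric family `𝓕_{ab}` of operators on
the fibre `W`, which carries a Hermitian inner product invariant under the compact gauge group
(so the `𝓕_{ab}` are skew-adjoint), with the integrability condition
`[𝓕_{cd}, 𝓕_{ab}] - R^f_{acd} 𝓕_{fb} - R^f_{bcd} 𝓕_{af} = 0` of `∇𝓕 = 0`. -/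
structure ParallelBundleCurvature {n p : ℕ} (S : SymmetricSpaceCurvature n p) (W : Type*)
    [NormedAddCommGroup W] [InnerProductSpace ℂ W] [CompleteSpace W] where
  /-- the operators `𝓕_{ab}` -/
  curv : Fin n → Fin n → (W →L[ℂ] W)
  antisymm : ∀ a b, curv a b = -curv b a
  skewAdjoint : ∀ a b, star (curv a b) = -curv a b
  parallel : ∀ a b c d, curv c d * curv a b - curv a b * curv c d
    - (∑ f, (S.riemann f a c d : ℂ) • curv f b) - (∑ f, (S.riemann f b c d : ℂ) • curv a f) = 0

/-- `sinh(M) / M`, as a power series. -/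
def sinhc {ι R : Type*} [Fintype ι] [DecidableEq ι] [Ring R] [Algebra ℂ R] [TopologicalSpace R]
    (M : Matrix ι ι R) : Matrix ι ι R :=
  ∑' m : ℕ, ((2 * m + 1).factorial : ℂ)⁻¹ • M ^ (2 * m)

/-- `cosh(M)`, as a power series. -/
def coshM {ι R : Type*} [Fintype ι] [DecidableEq ι] [Ring R] [Algebra ℂ R] [TopologicalSpace R]
    (M : Matrix ι ι R) : Matrix ι ι R :=
  ∑' m : ℕ, ((2 * m).factorial : ℂ)⁻¹ • M ^ (2 * m)

/-- The determinant, by the Leibniz formula, of a matrix whose entries lie in a ring but commute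
with one another; the order of the factors is then irrelevant. -/
def commDet {ι R : Type*} [Fintype ι] [DecidableEq ι] [Ring R] (M : Matrix ι ι R) : R :=
  ∑ σ : Equiv.Perm ι,
    ((Equiv.Perm.sign σ : ℤˣ) : ℤ) • ((Finset.univ : Finset ι).toList.map fun i => M (σ i) i).prod

/-- `|g|^{-1/2}` for a real symmetric nondegenerate `g` of any signature: the product over the
eigenvalues `x` of `g` of the principal values of `x^{-1/2}`. For positive definite `g` this is
`(det g)^{-1/2}`. -/
def invSqrtDet {ι : Type*} [Fintype ι] [DecidableEq ι] (g : Matrix ι ι ℝ) : ℂ :=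
  (g.charpoly.roots.map fun x : ℝ => (x : ℂ) ^ (-(1 / 2) : ℂ)).prod

namespace ParallelBundleCurvature

variable {n p : ℕ} {S : SymmetricSpaceCurvature n p} {W : Type*}
  [NormedAddCommGroup W] [InnerProductSpace ℂ W] [CompleteSpace W]
  (Ω : ParallelBundleCurvature S W)

/-- `𝓑_{ab} = 𝓕_{cd} q^c_a q^d_b`. -/
def flatCurv : Matrix (Fin n) (Fin n) (W →L[ℂ] W) :=
  Matrix.of fun a b => ∑ c, ∑ d, ((S.q c a * S.q d b : ℝ) : ℂ) • Ω.curv c d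

/-- `𝓑_{AB} = diag(𝓑_{ab}, 0)`. As `γ^{ab} = δ^{ab}`, it coincides with `γ^{AB} 𝓑_{BC}`. -/
def B : Matrix (Idx n p) (Idx n p) (W →L[ℂ] W) := Matrix.fromBlocks Ω.flatCurv 0 0 0

/-- `det (sinh [C(k)/2 + t𝓑] / (C(k)/2 + t𝓑))`. -/
def detSinhc (t : ℂ) (k : Idx n p → ℝ) : W →L[ℂ] W :=
  commDet (sinhc
    ((S.ad k).map (fun x : ℝ => ((x / 2 : ℝ) : ℂ) • (1 : W →L[ℂ] W)) + t • Ω.B))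

/-- `A(t;k) = det (sinh [C(k)/2 + t𝓑] / (C(k)/2 + t𝓑))^{-1/2}`. For `t` on the real or on the
imaginary axis the determinant is a self-adjoint nonnegative operator; where it is invertible,
its power `-1/2` is the positive one. -/
def A (t : ℂ) (k : Idx n p → ℝ) : W →L[ℂ] W :=
  cfc (fun x : ℝ => x ^ (-(1 / 2) : ℝ)) (Ω.detSinhc t k)

/-- `Θ̂(t) = t𝓑 coth (t𝓑)`. -/
def thetaHat (t : ℂ) : Matrix (Idx n p) (Idx n p) (W →L[ℂ] W) :=
  coshM (t • Ω.B) * Ring.inverse (sinhc (t • Ω.B))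

/-- `Θ(t;k) = (1/2) ⟨k, γ Θ̂(t) k⟩`. -/
def Θ (t : ℂ) (k : Idx n p → ℝ) : W →L[ℂ] W :=
  (1 / 2 : ℂ) • ∑ A, ∑ B, ∑ C, ((S.γ A B * k A * k C : ℝ) : ℂ) • Ω.thetaHat t B C

/-- `Φ(t;k) = (4πt)^{-N/2} A(t;k) exp (-Θ(t;k)/(2t) + R_G t/6)`, with `N = n + p` and the principal
value of the power. -/
def Φ (t : ℂ) (k : Idx n p → ℝ) : W →L[ℂ] W :=
  (4 * (Real.pi : ℂ) * t) ^ (-((n + p : ℕ) : ℂ) / 2) •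
    (Ω.A t k * NormedSpace.exp
      (-((1 / (2 * t)) • Ω.Θ t k) + ((S.scalarCurvature : ℂ) * t / 6) • (1 : W →L[ℂ] W)))

/-- `J_A = X_A^M ∂_M - (1/2) 𝓑_{AB} k^B`, where `X = Y⁻¹`. -/
def J (A : Idx n p) (f : (Idx n p → ℝ) → (W →L[ℂ] W)) : (Idx n p → ℝ) → (W →L[ℂ] W) :=
  fun k => (∑ M, ((S.Y k)⁻¹ M A : ℂ) • fderiv ℝ f k (Pi.single M 1))
    - (1 / 2 : ℂ) • ((∑ B, (k B : ℂ) • Ω.B A B) * f k)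

/-- `J² = γ^{AB} J_A J_B`. -/
def J2 (f : (Idx n p → ℝ) → (W →L[ℂ] W)) : (Idx n p → ℝ) → (W →L[ℂ] W) :=
  fun k => ∑ A, ∑ B, (S.γ⁻¹ A B : ℂ) • Ω.J A (Ω.J B f) k

end ParallelBundleCurvature

end

end CurvatureGroup

/-! The constants `structConst` define a Lie algebra with nondegenerate invariant form `γ`. The
integrability condition of `∇R = 0` makes the holonomy generators close and `β` invariant (`F_spec`,
`F_invariant`); the Bianchi identity gives the Jacobi identity for three translations (`ad_jacobi`).
The integrability condition on `𝓕` makes the flat components `𝓑_{ab}` commute. Being skew-adjoint,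
they have a joint orthonormal eigenbasis, in which `𝓑` becomes a family of matrices `i b`, with `b`
real, antisymmetric, annihilated by every `C(k)` and fixed by `γ`. All operators involved are then
diagonal (`Φ_eq`, `J2_Φ`), and one scalar kernel `heat` per eigenvector has to be studied. As `C(k)
b = 0`, its determinant factors into `j(k) = det Y(k)` and a function of time.

For the heat equation, the logarithmic gradients of `j` and of the quadratic form are fixed by
`Y⁻¹`, so `J_A` multiplies the kernel by the explicit factor `drift`. In the second derivative, the
cross terms between `log j` and the Gaussian cancel `tr Y⁻¹` (`logJac_self`), and the time
derivative of the Gaussian follows from the Riccati equation of the cotangent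
(`hasDerivAt_inv_smul_cothSqrt`). What is left is that `j^(-1/2)` is an eigenfunction of the
Laplacian with eigenvalue `R_G/6` (`logDer_laplacian`).

This eigenvalue equation is proved without roots, since the algebra need not be semisimple. The
gradient of `log j` is `tr (h(C) dC)` with the odd function `h(x) = coth(x/2)/2 - 1/x`. The second
derivative of `log j`, contracted with `γ⁻¹`, is a theta graph: two brackets joined by three edges
that may carry functions of `C`. Invariance of the form permits permuting the edges. Because `[C, ad
v] = ad (C v)`, the addition theorem of the cotangent and partial fractions for `1/x` relate
functions on three edges. These relations need invertible arguments, whereas `C(k)` annihilates `k`;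
the arguments are therefore shifted to `C + a`, `C + b`, `C + (a - b)`, and the shifts tend to zero
(`diffTrace_eq`).

For the initial condition, `j^(-1/2)` is absorbed into the test function. Parseval's identity turns
the remaining Gaussian of width `√t` into one of width `1/√t`, which tends to `1` under dominated
convergence (`tendsto_integral_quadGaussian`). This covers the oscillating case of imaginary time
and indefinite `γ` as well. -/

namespace CurvatureGroup

noncomputable section

/-! ### Entire power series in a Banach algebra and their divided differences. -/

section PowerSum

variable {𝕜 𝔸 : Type*} [RCLike 𝕜] [NormedRing 𝔸] [NormedAlgebra 𝕜 𝔸]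

/-- The coefficients of an entire power series of exponential type at most one. -/
def FactorialBound (c : ℕ → 𝕜) : Prop := ∀ m, ‖c m‖ ≤ ((m.factorial : ℝ))⁻¹

/-- The sum of a power series in a Banach algebra. -/
def powerSum (c : ℕ → 𝕜) (x : 𝔸) : 𝔸 := ∑' m, c m • x ^ m

/-- The coefficients of the derivative of a power series. -/
def derivCoeff (c : ℕ → 𝕜) (m : ℕ) : 𝕜 := (m + 1) * c (m + 1)

/-- The two-sided first divided difference of a power series. -/
def dividedDiff (c : ℕ → 𝕜) (x y v : 𝔸) : 𝔸 :=
  ∑' m, c (m + 1) • ∑ i ∈ Finset.range (m + 1), x ^ (m - i) * v * y ^ i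

theorem FactorialBound.deriv {c : ℕ → 𝕜} (hc : FactorialBound c) :
    FactorialBound (derivCoeff c) := by
  intro m
  have h := hc (m + 1)
  have h1 : ‖((m : 𝕜) + 1)‖ = (m : ℝ) + 1 := by
    have : ((m : 𝕜) + 1) = ((m + 1 : ℕ) : 𝕜) := by push_cast; rfl
    rw [this, RCLike.norm_natCast]; push_cast; rfl
  rw [derivCoeff, norm_mul, h1]
  calc ((m : ℝ) + 1) * ‖c (m + 1)‖ ≤ ((m : ℝ) + 1) * (((m + 1).factorial : ℝ))⁻¹ := by gcongr
    _ = ((m.factorial : ℝ))⁻¹ := by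
      rw [Nat.factorial_succ]
      push_cast
      field_simp

theorem FactorialBound.succ {c : ℕ → 𝕜} (hc : FactorialBound c) :
    FactorialBound fun m => c (m + 1) := by
  intro m
  refine (hc (m + 1)).trans ?_
  have : (m.factorial : ℝ) ≤ ((m + 1).factorial : ℝ) := by
    exact_mod_cast Nat.factorial_le (Nat.le_succ m)
  gcongr

theorem norm_pow_le_max (x : 𝔸) (m : ℕ) : ‖x ^ m‖ ≤ max 1 ‖(1 : 𝔸)‖ * ‖x‖ ^ m := by
  rcases Nat.eq_zero_or_pos m with rfl | hm
  · simp
  · refine (norm_pow_le' x hm).trans ?_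
    have : (1 : ℝ) ≤ max 1 ‖(1 : 𝔸)‖ := le_max_left _ _
    nlinarith [pow_nonneg (norm_nonneg x) m]

theorem norm_powerSum_term_le {c : ℕ → 𝕜} (hc : FactorialBound c) (x : 𝔸) (m : ℕ) :
    ‖c m • x ^ m‖ ≤ max 1 ‖(1 : 𝔸)‖ * (‖x‖ ^ m / m.factorial) := by
  rw [norm_smul]
  calc ‖c m‖ * ‖x ^ m‖ ≤ ((m.factorial : ℝ))⁻¹ * (max 1 ‖(1 : 𝔸)‖ * ‖x‖ ^ m) := by
        gcongr
        · exact hc m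
        · exact norm_pow_le_max x m
    _ = _ := by ring

theorem summable_exp_bound (K r : ℝ) : Summable fun m : ℕ => K * (r ^ m / m.factorial) :=
  (Real.summable_pow_div_factorial r).mul_left K

/-- The `m + 1` summands have a common bound, and this factor turns `1/(m+1)!` into `1/m!`.
Convergence is thus exponential and locally uniform in both arguments. -/
theorem norm_dividedDiff_term_le {c : ℕ → 𝕜} (hc : FactorialBound c) {r : ℝ} {x y : 𝔸}
    (hx : ‖x‖ ≤ r) (hy : ‖y‖ ≤ r) (v : 𝔸) (m : ℕ) :
    ‖c (m + 1) • ∑ i ∈ Finset.range (m + 1), x ^ (m - i) * v * y ^ i‖ ≤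
      (max 1 ‖(1 : 𝔸)‖ * max 1 ‖(1 : 𝔸)‖) * (r ^ m / m.factorial) * ‖v‖ := by
  have hr : 0 ≤ r := (norm_nonneg x).trans hx
  have hK : 0 ≤ max 1 ‖(1 : 𝔸)‖ := zero_le_one.trans (le_max_left _ _)
  have hterm : ∀ i ∈ Finset.range (m + 1), ‖x ^ (m - i) * v * y ^ i‖ ≤
      (max 1 ‖(1 : 𝔸)‖ * max 1 ‖(1 : 𝔸)‖) * r ^ m * ‖v‖ := by
    intro i hi
    have him : i ≤ m := Nat.lt_succ_iff.mp (Finset.mem_range.mp hi)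
    calc ‖x ^ (m - i) * v * y ^ i‖ ≤ ‖x ^ (m - i)‖ * ‖v‖ * ‖y ^ i‖ :=
          (norm_mul_le _ _).trans (by gcongr; exact norm_mul_le _ _)
      _ ≤ (max 1 ‖(1 : 𝔸)‖ * r ^ (m - i)) * ‖v‖ * (max 1 ‖(1 : 𝔸)‖ * r ^ i) := by
          gcongr
          · exact (norm_pow_le_max x _).trans (by gcongr)
          · exact (norm_pow_le_max y _).trans (by gcongr)
      _ = (max 1 ‖(1 : 𝔸)‖ * max 1 ‖(1 : 𝔸)‖) * (r ^ (m - i) * r ^ i) * ‖v‖ := by ring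
      _ = _ := by rw [← pow_add, Nat.sub_add_cancel him]
  rw [norm_smul]
  calc ‖c (m + 1)‖ * ‖∑ i ∈ Finset.range (m + 1), x ^ (m - i) * v * y ^ i‖
      ≤ (((m + 1).factorial : ℝ))⁻¹ *
        ((m + 1 : ℕ) * ((max 1 ‖(1 : 𝔸)‖ * max 1 ‖(1 : 𝔸)‖) * r ^ m * ‖v‖)) := by
        gcongr
        · exact hc (m + 1)
        · refine (norm_sum_le_of_le _ hterm).trans ?_
          simp
    _ = _ := by
      rw [Nat.factorial_succ]
      push_cast
      field_simp

variable [CompleteSpace 𝔸]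

theorem summable_powerSum {c : ℕ → 𝕜} (hc : FactorialBound c) (x : 𝔸) :
    Summable fun m => c m • x ^ m :=
  .of_norm_bounded (summable_exp_bound _ ‖x‖) (norm_powerSum_term_le hc x)

theorem hasSum_powerSum {c : ℕ → 𝕜} (hc : FactorialBound c) (x : 𝔸) :
    HasSum (fun m => c m • x ^ m) (powerSum c x) :=
  (summable_powerSum hc x).hasSum

theorem summable_dividedDiff {c : ℕ → 𝕜} (hc : FactorialBound c) (x y v : 𝔸) :
    Summable fun m => c (m + 1) • ∑ i ∈ Finset.range (m + 1), x ^ (m - i) * v * y ^ i :=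
  .of_norm_bounded
    ((summable_exp_bound (max 1 ‖(1 : 𝔸)‖ * max 1 ‖(1 : 𝔸)‖) (max ‖x‖ ‖y‖)).mul_right ‖v‖)
    (norm_dividedDiff_term_le hc (le_max_left _ _) (le_max_right _ _) v)

theorem hasSum_dividedDiff {c : ℕ → 𝕜} (hc : FactorialBound c) (x y v : 𝔸) :
    HasSum (fun m => c (m + 1) • ∑ i ∈ Finset.range (m + 1), x ^ (m - i) * v * y ^ i)
      (dividedDiff c x y v) :=
  (summable_dividedDiff hc x y v).hasSum

theorem powerSum_eq_add_mul {c : ℕ → 𝕜} (hc : FactorialBound c) (x : 𝔸) :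
    powerSum c x = c 0 • (1 : 𝔸) + x * powerSum (fun m => c (m + 1)) x := by
  rw [powerSum, (summable_powerSum hc x).tsum_eq_zero_add, powerSum,
    ← (summable_powerSum hc.succ x).tsum_mul_left]
  simp [pow_succ']

theorem commute_powerSum {c : ℕ → 𝕜} (hc : FactorialBound c) {x v : 𝔸} (h : Commute v x) :
    Commute v (powerSum c x) := by
  have h1 := (hasSum_powerSum hc x).mul_left v
  have h2 := (hasSum_powerSum hc x).mul_right v
  have : (fun m => v * (c m • x ^ m)) = fun m => (c m • x ^ m) * v := by
    funext m
    rw [mul_smul_comm, smul_mul_assoc, (h.pow_right m).eq]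
  rw [this] at h1
  exact h1.unique h2

/-- The inner sum telescopes to `x ^ (m + 1) * u - u * y ^ (m + 1)`. Along commutator directions a
derivative is therefore a difference of values of the function itself. -/
theorem dividedDiff_commutator {c : ℕ → 𝕜} (hc : FactorialBound c) (x y u : 𝔸) :
    dividedDiff c x y (x * u - u * y) = powerSum c x * u - u * powerSum c y := by
  have h1 := (hasSum_powerSum hc x).mul_right u
  have h2 := (hasSum_powerSum hc y).mul_left u
  have h3 := h1.sub h2
  rw [← (hasSum_nat_add_iff' 1)] at h3
  have h4 := hasSum_dividedDiff hc x y (x * u - u * y)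
  have hterm : ∀ m : ℕ, ∑ i ∈ Finset.range (m + 1), x ^ (m - i) * (x * u - u * y) * y ^ i
      = x ^ (m + 1) * u - u * y ^ (m + 1) := by
    intro m
    have : ∀ i ∈ Finset.range (m + 1), x ^ (m - i) * (x * u - u * y) * y ^ i =
        x ^ (m + 1 - i) * u * y ^ i - x ^ (m + 1 - (i + 1)) * u * y ^ (i + 1) := by
      intro i hi
      have him : i ≤ m := Nat.lt_succ_iff.mp (Finset.mem_range.mp hi)
      rw [Nat.succ_sub him, pow_succ, pow_succ']
      simp only [Nat.add_sub_add_right]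
      noncomm_ring
    rw [Finset.sum_congr rfl this,
      Finset.sum_range_sub' (fun i => x ^ (m + 1 - i) * u * y ^ i)]
    simp
  simp only [hterm] at h4
  have h5 : (fun m => c (m + 1) • (x ^ (m + 1) * u - u * y ^ (m + 1))) = fun n =>
      c (n + 1) • x ^ (n + 1) * u - u * c (n + 1) • y ^ (n + 1) := by
    funext m
    rw [smul_sub, smul_mul_assoc, mul_smul_comm]
  rw [h5] at h4
  refine h4.unique ?_
  convert! h3 using 1
  simp

theorem dividedDiff_of_commute {c : ℕ → 𝕜} {x v : 𝔸} (hc : FactorialBound c) (h : Commute v x) :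
    dividedDiff c x x v = powerSum (derivCoeff c) x * v := by
  refine (hasSum_dividedDiff hc x x v).unique ?_
  convert! (hasSum_powerSum hc.deriv x).mul_right v using 2 with m
  have : ∀ i ∈ Finset.range (m + 1), x ^ (m - i) * v * x ^ i = x ^ m * v := by
    intro i hi
    have him : i ≤ m := Nat.lt_succ_iff.mp (Finset.mem_range.mp hi)
    rw [mul_assoc, (h.pow_right i).eq, ← mul_assoc, ← pow_add, Nat.sub_add_cancel him]
  rw [Finset.sum_congr rfl this, Finset.sum_const, Finset.card_range, derivCoeff,
    smul_mul_assoc, mul_smul, smul_comm, ← Nat.cast_smul_eq_nsmul 𝕜]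
  push_cast
  rfl

theorem continuous_dividedDiff {c : ℕ → 𝕜} (hc : FactorialBound c) (v : 𝔸) :
    Continuous fun q : 𝔸 × 𝔸 => dividedDiff c q.1 q.2 v := by
  rw [continuous_iff_continuousAt]
  intro q
  have hU : Metric.ball (0 : 𝔸 × 𝔸) (‖q‖ + 1) ∈ 𝓝 q :=
    Metric.isOpen_ball.mem_nhds (by simp)
  refine ContinuousOn.continuousAt ?_ hU
  refine continuousOn_tsum (fun m => ?_)
    ((summable_exp_bound (max 1 ‖(1 : 𝔸)‖ * max 1 ‖(1 : 𝔸)‖) (‖q‖ + 1)).mul_right ‖v‖)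
    fun m z hz => ?_
  · exact Continuous.continuousOn (by fun_prop)
  · have hz' : ‖z‖ ≤ ‖q‖ + 1 := by
      have := mem_ball_zero_iff.mp hz
      exact this.le
    exact norm_dividedDiff_term_le hc ((norm_fst_le z).trans hz') ((norm_snd_le z).trans hz') v m

/-- Termwise differentiation on a ball of radius `‖x‖ + 1`, where an exponential series dominates
the derivatives. -/
theorem hasFDerivAt_powerSum {c : ℕ → 𝕜} (hc : FactorialBound c) (x : 𝔸) :
    ∃ L : 𝔸 →L[𝕜] 𝔸, HasFDerivAt (powerSum c) L x ∧ ∀ v, L v = dividedDiff c x x v := by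
  let : NormedSpace ℝ 𝔸 := NormedSpace.restrictScalars ℝ 𝕜 𝔸
  let T : ℕ → 𝔸 → (𝔸 →L[𝕜] 𝔸) := fun m z => c (m + 1) • ∑ i ∈ Finset.range (m + 1),
    (ContinuousLinearMap.mul 𝕜 𝔸 (z ^ (m - i))).comp ((ContinuousLinearMap.mul 𝕜 𝔸).flip (z ^ i))
  have hT : ∀ m z v, T m z v =
      c (m + 1) • ∑ i ∈ Finset.range (m + 1), z ^ (m - i) * v * z ^ i := by
    intro m z v
    simp [T, mul_assoc]
  set K := max 1 ‖(1 : 𝔸)‖ * max 1 ‖(1 : 𝔸)‖ with hK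
  have hK0 : 0 ≤ K := by positivity
  have hu := summable_exp_bound K (‖x‖ + 1)
  have hd : ∀ m (z : 𝔸), HasFDerivAt (fun z : 𝔸 => c (m + 1) • z ^ (m + 1)) (T m z) z := by
    intro m z
    refine ((hasFDerivAt_pow' (𝕜 := 𝕜) (m + 1)).const_smul (c (m + 1))).congr_fderiv ?_
    ext v
    rw [hT]
    simp
  have hb : ∀ m (z : 𝔸), z ∈ Metric.ball (0 : 𝔸) (‖x‖ + 1) →
      ‖T m z‖ ≤ K * ((‖x‖ + 1) ^ m / m.factorial) := by
    intro m z hz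
    have hz' : ‖z‖ ≤ ‖x‖ + 1 := (mem_ball_zero_iff.mp hz).le
    refine ContinuousLinearMap.opNorm_le_bound _ (by positivity) fun v => ?_
    rw [hT]
    exact norm_dividedDiff_term_le hc hz' hz' v m
  have hx : x ∈ Metric.ball (0 : 𝔸) (‖x‖ + 1) := by simp
  have hsum : ∀ z : 𝔸, Summable fun m => c (m + 1) • z ^ (m + 1) := fun z =>
    (summable_nat_add_iff 1).mpr (summable_powerSum hc z)
  have hmain := hasFDerivAt_tsum_of_isPreconnected hu Metric.isOpen_ball
    (convex_ball (0 : 𝔸) _).isPreconnected (fun m z _ => hd m z) hb hx (hsum x) hx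
  refine ⟨∑' m, T m x, ?_, fun v => ?_⟩
  · have heq : powerSum c = fun z : 𝔸 => c 0 • (1 : 𝔸) + ∑' m, c (m + 1) • z ^ (m + 1) := by
      funext z
      rw [powerSum, (summable_powerSum hc z).tsum_eq_zero_add]
      simp
    rw [heq]
    exact hmain.const_add _
  · have hs : Summable fun m => T m x :=
      .of_norm_bounded hu fun m => hb m x hx
    have := (ContinuousLinearMap.apply 𝕜 𝔸 v).map_tsum hs
    simp only [ContinuousLinearMap.apply_apply] at this
    rw [this, dividedDiff]
    simp only [hT]

theorem contDiff_powerSum {c : ℕ → 𝕜} (hc : FactorialBound c) {n : WithTop ℕ∞} :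
    ContDiff 𝕜 n (powerSum c : 𝔸 → 𝔸) := by
  have hrad : (FormalMultilinearSeries.ofScalars 𝔸 c).radius = ⊤ := by
    refine FormalMultilinearSeries.radius_eq_top_of_summable_norm _ fun r => ?_
    rw [← summable_nat_add_iff 1]
    refine .of_nonneg_of_le (fun m => by positivity) (fun m => ?_)
      ((summable_nat_add_iff 1).mpr (Real.summable_pow_div_factorial r))
    rw [div_eq_inv_mul]
    gcongr
    exact (FormalMultilinearSeries.ofScalars_norm_le 𝔸 c (m + 1) (by omega)).trans (hc _)
  have h := (FormalMultilinearSeries.ofScalars 𝔸 c).hasFPowerSeriesOnBall (by simp [hrad])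
  have heq : (FormalMultilinearSeries.ofScalars 𝔸 c).sum = powerSum c := by
    funext z
    exact FormalMultilinearSeries.ofScalars_sum_eq c z
  rw [heq, hrad] at h
  have : AnalyticOnNhd 𝕜 (powerSum c : 𝔸 → 𝔸) Set.univ := by
    intro z _
    exact h.analyticAt_of_mem (by simp)
  exact this.contDiff

theorem continuous_powerSum {c : ℕ → 𝕜} (hc : FactorialBound c) :
    Continuous (powerSum c : 𝔸 → 𝔸) :=
  (contDiff_powerSum (𝔸 := 𝔸) hc (n := 0)).continuous

theorem map_powerSum {𝔹 : Type*} [Ring 𝔹] [Algebra 𝕜 𝔹] [TopologicalSpace 𝔹] [T2Space 𝔹]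
    {c : ℕ → 𝕜} (hc : FactorialBound c) (φ : 𝔸 →ₐ[𝕜] 𝔹) (hφ : Continuous φ) (x : 𝔸) :
    φ (powerSum c x) = ∑' m, c m • φ x ^ m := by
  have := (hasSum_powerSum hc x).map φ hφ
  rw [← this.tsum_eq]
  simp

end PowerSum

end

end CurvatureGroup

/-! ### The exponential and hyperbolic series, and the signs of their determinants on real matrices.
-/

namespace CurvatureGroup

noncomputable section

section Coefficients

variable {𝕜 : Type*} [RCLike 𝕜]

/-- Coefficients of `exp (-x)`. -/
def expNegCoeff (𝕜 : Type*) [RCLike 𝕜] (m : ℕ) : 𝕜 := (-1) ^ m / (m.factorial : 𝕜)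

/-- Coefficients of `exp x`. -/
def expCoeff (𝕜 : Type*) [RCLike 𝕜] (m : ℕ) : 𝕜 := (m.factorial : 𝕜)⁻¹

/-- Coefficients of `(1 - exp (-x)) / x`. -/
def leftCoeff (𝕜 : Type*) [RCLike 𝕜] (m : ℕ) : 𝕜 := (-1) ^ m / ((m + 1).factorial : 𝕜)

/-- Coefficients of `sinh √x / √x`. -/
def sinhCoeff (𝕜 : Type*) [RCLike 𝕜] (m : ℕ) : 𝕜 := ((2 * m + 1).factorial : 𝕜)⁻¹

/-- Coefficients of `cosh √x`. -/
def coshCoeff (𝕜 : Type*) [RCLike 𝕜] (m : ℕ) : 𝕜 := ((2 * m).factorial : 𝕜)⁻¹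

theorem factorialBound_of_le {c : ℕ → 𝕜} {a : ℕ → ℕ} (ha : ∀ m, m ≤ a m)
    (hc : ∀ m, ‖c m‖ = ((a m).factorial : ℝ)⁻¹) : FactorialBound c := by
  intro m
  rw [hc m]
  have : (m.factorial : ℝ) ≤ ((a m).factorial : ℝ) := by
    exact_mod_cast Nat.factorial_le (ha m)
  gcongr

theorem factorialBound_expNegCoeff : FactorialBound (expNegCoeff 𝕜) :=
  factorialBound_of_le (a := id) (fun _ => le_rfl) fun m => by simp [expNegCoeff]

theorem factorialBound_expCoeff : FactorialBound (expCoeff 𝕜) :=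
  factorialBound_of_le (a := id) (fun _ => le_rfl) fun m => by simp [expCoeff]

theorem factorialBound_leftCoeff : FactorialBound (leftCoeff 𝕜) :=
  factorialBound_of_le (a := fun m => m + 1) (fun _ => by omega) fun m => by simp [leftCoeff]

theorem factorialBound_sinhCoeff : FactorialBound (sinhCoeff 𝕜) :=
  factorialBound_of_le (a := fun m => 2 * m + 1) (fun _ => by omega) fun m => by simp [sinhCoeff]

theorem factorialBound_coshCoeff : FactorialBound (coshCoeff 𝕜) :=
  factorialBound_of_le (a := fun m => 2 * m) (fun _ => by omega) fun m => by simp [coshCoeff]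

theorem derivCoeff_coshCoeff (m : ℕ) :
    derivCoeff (coshCoeff 𝕜) m = (1 / 2) * sinhCoeff 𝕜 m := by
  rw [derivCoeff, coshCoeff, sinhCoeff, show 2 * (m + 1) = (2 * m + 1) + 1 by ring,
    Nat.factorial_succ (2 * m + 1)]
  have h : ((m : 𝕜) + 1) ≠ 0 := by exact_mod_cast Nat.succ_ne_zero m
  have h' : (((2 * m + 1).factorial : ℕ) : 𝕜) ≠ 0 := by
    exact_mod_cast Nat.factorial_ne_zero _
  push_cast
  have h2 : (2 * (m : 𝕜) + 1 + 1) = 2 * (m + 1) := by ring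
  rw [h2]
  field_simp

theorem sinhCoeff_add_mul (m : ℕ) :
    sinhCoeff 𝕜 m + 2 * (m * sinhCoeff 𝕜 m) = coshCoeff 𝕜 m := by
  rw [coshCoeff, sinhCoeff, Nat.factorial_succ (2 * m)]
  have h : (2 * (m : 𝕜) + 1) ≠ 0 := by exact_mod_cast Nat.succ_ne_zero (2 * m)
  have h' : (((2 * m).factorial : ℕ) : 𝕜) ≠ 0 := by
    exact_mod_cast Nat.factorial_ne_zero _
  push_cast
  field_simp
  ring

theorem leftCoeff_add_mul (m : ℕ) :
    leftCoeff 𝕜 m + m * leftCoeff 𝕜 m = expNegCoeff 𝕜 m := by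
  rw [leftCoeff, expNegCoeff, Nat.factorial_succ m]
  have h : ((m : 𝕜) + 1) ≠ 0 := by exact_mod_cast Nat.succ_ne_zero m
  have h' : ((m.factorial : ℕ) : 𝕜) ≠ 0 := by
    exact_mod_cast Nat.factorial_ne_zero _
  push_cast
  field_simp
  ring

end Coefficients

section Banach

variable {𝕜 𝔸 : Type*} [RCLike 𝕜] [NormedRing 𝔸] [NormedAlgebra 𝕜 𝔸] [CompleteSpace 𝔸]

theorem hasSum_mul_derivCoeff {c : ℕ → 𝕜} (hc : FactorialBound c) (x : 𝔸) :
    HasSum (fun m : ℕ => ((m : 𝕜) * c m) • x ^ m) (x * powerSum (derivCoeff c) x) := by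
  rw [← hasSum_nat_add_iff' 1]
  convert! (hasSum_powerSum hc.deriv x).mul_left x using 1
  · funext m
    rw [derivCoeff, pow_succ']
    push_cast
    rw [mul_smul_comm]
  · simp

omit [CompleteSpace 𝔸] in
theorem powerSum_zero (c : ℕ → 𝕜) : powerSum c (0 : 𝔸) = c 0 • 1 := by
  rw [powerSum, tsum_eq_single 0]
  · simp
  · intro m hm
    simp [hm]

variable (𝕜)

/-- `(1 - exp (-x)) / x`. -/
def leftFun (x : 𝔸) : 𝔸 := powerSum (leftCoeff 𝕜) x

/-- The derivative of `(1 - exp (-x)) / x`. -/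
def leftFunDeriv (x : 𝔸) : 𝔸 := powerSum (derivCoeff (leftCoeff 𝕜)) x

/-- `sinh √x / √x`. -/
def sinhSqrt (x : 𝔸) : 𝔸 := powerSum (sinhCoeff 𝕜) x

/-- `cosh √x`. -/
def coshSqrt (x : 𝔸) : 𝔸 := powerSum (coshCoeff 𝕜) x

/-- The exponential series of a Banach algebra over `𝕜`. -/
def expFun (x : 𝔸) : 𝔸 := powerSum (expCoeff 𝕜) x

theorem expFun_eq_exp (x : 𝔸) : expFun 𝕜 x = NormedSpace.exp x :=
  (hasSum_powerSum factorialBound_expCoeff x).unique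
    (NormedSpace.exp_series_hasSum_exp' (𝕂 := 𝕜) x)

theorem expFun_add {x y : 𝔸} (h : Commute x y) :
    expFun 𝕜 (x + y) = expFun 𝕜 x * expFun 𝕜 y := by
  let : NormedAlgebra ℚ 𝔸 := NormedAlgebra.restrictScalars ℚ 𝕜 𝔸
  simp only [expFun_eq_exp]
  exact NormedSpace.exp_add_of_commute h

theorem powerSum_expNegCoeff (x : 𝔸) :
    powerSum (expNegCoeff 𝕜) x = expFun 𝕜 (-x) := by
  rw [expFun, powerSum, powerSum]
  congr 1
  funext m
  rw [expNegCoeff, expCoeff]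
  rcases Nat.even_or_odd m with h' | h' <;> simp [h'.neg_one_pow, h'.neg_pow, neg_div]

theorem mul_leftFun (x : 𝔸) : x * leftFun 𝕜 x = 1 - expFun 𝕜 (-x) := by
  have h := powerSum_eq_add_mul (factorialBound_expNegCoeff (𝕜 := 𝕜)) x
  rw [powerSum_expNegCoeff] at h
  have h2 : powerSum (fun m => expNegCoeff 𝕜 (m + 1)) x = -leftFun 𝕜 x := by
    rw [leftFun, powerSum, powerSum, ← tsum_neg]
    congr 1
    funext m
    rw [← neg_smul, leftCoeff, expNegCoeff, pow_succ]
    congr 1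
    ring
  rw [h, h2]
  simp [expNegCoeff]

/-- Termwise form of `(x f)' = exp (-x)` for `f = (1 - exp (-x)) / x`. -/
theorem leftFun_add_mul_deriv (x : 𝔸) :
    leftFun 𝕜 x + x * leftFunDeriv 𝕜 x = expFun 𝕜 (-x) := by
  rw [← powerSum_expNegCoeff 𝕜]
  have h := (hasSum_powerSum (factorialBound_leftCoeff (𝕜 := 𝕜)) x).add
    (hasSum_mul_derivCoeff (factorialBound_leftCoeff (𝕜 := 𝕜)) x)
  refine h.unique ?_
  convert! hasSum_powerSum (factorialBound_expNegCoeff (𝕜 := 𝕜)) x using 2 with m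
  rw [← add_smul, leftCoeff_add_mul]

theorem exp_eq_cosh_add_sinh (x : 𝔸) :
    expFun 𝕜 x = coshSqrt 𝕜 (x ^ 2) + x * sinhSqrt 𝕜 (x ^ 2) := by
  refine (hasSum_powerSum (factorialBound_expCoeff (𝕜 := 𝕜)) x).unique (HasSum.even_add_odd ?_ ?_)
  · convert! hasSum_powerSum (factorialBound_coshCoeff (𝕜 := 𝕜)) (x ^ 2) using 2 with m
    rw [coshCoeff, expCoeff, pow_mul]
  · convert! (hasSum_powerSum (factorialBound_sinhCoeff (𝕜 := 𝕜)) (x ^ 2)).mul_left x using 2 with m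
    rw [sinhCoeff, expCoeff, ← pow_mul, mul_smul_comm, pow_succ']

theorem exp_neg_eq_cosh_sub_sinh (x : 𝔸) :
    expFun 𝕜 (-x) = coshSqrt 𝕜 (x ^ 2) - x * sinhSqrt 𝕜 (x ^ 2) := by
  rw [exp_eq_cosh_add_sinh 𝕜 (-x)]
  simp [sub_eq_add_neg]

/-- In the variable `y = √x`, where `2 x d/dx = y d/dy`, this is `(y · sinh y / y)' = cosh y`. -/
theorem coshSqrt_eq_add (x : 𝔸) :
    sinhSqrt 𝕜 x + (2 : 𝕜) • (x * powerSum (derivCoeff (sinhCoeff 𝕜)) x) = coshSqrt 𝕜 x := by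
  have h := (hasSum_powerSum (factorialBound_sinhCoeff (𝕜 := 𝕜)) x).add
    ((hasSum_mul_derivCoeff (factorialBound_sinhCoeff (𝕜 := 𝕜)) x).const_smul (2 : 𝕜))
  refine h.unique ?_
  convert! hasSum_powerSum (factorialBound_coshCoeff (𝕜 := 𝕜)) x using 2 with m
  rw [smul_smul, ← add_smul, sinhCoeff_add_mul]

theorem powerSum_derivCoeff_coshCoeff (x : 𝔸) :
    powerSum (derivCoeff (coshCoeff 𝕜)) x = (1 / 2 : 𝕜) • sinhSqrt 𝕜 x := by
  rw [sinhSqrt, powerSum, powerSum,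
    ← (summable_powerSum (factorialBound_sinhCoeff (𝕜 := 𝕜)) x).tsum_const_smul]
  congr 1
  funext m
  rw [derivCoeff_coshCoeff, mul_smul]

theorem expFun_zero : expFun 𝕜 (0 : 𝔸) = 1 := by
  rw [expFun, powerSum_zero]
  simp [expCoeff]

end Banach

section RealMatrix

open scoped Matrix.Norms.Operator

variable {ι : Type*} [Fintype ι] [DecidableEq ι]

/-- A characteristic polynomial has finitely many roots, so only finitely many shifts are singular.
The punctured neighbourhood allows `M` itself to be singular. -/
theorem eventually_isUnit_add_smul_one (M : Matrix ι ι ℝ) {a : ℝ} (ha : a ≠ 0) :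
    ∀ᶠ ε : ℝ in 𝓝[≠] 0, IsUnit (M + (a * ε) • (1 : Matrix ι ι ℝ)) := by
  have hfin : {μ : ℝ | (-M).charpoly.IsRoot μ}.Finite :=
    Polynomial.finite_setOfPred_isRoot (Matrix.charpoly_monic _).ne_zero
  have hfin' : ((fun ε : ℝ => a * ε) ⁻¹' {μ : ℝ | (-M).charpoly.IsRoot μ} \ {0}).Finite :=
    (hfin.preimage (fun x _ y _ h => mul_left_cancel₀ ha h)).subset Set.sdiff_subset
  have hmem : ((fun ε : ℝ => a * ε) ⁻¹' {μ : ℝ | (-M).charpoly.IsRoot μ} \ {0})ᶜ ∈ 𝓝 (0 : ℝ) :=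
    hfin'.isClosed.isOpen_compl.mem_nhds (by simp)
  filter_upwards [nhdsWithin_le_nhds hmem, self_mem_nhdsWithin] with ε h1 h2
  rw [Matrix.isUnit_iff_isUnit_det, isUnit_iff_ne_zero]
  intro h
  refine h1 ⟨?_, h2⟩
  change (-M).charpoly.IsRoot (a * ε)
  rw [Polynomial.IsRoot, Matrix.eval_charpoly]
  rw [← h]
  congr 1
  rw [sub_neg_eq_add, add_comm, Matrix.scalar_apply, Matrix.smul_one_eq_diagonal]

/-- Continuous functions of a real matrix that agree after multiplication by the argument agree. -/
theorem eq_of_mul_eq_mul {F G : Matrix ι ι ℝ → Matrix ι ι ℝ} (hF : Continuous F)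
    (hG : Continuous G) (h : ∀ M, M * F M = M * G M) (M : Matrix ι ι ℝ) : F M = G M := by
  have hpath : Filter.Tendsto (fun ε : ℝ => M + ((1 : ℝ) * ε) • (1 : Matrix ι ι ℝ)) (𝓝[≠] 0)
      (𝓝 M) := by
    have : Continuous fun ε : ℝ => M + ((1 : ℝ) * ε) • (1 : Matrix ι ι ℝ) := by fun_prop
    have h0 := (this.tendsto 0).mono_left (nhdsWithin_le_nhds (s := {0}ᶜ))
    simpa using h0
  refine tendsto_nhds_unique ((hF.tendsto M).comp hpath) ?_
  refine ((hG.tendsto M).comp hpath).congr' ?_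
  filter_upwards [eventually_isUnit_add_smul_one M one_ne_zero] with ε hε
  exact (hε.mul_left_cancel (h _)).symm

/-- After multiplication by `M` both sides are differences of exponentials; `eq_of_mul_eq_mul`
permits the cancellation at singular `M` too. -/
theorem leftFun_two_smul (M : Matrix ι ι ℝ) :
    leftFun ℝ ((2 : ℝ) • M) = expFun ℝ (-M) * sinhSqrt ℝ (M ^ 2) := by
  have hl := continuous_powerSum (𝔸 := Matrix ι ι ℝ) (factorialBound_leftCoeff (𝕜 := ℝ))
  have hs := continuous_powerSum (𝔸 := Matrix ι ι ℝ) (factorialBound_sinhCoeff (𝕜 := ℝ))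
  have he := continuous_powerSum (𝔸 := Matrix ι ι ℝ) (factorialBound_expCoeff (𝕜 := ℝ))
  refine eq_of_mul_eq_mul (F := fun M => leftFun ℝ ((2 : ℝ) • M))
    (G := fun M => expFun ℝ (-M) * sinhSqrt ℝ (M ^ 2))
    (hl.comp (by fun_prop)) (Continuous.mul
      (he.comp continuous_neg) (hs.comp (by fun_prop))) (fun M => ?_) M
  have h1 := mul_leftFun ℝ ((2 : ℝ) • M)
  have h2 := exp_eq_cosh_add_sinh ℝ M
  have h3 := exp_neg_eq_cosh_sub_sinh ℝ M
  have hc : Commute M (expFun ℝ (-M)) := commute_powerSum factorialBound_expCoeff (Commute.refl M).neg_right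
  have h4 : expFun ℝ (-((2 : ℝ) • M)) = expFun ℝ (-M) * expFun ℝ (-M) := by
    rw [← expFun_add ℝ (Commute.refl _), two_smul, neg_add]
  have h5 : expFun ℝ (-M) * expFun ℝ M = 1 := by
    rw [← expFun_add ℝ ((Commute.refl M).neg_left), neg_add_cancel, expFun_zero]
  have h6 : (2 : ℝ) • (M * sinhSqrt ℝ (M ^ 2)) =
      expFun ℝ M - expFun ℝ (-M) := by
    rw [h2, h3, two_smul]; abel
  have h7 : (2 : ℝ) • (M * leftFun ℝ ((2 : ℝ) • M)) =
      (2 : ℝ) • (M * (expFun ℝ (-M) * sinhSqrt ℝ (M ^ 2))) := by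
    rw [← smul_mul_assoc, h1, ← mul_assoc, hc.eq, mul_assoc, ← mul_smul_comm, h6, mul_sub, h5, h4]
  exact smul_right_injective _ (two_ne_zero) h7

theorem sinhSqrt_two_smul_sq (M : Matrix ι ι ℝ) :
    sinhSqrt ℝ (((2 : ℝ) • M) ^ 2) = coshSqrt ℝ (M ^ 2) * sinhSqrt ℝ (M ^ 2) := by
  have hs := continuous_powerSum (𝔸 := Matrix ι ι ℝ) (factorialBound_sinhCoeff (𝕜 := ℝ))
  have hc := continuous_powerSum (𝔸 := Matrix ι ι ℝ) (factorialBound_coshCoeff (𝕜 := ℝ))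
  refine eq_of_mul_eq_mul (F := fun M => sinhSqrt ℝ (((2 : ℝ) • M) ^ 2))
    (G := fun M => coshSqrt ℝ (M ^ 2) * sinhSqrt ℝ (M ^ 2))
    (hs.comp (by fun_prop)) (Continuous.mul
      (hc.comp (by fun_prop)) (hs.comp (by fun_prop))) (fun M => ?_) M
  have h2 := exp_eq_cosh_add_sinh ℝ M
  have h3 := exp_neg_eq_cosh_sub_sinh ℝ M
  have h2' := exp_eq_cosh_add_sinh ℝ ((2 : ℝ) • M)
  have h3' := exp_neg_eq_cosh_sub_sinh ℝ ((2 : ℝ) • M)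
  have e1 : expFun ℝ (-((2 : ℝ) • M)) = expFun ℝ (-M) * expFun ℝ (-M) := by
    rw [← expFun_add ℝ (Commute.refl _), two_smul, neg_add]
  have e2 : expFun ℝ ((2 : ℝ) • M) = expFun ℝ M * expFun ℝ M := by
    rw [← expFun_add ℝ (Commute.refl _), two_smul]
  have hcm : Commute M (coshSqrt ℝ (M ^ 2)) :=
    commute_powerSum factorialBound_coshCoeff ((Commute.refl M).pow_right 2)
  have hsm : Commute M (sinhSqrt ℝ (M ^ 2)) :=
    commute_powerSum factorialBound_sinhCoeff ((Commute.refl M).pow_right 2)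
  have hcs : Commute (coshSqrt ℝ (M ^ 2)) (sinhSqrt ℝ (M ^ 2)) :=
    commute_powerSum factorialBound_sinhCoeff (hcm.symm.pow_right 2)
  set c := coshSqrt ℝ (M ^ 2)
  set s := sinhSqrt ℝ (M ^ 2)
  have h4 : (4 : ℝ) • (M * sinhSqrt ℝ (((2 : ℝ) • M) ^ 2)) = (4 : ℝ) • (M * (c * s)) := by
    have : (4 : ℝ) • (M * sinhSqrt ℝ (((2 : ℝ) • M) ^ 2)) =
        expFun ℝ ((2 : ℝ) • M) - expFun ℝ (-((2 : ℝ) • M)) := by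
      rw [h2', h3', smul_mul_assoc]
      have : (4 : ℝ) = 2 + 2 := by norm_num
      rw [this, add_smul]; abel
    rw [this, e1, e2, h2, h3]
    have k1 : (c + M * s) * (c + M * s) - (c - M * s) * (c - M * s) =
        (2 : ℝ) • (c * (M * s)) + (2 : ℝ) • (M * s * c) := by
      rw [two_smul, two_smul]; noncomm_ring
    rw [k1, ← mul_assoc c M, ← hcm.eq, mul_assoc M s, ← hcs.eq, mul_assoc M c, ← add_smul]
    norm_num
  exact smul_right_injective _ (four_ne_zero) h4

theorem det_exp_pos (M : Matrix ι ι ℝ) : 0 < (expFun ℝ M).det := by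
  have h : expFun ℝ M =
      expFun ℝ ((1 / 2 : ℝ) • M) * expFun ℝ ((1 / 2 : ℝ) • M) := by
    rw [← expFun_add ℝ (Commute.refl _), ← add_smul]
    norm_num
  have h0 : (expFun ℝ M).det ≠ 0 := by
    intro h0
    have h5 : expFun ℝ (-M) * expFun ℝ M = 1 := by
      rw [← expFun_add ℝ ((Commute.refl M).neg_left), neg_add_cancel, expFun_zero]
    have := congrArg Matrix.det h5
    simp [h0] at this
  refine lt_of_le_of_ne ?_ h0.symm
  rw [h, Matrix.det_mul]
  exact mul_self_nonneg _

/-- Over `ℂ` the matrix factors as `(1 + iP)(1 - iP)`, whose determinants are complex conjugates. -/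
theorem det_one_add_sq_nonneg (P : Matrix ι ι ℝ) : 0 ≤ (1 + P * P).det := by
  have h1 : ((1 + P * P).map (algebraMap ℝ ℂ)) =
      (1 + Complex.I • P.map (algebraMap ℝ ℂ)) * (1 - Complex.I • P.map (algebraMap ℝ ℂ)) := by
    rw [Matrix.map_add _ (map_add _), Matrix.map_mul, Matrix.map_one _ (map_zero _) (map_one _)]
    have : (Complex.I • P.map (algebraMap ℝ ℂ)) * (Complex.I • P.map (algebraMap ℝ ℂ)) =
      -(P.map (algebraMap ℝ ℂ) * P.map (algebraMap ℝ ℂ)) := by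
      rw [smul_mul_smul_comm, Complex.I_mul_I, neg_smul, one_smul]
    rw [mul_sub, add_mul, add_mul, this]
    noncomm_ring
  have h2 : (1 - Complex.I • P.map (algebraMap ℝ ℂ)) =
      (1 + Complex.I • P.map (algebraMap ℝ ℂ)).map (starRingEnd ℂ) := by
    ext i j
    by_cases hij : i = j <;> simp [hij, sub_eq_add_neg]
  have h3 : ((1 + P * P).det : ℂ) =
      (Complex.normSq (1 + Complex.I • P.map (algebraMap ℝ ℂ)).det : ℂ) := by
    have : ((1 + P * P).det : ℂ) = ((1 + P * P).map (algebraMap ℝ ℂ)).det := by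
      have := RingHom.map_det (algebraMap ℝ ℂ) (1 + P * P)
      simpa using! this
    rw [this, h1, Matrix.det_mul, h2, ← RingHom.mapMatrix_apply (starRingEnd ℂ),
      ← RingHom.map_det, Complex.mul_conj]
  have h4 := Complex.ofReal_injective h3
  rw [h4]
  exact Complex.normSq_nonneg _

/-- From `2 cosh M = exp (-M) (1 + (exp M)²)`, where the first factor has positive determinant. -/
theorem det_coshSqrt_sq_nonneg (M : Matrix ι ι ℝ) : 0 ≤ (coshSqrt ℝ (M ^ 2)).det := by
  have h2 := exp_eq_cosh_add_sinh ℝ M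
  have h3 := exp_neg_eq_cosh_sub_sinh ℝ M
  have h : (2 : ℝ) • coshSqrt ℝ (M ^ 2) =
      expFun ℝ (-M) * (1 + expFun ℝ M * expFun ℝ M) := by
    have h5 : expFun ℝ (-M) * expFun ℝ M = 1 := by
      rw [← expFun_add ℝ ((Commute.refl M).neg_left), neg_add_cancel, expFun_zero]
    rw [mul_add, ← mul_assoc, h5, h2, h3, two_smul]
    noncomm_ring
  have hd : (2 : ℝ) ^ Fintype.card ι * (coshSqrt ℝ (M ^ 2)).det =
      (expFun ℝ (-M)).det * (1 + expFun ℝ M * expFun ℝ M).det := by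
    rw [← Matrix.det_smul, h, Matrix.det_mul]
  have hp : 0 ≤ (2 : ℝ) ^ Fintype.card ι * (coshSqrt ℝ (M ^ 2)).det := by
    rw [hd]
    exact mul_nonneg (det_exp_pos _).le (det_one_add_sq_nonneg _)
  exact nonneg_of_mul_nonneg_right hp (by positivity)

/-- The duplication formula `sinh 2x / 2x = cosh x · (sinh x / x)` reduces the sign at `M` to the
sign at `M / 2^r`, and for large `r` the matrix is close to `1`. -/
theorem det_sinhSqrt_sq_nonneg (M : Matrix ι ι ℝ) : 0 ≤ (sinhSqrt ℝ (M ^ 2)).det := by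
  have hs := continuous_powerSum (𝔸 := Matrix ι ι ℝ) (factorialBound_sinhCoeff (𝕜 := ℝ))
  have hev : ∀ᶠ r : ℕ in Filter.atTop,
      0 ≤ (sinhSqrt ℝ ((((1 / 2 : ℝ) ^ r) • M) ^ 2)).det := by
    have hcont : Continuous fun e : ℝ => (sinhSqrt ℝ ((e • M) ^ 2)).det :=
      Continuous.matrix_det (hs.comp (by fun_prop))
    have h0 : (0 : ℝ) < (sinhSqrt ℝ (((0 : ℝ) • M) ^ 2)).det := by
      simp [sinhSqrt, powerSum_zero, sinhCoeff]
    have := (hcont.tendsto 0).eventually (lt_mem_nhds h0)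
    have hpow : Filter.Tendsto (fun r : ℕ => (1 / 2 : ℝ) ^ r) Filter.atTop (𝓝 0) :=
      tendsto_pow_atTop_nhds_zero_of_lt_one (by norm_num) (by norm_num)
    filter_upwards [hpow.eventually this] with r hr using hr.le
  obtain ⟨r, hr⟩ := hev.exists
  suffices ∀ r : ℕ, 0 ≤ (sinhSqrt ℝ ((((1 / 2 : ℝ) ^ r) • M) ^ 2)).det →
      0 ≤ (sinhSqrt ℝ (M ^ 2)).det from this r hr
  intro r
  induction r with
  | zero => simp
  | succ r ih =>
    intro h
    refine ih ?_
    have : ((1 / 2 : ℝ) ^ r) • M = (2 : ℝ) • (((1 / 2 : ℝ) ^ (r + 1)) • M) := by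
      rw [smul_smul, pow_succ]
      congr 1
      ring
    rw [this, sinhSqrt_two_smul_sq, Matrix.det_mul]
    exact mul_nonneg (det_coshSqrt_sq_nonneg _) h

end RealMatrix

end

end CurvatureGroup

/-! ### Quadratic Lie algebras and their theta graphs. -/

namespace CurvatureGroup

noncomputable section

open Matrix
open scoped Matrix.Norms.Operator

/-- A real Lie algebra with basis indexed by `ι` and a nondegenerate invariant symmetric form. -/
structure QuadraticLieAlgebra (ι : Type*) [Fintype ι] [DecidableEq ι] where
  /-- the adjoint representation -/
  ad : (ι → ℝ) →ₗ[ℝ] Matrix ι ι ℝ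
  /-- the invariant form -/
  form : Matrix ι ι ℝ
  form_symm : formᵀ = form
  form_det : form.det ≠ 0
  skew : ∀ x y, ad x *ᵥ y = -(ad y *ᵥ x)
  jacobi : ∀ x y, ad (ad x *ᵥ y) = ad x * ad y - ad y * ad x
  invariant : ∀ x, (ad x)ᵀ * form = -(form * ad x)

variable {ι : Type*} [Fintype ι] [DecidableEq ι]

/-- The standard basis vectors. -/
def stdVec (A : ι) : ι → ℝ := Pi.single A 1

theorem trace_eq_sum_stdVec (M : Matrix ι ι ℝ) : M.trace = ∑ A, stdVec A ⬝ᵥ M *ᵥ stdVec A := by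
  simp [Matrix.trace, stdVec]

theorem sum_bilin_mulVec {V : Type*} [AddCommGroup V] [Module ℝ V]
    (Q : (ι → ℝ) →ₗ[ℝ] (ι → ℝ) →ₗ[ℝ] V) (m n : Matrix ι ι ℝ) :
    ∑ A, Q (m *ᵥ stdVec A) (n *ᵥ stdVec A) = ∑ A, Q ((m * nᵀ) *ᵥ stdVec A) (stdVec A) := by
  have hexp : ∀ x : ι → ℝ, x = ∑ B, x B • stdVec B := fun x => by
    ext C
    simp [stdVec, Finset.sum_apply, Pi.single_apply]
  have h1 : ∀ A, Q (m *ᵥ stdVec A) (n *ᵥ stdVec A) =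
      ∑ B, n B A • Q (m *ᵥ stdVec A) (stdVec B) := fun A => by
    conv_lhs => rw [hexp (n *ᵥ stdVec A)]
    simp [stdVec]
  have h2 : ∀ B, (m * nᵀ) *ᵥ stdVec B = ∑ A, n B A • (m *ᵥ stdVec A) := fun B => by
    ext C
    simp [stdVec, Matrix.mul_apply, Finset.sum_apply, mul_comm]
  simp only [h1, h2, map_sum, map_smul, LinearMap.sum_apply, LinearMap.smul_apply]
  exact Finset.sum_comm

namespace QuadraticLieAlgebra

variable (G : QuadraticLieAlgebra ι)

theorem isUnit_form_det : IsUnit G.form.det := isUnit_iff_ne_zero.mpr G.form_det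

theorem form_mul_inv : G.form * G.form⁻¹ = 1 := Matrix.mul_nonsing_inv _ G.isUnit_form_det

theorem inv_mul_form : G.form⁻¹ * G.form = 1 := Matrix.nonsing_inv_mul _ G.isUnit_form_det

theorem form_inv_symm : (G.form⁻¹)ᵀ = G.form⁻¹ := by
  rw [Matrix.transpose_nonsing_inv, G.form_symm]

/-- The adjoint of a matrix for the invariant form. -/
def adj (f : Matrix ι ι ℝ) : Matrix ι ι ℝ := G.form⁻¹ * fᵀ * G.form

/-- The invariant form as a function of two vectors. -/
def inner (x y : ι → ℝ) : ℝ := x ⬝ᵥ G.form *ᵥ y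

theorem adj_mul (f g : Matrix ι ι ℝ) : G.adj (f * g) = G.adj g * G.adj f := by
  simp only [adj, Matrix.transpose_mul]
  calc _ = G.form⁻¹ * gᵀ * 1 * fᵀ * G.form := by simp only [Matrix.mul_assoc, Matrix.one_mul]
    _ = _ := by rw [← G.form_mul_inv]; simp only [Matrix.mul_assoc]

theorem adj_one : G.adj 1 = 1 := by simp [adj, G.inv_mul_form]

theorem adj_add (f g : Matrix ι ι ℝ) : G.adj (f + g) = G.adj f + G.adj g := by
  simp [adj, Matrix.mul_add, Matrix.add_mul]

theorem adj_smul (r : ℝ) (f : Matrix ι ι ℝ) : G.adj (r • f) = r • G.adj f := by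
  simp [adj]

theorem adj_adj (f : Matrix ι ι ℝ) : G.adj (G.adj f) = f := by
  simp only [adj, Matrix.transpose_mul, Matrix.transpose_transpose, G.form_symm, G.form_inv_symm]
  calc _ = (G.form⁻¹ * G.form) * f * (G.form⁻¹ * G.form) := by simp only [Matrix.mul_assoc]
    _ = f := by simp [G.inv_mul_form]

theorem adj_ad (x : ι → ℝ) : G.adj (G.ad x) = -G.ad x := by
  rw [adj, Matrix.mul_assoc, G.invariant, Matrix.mul_neg, ← Matrix.mul_assoc, G.inv_mul_form,
    Matrix.one_mul]

theorem trace_adj (f : Matrix ι ι ℝ) : (G.adj f).trace = f.trace := by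
  rw [adj, Matrix.trace_mul_cycle, G.form_mul_inv, Matrix.one_mul, Matrix.trace_transpose]

theorem adj_pow (f : Matrix ι ι ℝ) (m : ℕ) : G.adj (f ^ m) = G.adj f ^ m := by
  induction m with
  | zero => simp [G.adj_one]
  | succ m ih => rw [pow_succ, G.adj_mul, ih, ← pow_succ']

theorem adj_powerSum {c : ℕ → ℝ} (hc : FactorialBound c) (f : Matrix ι ι ℝ) :
    G.adj (powerSum c f) = powerSum c (G.adj f) := by
  let L : Matrix ι ι ℝ →ₗ[ℝ] Matrix ι ι ℝ :=
    { toFun := G.adj, map_add' := G.adj_add, map_smul' := G.adj_smul }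
  have h := (hasSum_powerSum hc f).mapL (LinearMap.toContinuousLinearMap L)
  refine h.unique ?_
  convert! hasSum_powerSum hc (G.adj f) using 2 with m
  change G.adj (c m • f ^ m) = _
  rw [G.adj_smul, G.adj_pow]

theorem adj_inv (f : Matrix ι ι ℝ) : G.adj f⁻¹ = (G.adj f)⁻¹ := by
  have h1 : (G.form⁻¹)⁻¹ = G.form := Matrix.nonsing_inv_nonsing_inv _ G.isUnit_form_det
  rw [adj, adj, Matrix.mul_inv_rev, Matrix.mul_inv_rev, h1, Matrix.transpose_nonsing_inv,
    Matrix.mul_assoc]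

theorem inner_mulVec (f : Matrix ι ι ℝ) (x y : ι → ℝ) :
    G.inner x (f *ᵥ y) = G.inner (G.adj f *ᵥ x) y := by
  have h : (G.adj f)ᵀ * G.form = G.form * f := by
    rw [adj, Matrix.transpose_mul, Matrix.transpose_mul, Matrix.transpose_transpose, G.form_symm,
      G.form_inv_symm, Matrix.mul_assoc, Matrix.mul_assoc, G.inv_mul_form, Matrix.mul_one]
  rw [inner, inner, Matrix.mulVec_mulVec, ← h, ← Matrix.mulVec_mulVec,
    Matrix.dotProduct_mulVec x, Matrix.vecMul_transpose]

theorem inner_ad (u x y : ι → ℝ) : G.inner x (G.ad u *ᵥ y) = -G.inner (G.ad u *ᵥ x) y := by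
  rw [G.inner_mulVec, G.adj_ad, Matrix.neg_mulVec, inner, inner, neg_dotProduct]

theorem inner_inv (x y : ι → ℝ) : G.inner (G.form⁻¹ *ᵥ x) y = x ⬝ᵥ y := by
  rw [inner, ← Matrix.vecMul_transpose, G.form_inv_symm, ← Matrix.dotProduct_mulVec,
    Matrix.mulVec_mulVec, G.inv_mul_form, Matrix.one_mulVec]

theorem inner_comm (x y : ι → ℝ) : G.inner x y = G.inner y x := by
  rw [inner, inner, Matrix.dotProduct_mulVec, ← Matrix.mulVec_transpose, G.form_symm,
    dotProduct_comm]

theorem trace_eq_sum_inner (M : Matrix ι ι ℝ) :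
    M.trace = ∑ D, G.inner (G.form⁻¹ *ᵥ stdVec D) (M *ᵥ stdVec D) := by
  simp only [G.inner_inv]
  exact trace_eq_sum_stdVec M

/-- `inner` as a bilinear map. -/
def innerBilin : (ι → ℝ) →ₗ[ℝ] (ι → ℝ) →ₗ[ℝ] ℝ := Matrix.toLinearMap₂' ℝ G.form

theorem innerBilin_apply (x y : ι → ℝ) : G.innerBilin x y = G.inner x y := by
  rw [innerBilin, Matrix.toLinearMap₂'_apply', inner]

/-- Duality of the bases: the inverse form may be moved from one basis vector to the other. -/
theorem sum_bilin_form_inv {V : Type*} [AddCommGroup V] [Module ℝ V]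
    (Q : (ι → ℝ) →ₗ[ℝ] (ι → ℝ) →ₗ[ℝ] V) (m : Matrix ι ι ℝ) :
    ∑ A, Q ((m * G.form⁻¹) *ᵥ stdVec A) (stdVec A) =
      ∑ A, Q (m *ᵥ stdVec A) (G.form⁻¹ *ᵥ stdVec A) := by
  rw [sum_bilin_mulVec Q m G.form⁻¹, G.form_inv_symm]

/-- The theta graph with the matrices `f`, `g`, `h` on its edges. -/
def theta (f g h : Matrix ι ι ℝ) : ℝ :=
  ∑ A, (f * G.ad (h *ᵥ stdVec A) * g * G.ad (G.form⁻¹ *ᵥ stdVec A)).trace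

/-- Taking adjoints inside the trace reverses the product, and the signs of the two factors `ad`
cancel. -/
theorem theta_adj_swap (f g h : Matrix ι ι ℝ) :
    G.theta f g h = G.theta (G.adj g) (G.adj f) h := by
  refine Finset.sum_congr rfl fun A _ => ?_
  rw [← G.trace_adj, G.adj_mul, G.adj_mul, G.adj_mul, G.adj_ad, G.adj_ad, Matrix.neg_mul,
    Matrix.trace_neg, Matrix.trace_mul_comm]
  simp only [Matrix.mul_neg, Matrix.neg_mul, Matrix.trace_neg, neg_neg, Matrix.mul_assoc]

/-- Opening the trace puts the labels `A` and `D` on an equal footing: two brackets joined by three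
edges, each carrying one matrix. -/
theorem theta_eq_sum_inner (f g h : Matrix ι ι ℝ) :
    G.theta f g h = -∑ A, ∑ D, G.inner (G.ad (h *ᵥ stdVec A) *ᵥ (G.adj f *ᵥ stdVec D))
      (g *ᵥ (G.ad (G.form⁻¹ *ᵥ stdVec A) *ᵥ (G.form⁻¹ *ᵥ stdVec D))) := by
  rw [theta, ← Finset.sum_neg_distrib]
  refine Finset.sum_congr rfl fun A _ => ?_
  rw [G.trace_eq_sum_inner]
  let Q : (ι → ℝ) →ₗ[ℝ] (ι → ℝ) →ₗ[ℝ] ℝ :=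
    G.innerBilin.compl₁₂ (Matrix.toLin' (G.ad (h *ᵥ stdVec A)))
      (Matrix.toLin' (g * G.ad (G.form⁻¹ *ᵥ stdVec A)))
  have hQ : ∀ x y, Q x y = G.inner (G.ad (h *ᵥ stdVec A) *ᵥ x)
      (g *ᵥ (G.ad (G.form⁻¹ *ᵥ stdVec A) *ᵥ y)) := fun x y => by
    simp [Q, innerBilin_apply, Matrix.mulVec_mulVec]
  have h1 := G.sum_bilin_form_inv Q (G.adj f)
  simp only [hQ] at h1
  rw [← h1, ← Finset.sum_neg_distrib]
  refine Finset.sum_congr rfl fun D _ => ?_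
  rw [← Matrix.mulVec_mulVec, ← Matrix.mulVec_mulVec, ← Matrix.mulVec_mulVec, G.inner_mulVec,
    G.inner_ad]
  simp only [Matrix.mulVec_mulVec]

/-- Exchanging the labels `A` and `D` flips both brackets, so the two signs cancel. Together with
`theta_adj_swap` this generates all permutations of the edges. -/
theorem theta_rotate (f g h : Matrix ι ι ℝ) :
    G.theta f g h = G.theta (G.adj h) g (G.adj f) := by
  rw [theta_eq_sum_inner, theta_eq_sum_inner, Finset.sum_comm, G.adj_adj]
  congr 1
  refine Finset.sum_congr rfl fun A _ => Finset.sum_congr rfl fun D _ => ?_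
  rw [G.skew, G.skew (G.form⁻¹ *ᵥ stdVec D)]
  simp [inner, Matrix.mulVec_neg]

theorem theta_neg_left (f g h : Matrix ι ι ℝ) : G.theta (-f) g h = -G.theta f g h := by
  simp [theta, Finset.sum_neg_distrib]

theorem theta_neg_mid (f g h : Matrix ι ι ℝ) : G.theta f (-g) h = -G.theta f g h := by
  simp [theta, Finset.sum_neg_distrib]

theorem theta_neg_right (f g h : Matrix ι ι ℝ) : G.theta f g (-h) = -G.theta f g h := by
  simp [theta, Finset.sum_neg_distrib, Matrix.neg_mulVec]

theorem theta_add_right (f g h h' : Matrix ι ι ℝ) :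
    G.theta f g (h + h') = G.theta f g h + G.theta f g h' := by
  simp [theta, Finset.sum_add_distrib, Matrix.add_mulVec, Matrix.mul_add, Matrix.add_mul]

theorem theta_smul_right (r : ℝ) (f g h : Matrix ι ι ℝ) :
    G.theta f g (r • h) = r * G.theta f g h := by
  simp [theta, Finset.mul_sum, Matrix.smul_mulVec]

/-- The linear form `w ↦ tr (h ad w)` is the inner product with a sum `v` of brackets, so the left
side is `tr (h ad v)`. The Jacobi identity opens `ad v` into two theta graphs, which agree because
`h * form⁻¹` is antisymmetric. -/
theorem sum_trace_mul_trace {h : Matrix ι ι ℝ} (hh : G.adj h = -h) :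
    ∑ A, (h * G.ad (stdVec A)).trace * (h * G.ad (G.form⁻¹ *ᵥ stdVec A)).trace =
      2 * G.theta h 1 h := by
  set v : ι → ℝ := -∑ D, G.ad (stdVec D) *ᵥ ((h * G.form⁻¹) *ᵥ stdVec D) with hv
  have h1 : ∀ w, (h * G.ad w).trace = G.inner v w := by
    intro w
    rw [G.trace_eq_sum_inner, hv]
    have : G.inner (-∑ D, G.ad (stdVec D) *ᵥ ((h * G.form⁻¹) *ᵥ stdVec D)) w =
        ∑ D, -G.inner (G.ad (stdVec D) *ᵥ ((h * G.form⁻¹) *ᵥ stdVec D)) w := by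
      rw [← innerBilin_apply, map_neg, map_sum]
      simp [innerBilin_apply, LinearMap.sum_apply]
    rw [this]
    refine Finset.sum_congr rfl fun D _ => ?_
    rw [← G.inner_ad, ← Matrix.mulVec_mulVec, G.inner_mulVec, hh, G.skew w, Matrix.mulVec_mulVec,
      ← innerBilin_apply, ← innerBilin_apply]
    simp [Matrix.neg_mulVec]
  have h2 : ∑ A, (h * G.ad (stdVec A)).trace * (h * G.ad (G.form⁻¹ *ᵥ stdVec A)).trace =
      (h * G.ad v).trace := by
    have hvA : ∀ A, (h * G.ad (G.form⁻¹ *ᵥ stdVec A)).trace = v A := by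
      intro A
      rw [h1, G.inner_comm, G.inner_inv]
      simp [stdVec]
    have hexp : v = ∑ A, v A • stdVec A := by
      ext C
      simp [stdVec, Finset.sum_apply, Pi.single_apply]
    conv_rhs => rw [hexp]
    simp only [hvA, map_sum, map_smul, Matrix.mul_sum, Matrix.trace_sum, Matrix.mul_smul,
      Matrix.trace_smul, smul_eq_mul, mul_comm]
  let Q : (ι → ℝ) →ₗ[ℝ] (ι → ℝ) →ₗ[ℝ] ℝ := LinearMap.mk₂ ℝ
    (fun x y => (h * (G.ad x * G.ad y)).trace)
    (fun x y z => by simp [Matrix.mul_add, Matrix.add_mul]) (fun r x y => by simp)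
    (fun x y z => by simp [Matrix.mul_add]) (fun r x y => by simp)
  have hQ : ∀ x y, Q x y = (h * (G.ad x * G.ad y)).trace := fun x y => rfl
  have h3 : (h * G.ad v).trace = -∑ D, Q (stdVec D) ((h * G.form⁻¹) *ᵥ stdVec D) +
      ∑ D, Q ((h * G.form⁻¹) *ᵥ stdVec D) (stdVec D) := by
    rw [hv, map_neg, map_sum, ← sub_eq_neg_add, ← Finset.sum_sub_distrib, Matrix.mul_neg,
      Matrix.mul_sum, Matrix.trace_neg, Matrix.trace_sum, ← Finset.sum_neg_distrib]
    refine Finset.sum_congr rfl fun D _ => ?_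
    rw [hQ, hQ, G.jacobi, Matrix.mul_sub, Matrix.trace_sub]
    ring
  have h4 : ∑ D, Q ((h * G.form⁻¹) *ᵥ stdVec D) (stdVec D) = G.theta h 1 h := by
    rw [G.sum_bilin_form_inv]
    refine Finset.sum_congr rfl fun A _ => ?_
    rw [hQ, Matrix.mul_one, Matrix.mul_assoc]
  have h5 : h * G.form⁻¹ = -(G.form⁻¹ * hᵀ) := by
    have : G.adj h * G.form⁻¹ = G.form⁻¹ * hᵀ := by
      rw [adj, Matrix.mul_assoc, G.form_mul_inv, Matrix.mul_one]
    rw [← this, hh, Matrix.neg_mul, neg_neg]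
  have h6 : ∑ D, Q (stdVec D) ((h * G.form⁻¹) *ᵥ stdVec D) =
      -∑ D, Q ((h * G.form⁻¹) *ᵥ stdVec D) (stdVec D) := by
    have h7 := sum_bilin_mulVec Q 1 (h * G.form⁻¹)
    have h8 : (1 : Matrix ι ι ℝ) * (h * G.form⁻¹)ᵀ = -(h * G.form⁻¹) := by
      rw [Matrix.one_mul, Matrix.transpose_mul, G.form_inv_symm, h5, neg_neg]
    rw [h8] at h7
    simp only [Matrix.one_mulVec] at h7
    rw [h7]
    simp [Matrix.neg_mulVec, Finset.sum_neg_distrib]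
  rw [h2, h3, h6, h4]
  ring

end QuadraticLieAlgebra

end

end CurvatureGroup

/-! ### The function `coth (x/2)/2 - 1/x` and the addition theorem on the adjoint representation. -/

namespace CurvatureGroup

noncomputable section

open Matrix
open scoped Matrix.Norms.Operator

variable {ι : Type*} [Fintype ι] [DecidableEq ι]

/-- The logarithmic derivative of `(1 - exp (-x)) / x`. -/
def logDer (M : Matrix ι ι ℝ) : Matrix ι ι ℝ := (leftFun ℝ M)⁻¹ * leftFunDeriv ℝ M

/-- `coth (x / 2) / 2 - 1 / x`. -/
def oddLog (M : Matrix ι ι ℝ) : Matrix ι ι ℝ := logDer M + (1 / 2 : ℝ) • 1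

/-- The derivative of `logDer` as a two-sided divided difference. -/
def logDerDiff (M N V : Matrix ι ι ℝ) : Matrix ι ι ℝ :=
  (leftFun ℝ M)⁻¹ * (dividedDiff (derivCoeff (leftCoeff ℝ)) M N V
    - dividedDiff (leftCoeff ℝ) M N V * logDer N)

theorem continuous_leftFun : Continuous (leftFun ℝ : Matrix ι ι ℝ → Matrix ι ι ℝ) :=
  continuous_powerSum factorialBound_leftCoeff

theorem continuous_leftFunDeriv : Continuous (leftFunDeriv ℝ : Matrix ι ι ℝ → Matrix ι ι ℝ) :=
  continuous_powerSum factorialBound_leftCoeff.deriv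

theorem commute_leftFun {x M : Matrix ι ι ℝ} (h : Commute x M) : Commute x (leftFun ℝ M) :=
  commute_powerSum factorialBound_leftCoeff h

theorem commute_leftFunDeriv {x M : Matrix ι ι ℝ} (h : Commute x M) :
    Commute x (leftFunDeriv ℝ M) :=
  commute_powerSum factorialBound_leftCoeff.deriv h

theorem commute_leftFun_leftFunDeriv (M : Matrix ι ι ℝ) :
    Commute (leftFun ℝ M) (leftFunDeriv ℝ M) :=
  commute_leftFunDeriv (commute_leftFun (Commute.refl M)).symm

theorem commute_inv {x M : Matrix ι ι ℝ} (h : Commute x M) : Commute x M⁻¹ := by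
  by_cases hM : IsUnit M.det
  · have h1 := Matrix.nonsing_inv_mul M hM
    have h2 := Matrix.mul_nonsing_inv M hM
    change x * M⁻¹ = M⁻¹ * x
    calc x * M⁻¹ = (M⁻¹ * M) * x * M⁻¹ := by rw [h1, one_mul]
      _ = M⁻¹ * (x * M) * M⁻¹ := by rw [h.eq, mul_assoc M⁻¹ M x]
      _ = M⁻¹ * x := by rw [mul_assoc, mul_assoc, h2, mul_one]
  · rw [Matrix.nonsing_inv_apply_not_isUnit M hM]
    exact Commute.zero_right x

theorem logDer_eq (M : Matrix ι ι ℝ) : logDer M = leftFunDeriv ℝ M * (leftFun ℝ M)⁻¹ :=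
  ((commute_inv (commute_leftFun_leftFunDeriv M).symm).eq).symm

theorem commute_logDer {x M : Matrix ι ι ℝ} (h : Commute x M) : Commute x (logDer M) :=
  (commute_inv (commute_leftFun h)).mul_right (commute_leftFunDeriv h)

theorem leftFun_neg (M : Matrix ι ι ℝ) : leftFun ℝ (-M) = expFun ℝ M * leftFun ℝ M := by
  have he := continuous_powerSum (𝔸 := Matrix ι ι ℝ) (factorialBound_expCoeff (𝕜 := ℝ))
  refine eq_of_mul_eq_mul (F := fun M => leftFun ℝ (-M)) (G := fun M => expFun ℝ M * leftFun ℝ M)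
    (continuous_leftFun.comp continuous_neg) (he.mul continuous_leftFun) (fun M => ?_) M
  have h1 := mul_leftFun ℝ (-M)
  have h2 := mul_leftFun ℝ M
  have hc : Commute M (expFun ℝ M) := commute_powerSum factorialBound_expCoeff (Commute.refl M)
  have h5 : expFun ℝ M * expFun ℝ (-M) = 1 := by
    rw [← expFun_add ℝ ((Commute.refl M).neg_right), add_neg_cancel, expFun_zero]
  change M * leftFun ℝ (-M) = M * (expFun ℝ M * leftFun ℝ M)
  rw [← mul_assoc, hc.eq, mul_assoc, h2, mul_sub, h5, mul_one]
  rw [neg_neg, neg_mul] at h1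
  rw [← neg_inj, h1]
  abel

/-- The logarithmic derivative of `leftFun (-x) = exp x * leftFun x`, with denominators cleared so
that no invertibility is needed. -/
theorem leftFunDeriv_neg_mul (M : Matrix ι ι ℝ) :
    leftFunDeriv ℝ (-M) * leftFun ℝ M =
      -((leftFunDeriv ℝ M + leftFun ℝ M) * leftFun ℝ (-M)) := by
  refine eq_of_mul_eq_mul (F := fun M => leftFunDeriv ℝ (-M) * leftFun ℝ M)
    (G := fun M => -((leftFunDeriv ℝ M + leftFun ℝ M) * leftFun ℝ (-M)))
    ((continuous_leftFunDeriv.comp continuous_neg).mul continuous_leftFun)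
    (((continuous_leftFunDeriv.add continuous_leftFun).mul
      (continuous_leftFun.comp continuous_neg)).neg) (fun M => ?_) M
  have h1 := leftFun_add_mul_deriv ℝ (-M)
  have h2 := leftFun_add_mul_deriv ℝ M
  have h3 := mul_leftFun ℝ M
  have h4 := leftFun_neg M
  have hc : Commute (leftFun ℝ M) (leftFun ℝ (-M)) :=
    commute_leftFun (commute_leftFun (Commute.refl M)).symm.neg_right
  rw [neg_neg, neg_mul] at h1
  have h1' : M * leftFunDeriv ℝ (-M) = leftFun ℝ (-M) - expFun ℝ M := by
    rw [← h1]; abel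
  have h2' : M * (leftFunDeriv ℝ M + leftFun ℝ M) = 1 - leftFun ℝ M := by
    rw [mul_add, h3, ← h2]; abel
  change M * (leftFunDeriv ℝ (-M) * leftFun ℝ M) =
    M * -((leftFunDeriv ℝ M + leftFun ℝ M) * leftFun ℝ (-M))
  rw [mul_neg, ← mul_assoc, ← mul_assoc, h1', h2', sub_mul, sub_mul, ← h4, hc.eq, one_mul]
  abel

theorem isUnit_expFun (M : Matrix ι ι ℝ) : IsUnit (expFun ℝ M) := by
  rw [Matrix.isUnit_iff_isUnit_det, isUnit_iff_ne_zero]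
  exact (det_exp_pos M).ne'

theorem isUnit_leftFun_neg {M : Matrix ι ι ℝ} (h : IsUnit (leftFun ℝ M)) :
    IsUnit (leftFun ℝ (-M)) := by
  rw [leftFun_neg]
  exact (isUnit_expFun M).mul h

theorem inv_mul_of_isUnit {M : Matrix ι ι ℝ} (h : IsUnit M) : M⁻¹ * M = 1 :=
  Matrix.nonsing_inv_mul M ((Matrix.isUnit_iff_isUnit_det M).mp h)

theorem mul_inv_of_isUnit {M : Matrix ι ι ℝ} (h : IsUnit M) : M * M⁻¹ = 1 :=
  Matrix.mul_nonsing_inv M ((Matrix.isUnit_iff_isUnit_det M).mp h)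

/-- The summand `1/2` in `oddLog` is chosen to split evenly the constant in `logDer (-M) = -(logDer
M + 1)`. Oddness makes `oddLog (ad k)` anti-self-adjoint for the invariant form. -/
theorem oddLog_neg {M : Matrix ι ι ℝ} (h : IsUnit (leftFun ℝ M)) :
    oddLog (-M) = -oddLog M := by
  have h' := isUnit_leftFun_neg h
  have h1 : logDer (-M) = -(logDer M + 1) := by
    have e1 : leftFunDeriv ℝ (-M) =
        -((leftFunDeriv ℝ M + leftFun ℝ M) * leftFun ℝ (-M)) * (leftFun ℝ M)⁻¹ := by
      rw [← leftFunDeriv_neg_mul, mul_assoc, mul_inv_of_isUnit h, mul_one]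
    have hc : Commute (leftFun ℝ (-M)) (leftFun ℝ M)⁻¹ :=
      commute_inv (commute_leftFun (commute_leftFun (Commute.refl M).neg_right).symm)
    rw [logDer_eq, e1, logDer_eq M, neg_mul, neg_mul, mul_assoc _ (leftFun ℝ (-M)), hc.eq]
    simp only [mul_assoc]
    rw [mul_inv_of_isUnit h', mul_one, add_mul, mul_inv_of_isUnit h]
  rw [oddLog, oddLog, h1]
  have : (1 : Matrix ι ι ℝ) = (1 / 2 : ℝ) • 1 + (1 / 2 : ℝ) • 1 := by
    rw [← add_smul]; norm_num
  nth_rewrite 1 [this]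
  abel

/-- Separates the cotangent from the pole `1/x`, each of which has its own addition theorem. The
separation requires `M` itself to be invertible, which is why `ad k` is shifted below. -/
theorem oddLog_eq_of_isUnit {M : Matrix ι ι ℝ} (hM : IsUnit M) (h : IsUnit (leftFun ℝ M)) :
    oddLog M = (1 - expFun ℝ (-M))⁻¹ - (1 / 2 : ℝ) • 1 - M⁻¹ := by
  have h1 := mul_leftFun ℝ M
  have h2 := leftFun_add_mul_deriv ℝ M
  have hU : IsUnit (1 - expFun ℝ (-M)) := h1 ▸ hM.mul h
  have h3 : leftFunDeriv ℝ M = M⁻¹ * (expFun ℝ (-M) - leftFun ℝ M) := by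
    rw [← h2, add_sub_cancel_left, ← mul_assoc, inv_mul_of_isUnit hM, one_mul]
  have h4 : (1 - expFun ℝ (-M))⁻¹ = (leftFun ℝ M)⁻¹ * M⁻¹ := by
    rw [← h1, Matrix.mul_inv_rev]
  have hc : Commute M⁻¹ (leftFun ℝ M) :=
    (commute_inv (commute_leftFun (Commute.refl M)).symm).symm
  have h5 : (1 - expFun ℝ (-M))⁻¹ * expFun ℝ (-M) = (1 - expFun ℝ (-M))⁻¹ - 1 := by
    have := inv_mul_of_isUnit hU
    rw [mul_sub, mul_one] at this
    exact (sub_eq_iff_eq_add.mpr (sub_eq_iff_eq_add'.mp this)).symm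
  have h6 : logDer M = (1 - expFun ℝ (-M))⁻¹ - 1 - M⁻¹ := by
    rw [logDer, h3, mul_sub, mul_sub, ← mul_assoc, ← h4, h5, hc.eq, ← mul_assoc,
      inv_mul_of_isUnit h, one_mul]
  rw [oddLog, h6]
  have : (1 : Matrix ι ι ℝ) = (1 / 2 : ℝ) • 1 + (1 / 2 : ℝ) • 1 := by
    rw [← add_smul]; norm_num
  nth_rewrite 2 [this]
  abel

/-- The quotient rule carries `dividedDiff_commutator` over from `leftFun` and its derivative to
their quotient. -/
theorem logDerDiff_commutator {M N : Matrix ι ι ℝ} (hM : IsUnit (leftFun ℝ M))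
    (hN : IsUnit (leftFun ℝ N)) (u : Matrix ι ι ℝ) :
    logDerDiff M N (M * u - u * N) = logDer M * u - u * logDer N := by
  rw [logDerDiff, dividedDiff_commutator factorialBound_leftCoeff,
    dividedDiff_commutator factorialBound_leftCoeff.deriv]
  change (leftFun ℝ M)⁻¹ * (leftFunDeriv ℝ M * u - u * leftFunDeriv ℝ N
    - (leftFun ℝ M * u - u * leftFun ℝ N) * logDer N) = _
  have h1 : leftFun ℝ N * logDer N = leftFunDeriv ℝ N := by
    rw [logDer, ← mul_assoc, mul_inv_of_isUnit hN, one_mul]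
  rw [sub_mul, mul_assoc u, h1, mul_sub, mul_sub, mul_sub, ← mul_assoc, ← mul_assoc _ (_ * u),
    ← mul_assoc _ (leftFun ℝ M) u, inv_mul_of_isUnit hM, one_mul]
  change logDer M * u - _ - _ = _
  abel

theorem tendsto_leftFun_shift (M : Matrix ι ι ℝ) (a : ℝ) :
    Filter.Tendsto (fun ε : ℝ => M + (a * ε) • (1 : Matrix ι ι ℝ)) (𝓝[≠] 0) (𝓝 M) := by
  have : Continuous fun ε : ℝ => M + (a * ε) • (1 : Matrix ι ι ℝ) := by fun_prop
  have h0 := (this.tendsto 0).mono_left (nhdsWithin_le_nhds (s := {0}ᶜ))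
  simpa using h0

theorem continuousAt_inv {M : Matrix ι ι ℝ} (h : IsUnit M) :
    ContinuousAt (fun N : Matrix ι ι ℝ => N⁻¹) M := by
  have : (fun N : Matrix ι ι ℝ => N⁻¹) = Ring.inverse := by
    funext N
    exact Matrix.nonsing_inv_eq_ringInverse N
  rw [this]
  obtain ⟨u, rfl⟩ := h
  exact NormedRing.inverse_continuousAt u

theorem continuousAt_logDer {M : Matrix ι ι ℝ} (h : IsUnit (leftFun ℝ M)) :
    ContinuousAt logDer M :=
  ContinuousAt.mul ((continuousAt_inv h).comp (f := leftFun ℝ) continuous_leftFun.continuousAt)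
    continuous_leftFunDeriv.continuousAt

theorem continuousAt_oddLog {M : Matrix ι ι ℝ} (h : IsUnit (leftFun ℝ M)) :
    ContinuousAt oddLog M :=
  (continuousAt_logDer h).add continuousAt_const

theorem tendsto_logDerDiff {M : Matrix ι ι ℝ} (h : IsUnit (leftFun ℝ M)) (a b : ℝ)
    (V : Matrix ι ι ℝ) :
    Filter.Tendsto (fun ε : ℝ => logDerDiff (M + (a * ε) • (1 : Matrix ι ι ℝ))
      (M + (b * ε) • (1 : Matrix ι ι ℝ)) V) (𝓝[≠] 0) (𝓝 (logDerDiff M M V)) := by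
  have ha := tendsto_leftFun_shift M a
  have hb := tendsto_leftFun_shift M b
  have hab := ha.prodMk_nhds hb
  have h1 := ((continuousAt_inv h).comp (f := leftFun ℝ)
    continuous_leftFun.continuousAt).tendsto.comp ha
  have h2 := ((continuous_dividedDiff (factorialBound_leftCoeff (𝕜 := ℝ)).deriv V).tendsto (M, M)).comp hab
  have h3 := ((continuous_dividedDiff (factorialBound_leftCoeff (𝕜 := ℝ)) V).tendsto (M, M)).comp hab
  have h4 := (continuousAt_logDer h).tendsto.comp hb
  exact h1.mul (h2.sub (h3.mul h4))

theorem eventually_isUnit_leftFun {M : Matrix ι ι ℝ} (h : IsUnit (leftFun ℝ M)) (a : ℝ) :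
    ∀ᶠ ε : ℝ in 𝓝[≠] 0, IsUnit (leftFun ℝ (M + (a * ε) • (1 : Matrix ι ι ℝ))) := by
  have h1 : Filter.Tendsto (fun ε : ℝ => leftFun ℝ (M + (a * ε) • (1 : Matrix ι ι ℝ)))
      (𝓝[≠] 0) (𝓝 (leftFun ℝ M)) :=
    (continuous_leftFun.tendsto M).comp (tendsto_leftFun_shift M a)
  exact h1.eventually (Units.isOpen.mem_nhds h)

namespace QuadraticLieAlgebra

variable (G : QuadraticLieAlgebra ι)

theorem adj_oddLog (M : Matrix ι ι ℝ) : G.adj (oddLog M) = oddLog (G.adj M) := by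
  rw [oddLog, G.adj_add, G.adj_smul, G.adj_one, oddLog, logDer, G.adj_mul, G.adj_inv, logDer_eq,
    leftFunDeriv, leftFun, G.adj_powerSum factorialBound_leftCoeff,
    G.adj_powerSum factorialBound_leftCoeff.deriv]
  rfl

/-- The Jacobi identity survives the scalar shifts if the third argument is shifted by `a - b`, so
it can be used with invertible matrices. -/
theorem jacobi_shift (k v : ι → ℝ) (a b : ℝ) :
    (G.ad k + a • (1 : Matrix ι ι ℝ)) * G.ad v - G.ad v * (G.ad k + b • (1 : Matrix ι ι ℝ)) =
      G.ad ((G.ad k + (a - b) • (1 : Matrix ι ι ℝ)) *ᵥ v) := by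
  rw [Matrix.add_mulVec, map_add, G.jacobi, Matrix.smul_mulVec, Matrix.one_mulVec, map_smul,
    sub_smul, add_mul, mul_add]
  simp only [smul_mul_assoc, mul_smul_comm, one_mul, mul_one]
  abel

/-- The product `exp (s C₁) · ad (exp (-s C₃) v) · exp (-s C₂)` has zero derivative in `s` by `h`;
its values at `0` and `1` are compared. -/
theorem exp_intertwine {C₁ C₂ C₃ : Matrix ι ι ℝ}
    (h : ∀ v, C₁ * G.ad v - G.ad v * C₂ = G.ad (C₃ *ᵥ v)) (v : ι → ℝ) :
    expFun ℝ (-C₁) * G.ad v = G.ad (expFun ℝ (-C₃) *ᵥ v) * expFun ℝ (-C₂) := by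
  have hd : ∀ (M : Matrix ι ι ℝ) (s : ℝ), HasDerivAt (fun s : ℝ => expFun ℝ (s • M))
      (M * expFun ℝ (s • M)) s := by
    intro M s
    simp only [expFun_eq_exp]
    exact hasDerivAt_exp_smul_const' M s
  have hd' : ∀ (M : Matrix ι ι ℝ) (s : ℝ), HasDerivAt (fun s : ℝ => expFun ℝ (s • M))
      (expFun ℝ (s • M) * M) s := by
    intro M s
    simp only [expFun_eq_exp]
    exact hasDerivAt_exp_smul_const M s
  let L : Matrix ι ι ℝ →ₗ[ℝ] Matrix ι ι ℝ :=
    { toFun := fun M => G.ad (M *ᵥ v)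
      map_add' := fun M N => by rw [Matrix.add_mulVec, map_add]
      map_smul' := fun r M => by rw [Matrix.smul_mulVec, map_smul]; rfl }
  have hL : ∀ s, HasDerivAt (fun s : ℝ => G.ad (expFun ℝ (s • (-C₃)) *ᵥ v))
      (G.ad ((-C₃ * expFun ℝ (s • (-C₃))) *ᵥ v)) s := fun s =>
    (LinearMap.toContinuousLinearMap L).hasFDerivAt.comp_hasDerivAt s (hd (-C₃) s)
  let f : ℝ → Matrix ι ι ℝ := fun s =>
    expFun ℝ (s • C₁) * G.ad (expFun ℝ (s • (-C₃)) *ᵥ v) * expFun ℝ (s • (-C₂))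
  have hf : ∀ s, HasDerivAt f 0 s := by
    intro s
    have := ((hd' C₁ s).mul (hL s)).mul (hd (-C₂) s)
    convert! this using 1
    set w := expFun ℝ (s • (-C₃)) *ᵥ v
    have e1 : G.ad ((-C₃ * expFun ℝ (s • (-C₃))) *ᵥ v) = -(C₁ * G.ad w - G.ad w * C₂) := by
      rw [h w, ← Matrix.mulVec_mulVec, Matrix.neg_mulVec, map_neg]
    rw [e1]
    change 0 = (expFun ℝ (s • C₁) * C₁ * G.ad w + expFun ℝ (s • C₁) *
      -(C₁ * G.ad w - G.ad w * C₂)) * expFun ℝ (s • (-C₂)) +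
      expFun ℝ (s • C₁) * G.ad w * (-C₂ * expFun ℝ (s • (-C₂)))
    noncomm_ring
  have hconst := is_const_of_deriv_eq_zero (fun s => (hf s).differentiableAt)
    (fun s => (hf s).deriv) 1 0
  have h0 : f 0 = G.ad v := by simp [f, expFun_zero]
  have h1 : f 1 = expFun ℝ C₁ * G.ad (expFun ℝ (-C₃) *ᵥ v) * expFun ℝ (-C₂) := by simp [f]
  rw [← h0, ← hconst, h1, ← mul_assoc, ← mul_assoc]
  rw [← expFun_add ℝ ((Commute.refl C₁).neg_left), neg_add_cancel, expFun_zero, one_mul]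

/-- The addition theorem of the hyperbolic cotangent, for the adjoint action. -/
theorem coth_identity {S₁ S₂ S₃ U₁ U₂ U₃ : Matrix ι ι ℝ} (hS₁ : (1 - U₁) * S₁ = 1)
    (hS₂ : S₂ * (1 - U₂) = 1) (hS₃ : (1 - U₃) * S₃ = 1)
    (hU : ∀ v, U₁ * G.ad v = G.ad (U₃ *ᵥ v) * U₂) (v : ι → ℝ) :
    G.ad (S₃ *ᵥ v) * S₂ + S₁ * G.ad v = S₁ * G.ad v * S₂ + S₁ * G.ad (S₃ *ᵥ v) := by
  set w := S₃ *ᵥ v with hw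
  have hv : v = w - U₃ *ᵥ w := by
    rw [hw, Matrix.mulVec_mulVec, ← Matrix.sub_mulVec, ← one_sub_mul, hS₃,
      Matrix.one_mulVec]
  have hS₁' : S₁ * (1 - U₁) = 1 := mul_eq_one_comm.mp hS₁
  have hS₂' : (1 - U₂) * S₂ = 1 := mul_eq_one_comm.mp hS₂
  -- With `v = w - U₃ w` the intertwining relation cancels the terms `ad (U₃ w) U₂`; the claim is
  -- this relation between `S₁` and `S₂`.
  have key : (1 - U₁) * G.ad w + G.ad v * (1 - U₂) = G.ad v + G.ad w * (1 - U₂) := by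
    rw [hv, map_sub, sub_mul, hU w]
    noncomm_ring
  have := congrArg (fun M => S₁ * M * S₂) key
  calc G.ad w * S₂ + S₁ * G.ad v
      = (S₁ * (1 - U₁)) * G.ad w * S₂ + S₁ * G.ad v * ((1 - U₂) * S₂) := by
        rw [hS₁', hS₂', one_mul, mul_one]
    _ = S₁ * ((1 - U₁) * G.ad w + G.ad v * (1 - U₂)) * S₂ := by noncomm_ring
    _ = S₁ * (G.ad v + G.ad w * (1 - U₂)) * S₂ := this
    _ = S₁ * G.ad v * S₂ + S₁ * G.ad w * ((1 - U₂) * S₂) := by noncomm_ring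
    _ = _ := by rw [hS₂', mul_one]

/-- Noncommutative form of `1/(x₁x₃) + 1/(x₁x₂) = 1/(x₂x₃)` for `x₁ = x₂ + x₃`. -/
theorem inv_identity {C₁ C₂ C₃ I₁ I₂ I₃ : Matrix ι ι ℝ} (h₁ : I₁ * C₁ = 1)
    (h₂ : C₂ * I₂ = 1) (h₃ : C₃ * I₃ = 1)
    (h : ∀ v, C₁ * G.ad v - G.ad v * C₂ = G.ad (C₃ *ᵥ v)) (v : ι → ℝ) :
    I₁ * G.ad (I₃ *ᵥ v) + I₁ * G.ad v * I₂ = G.ad (I₃ *ᵥ v) * I₂ := by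
  set w := I₃ *ᵥ v with hw
  have hv : v = C₃ *ᵥ w := by rw [hw, Matrix.mulVec_mulVec, h₃, Matrix.one_mulVec]
  rw [hv, ← h w, mul_sub, ← mul_assoc, h₁, one_mul, sub_mul, mul_assoc I₁, mul_assoc (G.ad w),
    h₂, mul_one]
  abel

/-- The pointwise identity behind the eigenvalue equation of `j ^ (1 / 2)`. -/
theorem odd_identity {S₁ S₂ S₃ I₁ I₂ I₃ H₁ H₂ H₃ : Matrix ι ι ℝ} {v : ι → ℝ}
    (hS : G.ad (S₃ *ᵥ v) * S₂ + S₁ * G.ad v = S₁ * G.ad v * S₂ + S₁ * G.ad (S₃ *ᵥ v))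
    (hI : I₁ * G.ad (I₃ *ᵥ v) + I₁ * G.ad v * I₂ = G.ad (I₃ *ᵥ v) * I₂)
    (h₁ : H₁ = S₁ - (1 / 2 : ℝ) • 1 - I₁) (h₂ : H₂ = S₂ - (1 / 2 : ℝ) • 1 - I₂)
    (h₃ : H₃ = S₃ - (1 / 2 : ℝ) • 1 - I₃) :
    -(H₁ * G.ad v * H₂) + G.ad (H₃ *ᵥ v) * H₂ - H₁ * G.ad (H₃ *ᵥ v) + (1 / 4 : ℝ) • G.ad v =
      (H₁ * G.ad (I₃ *ᵥ v) - G.ad (I₃ *ᵥ v) * H₂) + (I₁ * G.ad v * H₂ + I₁ * G.ad (H₃ *ᵥ v))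
        + (H₁ * G.ad v * I₂ - G.ad (H₃ *ᵥ v) * I₂) := by
  have e3 : G.ad (H₃ *ᵥ v) = G.ad (S₃ *ᵥ v) - (1 / 2 : ℝ) • G.ad v - G.ad (I₃ *ᵥ v) := by
    rw [h₃, Matrix.sub_mulVec, Matrix.sub_mulVec, Matrix.smul_mulVec, Matrix.one_mulVec, map_sub,
      map_sub, map_smul]
  rw [e3]
  generalize G.ad (S₃ *ᵥ v) = s at *
  generalize G.ad (I₃ *ᵥ v) = i at *
  generalize G.ad v = x at *
  subst h₁ h₂
  rw [← sub_eq_zero] at hS hI ⊢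
  -- The difference of the two sides of the goal is the sum of the defects of the cotangent relation
  -- and of the partial fraction relation.
  have h2 : (0 : Matrix ι ι ℝ) = (s * S₂ + S₁ * x - (S₁ * x * S₂ + S₁ * s)) +
      (I₁ * i + I₁ * x * I₂ - i * I₂) := by rw [hS, hI, add_zero]
  rw [h2]
  simp only [sub_mul, mul_sub, smul_mul_assoc, mul_smul_comm, one_mul, mul_one, smul_sub,
    smul_smul]
  module

end QuadraticLieAlgebra

end

end CurvatureGroup

/-! ### The eigenvalue equation for the Jacobian, as a limit of shifted identities. -/

namespace CurvatureGroup

noncomputable section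

open Matrix
open scoped Matrix.Norms.Operator

variable {ι : Type*} [Fintype ι] [DecidableEq ι]

theorem dividedDiff_add {c : ℕ → ℝ} (hc : FactorialBound c) (M N V V' : Matrix ι ι ℝ) :
    dividedDiff c M N (V + V') = dividedDiff c M N V + dividedDiff c M N V' := by
  refine (hasSum_dividedDiff hc M N (V + V')).unique ?_
  convert! (hasSum_dividedDiff hc M N V).add (hasSum_dividedDiff hc M N V') using 2 with m
  rw [← smul_add, ← Finset.sum_add_distrib]
  congr 1
  refine Finset.sum_congr rfl fun i _ => ?_
  rw [mul_add, add_mul]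

theorem logDerDiff_add (M N V V' : Matrix ι ι ℝ) :
    logDerDiff M N (V + V') = logDerDiff M N V + logDerDiff M N V' := by
  simp only [logDerDiff, dividedDiff_add factorialBound_leftCoeff,
    dividedDiff_add factorialBound_leftCoeff.deriv]
  noncomm_ring

namespace QuadraticLieAlgebra

variable (G : QuadraticLieAlgebra ι)

theorem trace_ad (x : ι → ℝ) : (G.ad x).trace = 0 := by
  have h := G.trace_adj (G.ad x)
  rw [G.adj_ad, Matrix.trace_neg] at h
  linarith

theorem continuous_theta : Continuous fun q : Matrix ι ι ℝ × Matrix ι ι ℝ × Matrix ι ι ℝ =>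
    G.theta q.1 q.2.1 q.2.2 := by
  have had : Continuous G.ad := G.ad.continuous_of_finiteDimensional
  refine continuous_finsetSum _ fun A _ => ?_
  refine Continuous.matrix_trace ?_
  refine Continuous.mul (Continuous.mul (Continuous.mul continuous_fst (had.comp ?_)) ?_)
    continuous_const
  · exact Continuous.matrix_mulVec (continuous_snd.comp continuous_snd) continuous_const
  · exact continuous_fst.comp continuous_snd

section

variable (k : ι → ℝ)

/-- `h (C(k) + a)`. -/
def oddAt (a : ℝ) : Matrix ι ι ℝ := oddLog (G.ad k + a • (1 : Matrix ι ι ℝ))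

/-- `(C(k) + a)⁻¹`. -/
def invAt (a : ℝ) : Matrix ι ι ℝ := (G.ad k + a • (1 : Matrix ι ι ℝ))⁻¹

/-- The contraction of the divided difference of `h` at shifted arguments. -/
def bracket (a b : ℝ) : ℝ :=
  G.theta (G.oddAt k a) 1 (G.invAt k (a - b)) - G.theta 1 (G.oddAt k b) (G.invAt k (a - b))

/-- The contraction of the derivative of `h`. -/
def diffTrace : ℝ :=
  ∑ A, (logDerDiff (G.ad k) (G.ad k) (G.ad (stdVec A)) * G.ad (G.form⁻¹ *ᵥ stdVec A)).trace

theorem adj_shift (a : ℝ) : G.adj (G.ad k + a • (1 : Matrix ι ι ℝ)) =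
    -(G.ad k + (-a) • (1 : Matrix ι ι ℝ)) := by
  rw [G.adj_add, G.adj_ad, G.adj_smul, G.adj_one, neg_smul, neg_add, neg_neg]

theorem adj_invAt (a : ℝ) : G.adj (G.invAt k a) = -G.invAt k (-a) := by
  have hneg : ∀ M : Matrix ι ι ℝ, (-M)⁻¹ = -M⁻¹ := fun M => by
    by_cases h : IsUnit M.det
    · refine Matrix.inv_eq_right_inv ?_
      rw [neg_mul_neg, Matrix.mul_nonsing_inv M h]
    · have h' : ¬ IsUnit (-M).det := by
        rw [Matrix.det_neg, IsUnit.mul_iff]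
        exact fun h'' => h h''.2
      rw [Matrix.nonsing_inv_apply_not_isUnit _ h, Matrix.nonsing_inv_apply_not_isUnit _ h',
        neg_zero]
  rw [invAt, G.adj_inv, adj_shift, hneg, invAt]

theorem adj_oddAt {a : ℝ} (h : IsUnit (leftFun ℝ (G.ad k + (-a) • (1 : Matrix ι ι ℝ)))) :
    G.adj (G.oddAt k a) = -G.oddAt k (-a) := by
  rw [oddAt, G.adj_oddLog, adj_shift, oddLog_neg h, oddAt]

variable {k}

/-- With `w = (C + a - b)⁻¹ v` one has `ad v = (C + a) ad w - ad w (C + b)`. So `bracket` is the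
contraction of a genuine divided difference, whose limit does not depend on the ratio of the shifts.
-/
theorem tendsto_bracket (hk : IsUnit (leftFun ℝ (G.ad k))) {a b : ℝ} (hab : a ≠ b) :
    Filter.Tendsto (fun ε : ℝ => G.bracket k (a * ε) (b * ε)) (𝓝[≠] 0) (𝓝 (G.diffTrace k)) := by
  have hlim : Filter.Tendsto (fun ε : ℝ => ∑ A, (logDerDiff
      (G.ad k + (a * ε) • (1 : Matrix ι ι ℝ)) (G.ad k + (b * ε) • (1 : Matrix ι ι ℝ))
      (G.ad (stdVec A)) * G.ad (G.form⁻¹ *ᵥ stdVec A)).trace) (𝓝[≠] 0) (𝓝 (G.diffTrace k)) := by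
    refine tendsto_finsetSum _ fun A _ => ?_
    have h1 := (tendsto_logDerDiff hk a b (G.ad (stdVec A))).mul_const
      (G.ad (G.form⁻¹ *ᵥ stdVec A))
    exact ((continuous_id.matrix_trace).tendsto _).comp h1
  refine hlim.congr' ?_
  filter_upwards [eventually_isUnit_add_smul_one (G.ad k) (sub_ne_zero.mpr hab),
    eventually_isUnit_leftFun hk a, eventually_isUnit_leftFun hk b] with ε h3 h1 h2
  rw [bracket, theta, theta, ← Finset.sum_sub_distrib]
  refine Finset.sum_congr rfl fun A _ => ?_
  rw [← Matrix.trace_sub, mul_one, one_mul, ← sub_mul]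
  congr 2
  rw [sub_mul] at h3
  set I₃ := G.invAt k (a * ε - b * ε) with hI₃
  have hv : G.ad (stdVec A) = (G.ad k + (a * ε) • (1 : Matrix ι ι ℝ)) * G.ad (I₃ *ᵥ stdVec A)
      - G.ad (I₃ *ᵥ stdVec A) * (G.ad k + (b * ε) • (1 : Matrix ι ι ℝ)) := by
    rw [G.jacobi_shift, Matrix.mulVec_mulVec, hI₃, invAt, mul_inv_of_isUnit h3, Matrix.one_mulVec]
  rw [hv, logDerDiff_commutator h1 h2, oddAt, oddAt, oddLog, oddLog, add_mul, mul_add]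
  simp

/-- The trace of `odd_identity` against the dual basis. The two parenthesized groups on the right
are also of the form `bracket`, by the edge symmetries. -/
theorem theta_identity {a b : ℝ}
    (h₁ : IsUnit (G.ad k + a • (1 : Matrix ι ι ℝ))) (h₂ : IsUnit (G.ad k + b • (1 : Matrix ι ι ℝ)))
    (h₃ : IsUnit (G.ad k + (a - b) • (1 : Matrix ι ι ℝ)))
    (y₁ : IsUnit (leftFun ℝ (G.ad k + a • (1 : Matrix ι ι ℝ))))
    (y₂ : IsUnit (leftFun ℝ (G.ad k + b • (1 : Matrix ι ι ℝ))))
    (y₃ : IsUnit (leftFun ℝ (G.ad k + (a - b) • (1 : Matrix ι ι ℝ)))) :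
    -G.theta (G.oddAt k a) (G.oddAt k b) 1 + G.theta 1 (G.oddAt k b) (G.oddAt k (a - b))
      - G.theta (G.oddAt k a) 1 (G.oddAt k (a - b)) + (1 / 4) * G.theta 1 1 1 =
    G.bracket k a b
      + (G.theta (G.invAt k a) (G.oddAt k b) 1 + G.theta (G.invAt k a) 1 (G.oddAt k (a - b)))
      + (G.theta (G.oddAt k a) (G.invAt k b) 1 - G.theta 1 (G.invAt k b) (G.oddAt k (a - b))) := by
  set C₁ := G.ad k + a • (1 : Matrix ι ι ℝ) with hC₁
  set C₂ := G.ad k + b • (1 : Matrix ι ι ℝ) with hC₂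
  set C₃ := G.ad k + (a - b) • (1 : Matrix ι ι ℝ) with hC₃
  have hj : ∀ v, C₁ * G.ad v - G.ad v * C₂ = G.ad (C₃ *ᵥ v) := fun v => G.jacobi_shift k v a b
  have hU := G.exp_intertwine hj
  have u : ∀ {C : Matrix ι ι ℝ}, IsUnit C → IsUnit (leftFun ℝ C) → IsUnit (1 - expFun ℝ (-C)) :=
    fun {C} hC hy => (mul_leftFun ℝ C) ▸ hC.mul hy
  have hid : ∀ v, _ := fun v => G.odd_identity
    (G.coth_identity (mul_inv_of_isUnit (u h₁ y₁)) (inv_mul_of_isUnit (u h₂ y₂))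
      (mul_inv_of_isUnit (u h₃ y₃)) hU v)
    (G.inv_identity (inv_mul_of_isUnit h₁) (mul_inv_of_isUnit h₂) (mul_inv_of_isUnit h₃) hj v)
    (oddLog_eq_of_isUnit h₁ y₁) (oddLog_eq_of_isUnit h₂ y₂) (oddLog_eq_of_isUnit h₃ y₃)
  have hsum := Finset.sum_congr (rfl : (Finset.univ : Finset ι) = Finset.univ) fun A _ =>
    congrArg (fun M => (M * G.ad (G.form⁻¹ *ᵥ stdVec A)).trace) (hid (stdVec A))
  simp only [add_mul, sub_mul, neg_mul, smul_mul_assoc, Matrix.trace_add, Matrix.trace_sub,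
    Matrix.trace_neg, Matrix.trace_smul, Finset.sum_add_distrib, Finset.sum_sub_distrib,
    Finset.sum_neg_distrib, smul_eq_mul, ← Finset.mul_sum] at hsum
  simp only [bracket, theta, oddAt, invAt, one_mul, mul_one, Matrix.one_mulVec, ← hC₁, ← hC₂,
    ← hC₃]
  exact hsum

theorem tendsto_oddAt (hk : IsUnit (leftFun ℝ (G.ad k))) (a : ℝ) :
    Filter.Tendsto (fun ε : ℝ => G.oddAt k (a * ε)) (𝓝[≠] 0) (𝓝 (oddLog (G.ad k))) := by
  unfold oddAt
  exact Filter.Tendsto.comp (g := oddLog) (f := fun ε : ℝ => G.ad k + (a * ε) • (1 : Matrix ι ι ℝ))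
    (continuousAt_oddLog hk) (tendsto_leftFun_shift (G.ad k) a)

theorem tendsto_theta {l : Filter ℝ} {f₁ f₂ f₃ : ℝ → Matrix ι ι ℝ} {g₁ g₂ g₃ : Matrix ι ι ℝ}
    (h₁ : Filter.Tendsto f₁ l (𝓝 g₁)) (h₂ : Filter.Tendsto f₂ l (𝓝 g₂))
    (h₃ : Filter.Tendsto f₃ l (𝓝 g₃)) :
    Filter.Tendsto (fun ε => G.theta (f₁ ε) (f₂ ε) (f₃ ε)) l (𝓝 (G.theta g₁ g₂ g₃)) :=
  Filter.Tendsto.comp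
    (g := fun q : Matrix ι ι ℝ × Matrix ι ι ℝ × Matrix ι ι ℝ => G.theta q.1 q.2.1 q.2.2)
    (f := fun ε => (f₁ ε, f₂ ε, f₃ ε)) (G.continuous_theta.tendsto (g₁, g₂, g₃))
    (h₁.prodMk_nhds (h₂.prodMk_nhds h₃))

-- A rotation of the edges brings the inverse to the third edge, as in `bracket`. The relations
-- between the shifts are those of `ε, -ε, 2ε, -2ε`.
variable (k) in
theorem bracket_second {a b c d : ℝ} (h₁ : d - b = b) (ha : -a = b) (hc : -c = d)
    (y : IsUnit (leftFun ℝ (G.ad k + d • (1 : Matrix ι ι ℝ)))) :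
    G.theta (G.invAt k a) (G.oddAt k b) 1 + G.theta (G.invAt k a) 1 (G.oddAt k c) =
      G.bracket k d b := by
  have a2 : G.adj (G.oddAt k c) = -G.oddAt k d := by rw [G.adj_oddAt k (hc ▸ y), hc]
  have i1 : G.adj (G.invAt k a) = -G.invAt k b := by rw [G.adj_invAt, ha]
  have r1 : G.theta (G.invAt k a) (G.oddAt k b) 1 = -G.theta 1 (G.oddAt k b) (G.invAt k b) := by
    rw [G.theta_rotate, G.adj_one, i1, theta_neg_right]
  have r2 : G.theta (G.invAt k a) 1 (G.oddAt k c) = G.theta (G.oddAt k d) 1 (G.invAt k b) := by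
    rw [G.theta_rotate, i1, a2, theta_neg_right, theta_neg_left, neg_neg]
  rw [bracket, h₁, r1, r2]
  ring

variable (k) in
theorem bracket_third {a b c d : ℝ} (h₁ : d - b = b) (ha : -a = b) (hc : -c = d)
    (hb : -b = a) (y : IsUnit (leftFun ℝ (G.ad k + b • (1 : Matrix ι ι ℝ))))
    (y' : IsUnit (leftFun ℝ (G.ad k + d • (1 : Matrix ι ι ℝ)))) :
    G.theta (G.oddAt k a) (G.invAt k b) 1 - G.theta 1 (G.invAt k b) (G.oddAt k c) =
      G.bracket k d b := by
  have a1 : G.adj (G.oddAt k a) = -G.oddAt k b := by rw [G.adj_oddAt k (ha ▸ y), ha]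
  have a2 : G.adj (G.oddAt k c) = -G.oddAt k d := by rw [G.adj_oddAt k (hc ▸ y'), hc]
  have i1 : G.adj (G.invAt k a) = -G.invAt k b := by rw [G.adj_invAt, ha]
  have i2 : G.adj (G.invAt k b) = -G.invAt k a := by rw [G.adj_invAt, hb]
  have r1 : G.theta (G.oddAt k a) (G.invAt k b) 1 = -G.theta 1 (G.oddAt k b) (G.invAt k b) := by
    rw [G.theta_adj_swap, i2, a1, theta_neg_left, theta_neg_mid, neg_neg, G.theta_rotate,
      G.adj_one, i1, theta_neg_right]
  have r2 : G.theta 1 (G.invAt k b) (G.oddAt k c) = -G.theta (G.oddAt k d) 1 (G.invAt k b) := by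
    rw [G.theta_adj_swap, i2, G.adj_one, theta_neg_left, G.theta_rotate, a2, i1, theta_neg_left,
      theta_neg_right, neg_neg]
  rw [bracket, h₁, r1, r2]
  ring

/-- As `ε → 0` each of the three groups in `theta_identity` tends to `diffTrace`, while each
quadratic term on the left tends to `θ(1,h,h)`, signs included, by edge symmetry. Hence `3 diffTrace
= 3 θ(1,h,h) + θ(1,1,1)/4`. -/
theorem diffTrace_eq (hk : IsUnit (leftFun ℝ (G.ad k))) :
    G.diffTrace k = G.theta 1 (oddLog (G.ad k)) (oddLog (G.ad k)) + (1 / 12) * G.theta 1 1 1 := by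
  set h := oddLog (G.ad k) with hh
  have hadj : G.adj h = -h := by rw [hh, G.adj_oddLog, G.adj_ad, oddLog_neg hk]
  have hodd : ∀ a : ℝ, Filter.Tendsto (fun ε : ℝ => G.oddAt k (a * ε)) (𝓝[≠] 0) (𝓝 h) :=
    G.tendsto_oddAt hk
  have hone : Filter.Tendsto (fun _ : ℝ => (1 : Matrix ι ι ℝ)) (𝓝[≠] 0) (𝓝 1) :=
    tendsto_const_nhds
  have hL : Filter.Tendsto (fun ε : ℝ =>
      -G.theta (G.oddAt k (1 * ε)) (G.oddAt k (-1 * ε)) 1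
        + G.theta 1 (G.oddAt k (-1 * ε)) (G.oddAt k (2 * ε))
        - G.theta (G.oddAt k (1 * ε)) 1 (G.oddAt k (2 * ε)) + (1 / 4) * G.theta 1 1 1) (𝓝[≠] 0)
      (𝓝 (-G.theta h h 1 + G.theta 1 h h - G.theta h 1 h + (1 / 4) * G.theta 1 1 1)) :=
    Filter.Tendsto.add_const _ (((G.tendsto_theta (hodd 1) (hodd (-1)) hone).neg.add
      (G.tendsto_theta hone (hodd (-1)) (hodd 2))).sub
      (G.tendsto_theta (hodd 1) hone (hodd 2)))
  have hR : Filter.Tendsto (fun ε : ℝ => G.bracket k (1 * ε) (-1 * ε) +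
      G.bracket k (-2 * ε) (-1 * ε) + G.bracket k (-2 * ε) (-1 * ε)) (𝓝[≠] 0)
      (𝓝 (G.diffTrace k + G.diffTrace k + G.diffTrace k)) :=
    ((G.tendsto_bracket hk (a := 1) (b := -1) (by norm_num)).add
      (G.tendsto_bracket hk (a := -2) (b := -1) (by norm_num))).add
      (G.tendsto_bracket hk (a := -2) (b := -1) (by norm_num))
  have hev : ∀ {a : ℝ}, a ≠ 0 → ∀ᶠ ε : ℝ in 𝓝[≠] 0,
      IsUnit (G.ad k + (a * ε) • (1 : Matrix ι ι ℝ)) :=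
    fun ha => eventually_isUnit_add_smul_one (G.ad k) ha
  have hLR : (fun ε : ℝ =>
      -G.theta (G.oddAt k (1 * ε)) (G.oddAt k (-1 * ε)) 1
        + G.theta 1 (G.oddAt k (-1 * ε)) (G.oddAt k (2 * ε))
        - G.theta (G.oddAt k (1 * ε)) 1 (G.oddAt k (2 * ε)) + (1 / 4) * G.theta 1 1 1) =ᶠ[𝓝[≠] 0]
      fun ε : ℝ => G.bracket k (1 * ε) (-1 * ε) +
      G.bracket k (-2 * ε) (-1 * ε) + G.bracket k (-2 * ε) (-1 * ε) := by
    filter_upwards [hev (one_ne_zero), hev (a := -1) (by norm_num), hev (a := 2) (by norm_num),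
      eventually_isUnit_leftFun hk 1, eventually_isUnit_leftFun hk (-1),
      eventually_isUnit_leftFun hk 2, eventually_isUnit_leftFun hk (-2)]
      with ε h₁ h₂ h₃ y₁ y₂ y₃ y₄
    have e2 : 1 * ε - -1 * ε = 2 * ε := by ring
    have n1 : -(1 * ε) = -1 * ε := by ring
    have n2 : -(2 * ε) = -2 * ε := by ring
    have n3 : -(-1 * ε) = 1 * ε := by ring
    have e3 : -2 * ε - -1 * ε = -1 * ε := by ring
    have hid := G.theta_identity h₁ h₂ (by rw [e2]; exact h₃) y₁ y₂ (by rw [e2]; exact y₃)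
    rw [e2] at hid
    have r2 := G.bracket_second k e3 n1 n2 y₄
    have r3 := G.bracket_third k e3 n1 n2 n3 y₂ y₄
    linarith
  have heq := tendsto_nhds_unique_of_eventuallyEq hL hR hLR
  have p1 : G.theta h h 1 = -G.theta 1 h h := by
    rw [G.theta_rotate, G.adj_one, hadj, theta_neg_right]
  have p2 : G.theta h 1 h = -G.theta 1 h h := by
    rw [G.theta_adj_swap, G.adj_one, hadj, theta_neg_mid]
  rw [p1, p2] at heq
  linarith

/-- The eigenvalue equation for the square root of the Jacobian of the exponential map. -/
theorem logDer_laplacian (hk : IsUnit (leftFun ℝ (G.ad k))) :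
    (1 / 4) * ∑ A, (logDer (G.ad k) * G.ad (stdVec A)).trace *
        (logDer (G.ad k) * G.ad (G.form⁻¹ *ᵥ stdVec A)).trace
      - (1 / 2) * ∑ A, (logDerDiff (G.ad k) (G.ad k)
          (G.ad ((leftFun ℝ (G.ad k))⁻¹ *ᵥ stdVec A)) * G.ad (G.form⁻¹ *ᵥ stdVec A)).trace =
      -(1 / 24) * G.theta 1 1 1 := by
  set C := G.ad k with hC
  set h := oddLog C with hh
  have hadj : G.adj h = -h := by rw [hh, G.adj_oddLog, hC, G.adj_ad, oddLog_neg hk]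
  have htr : ∀ x, (logDer C * G.ad x).trace = (h * G.ad x).trace := fun x => by
    rw [hh, oddLog, add_mul, Matrix.trace_add, smul_mul_assoc, one_mul, Matrix.trace_smul,
      G.trace_ad, smul_zero, add_zero]
  -- From `Y + C Y' + C Y = 1`. The correction begins with `C`, so its `ad` is a commutator with
  -- `C`, on which the derivative of `logDer` is explicit.
  have hX : (leftFun ℝ C)⁻¹ = 1 + C * (h + (1 / 2 : ℝ) • 1) := by
    have e1 := leftFun_add_mul_deriv ℝ C
    have e2 := mul_leftFun ℝ C
    have e3 : 1 = leftFun ℝ C + C * leftFunDeriv ℝ C + C * leftFun ℝ C := by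
      rw [e1, e2]; abel
    have e4 : h + (1 / 2 : ℝ) • 1 = logDer C + 1 := by
      rw [hh, oddLog, add_assoc, ← add_smul]; norm_num
    rw [e4, logDer_eq]
    calc (leftFun ℝ C)⁻¹ = (leftFun ℝ C + C * leftFunDeriv ℝ C + C * leftFun ℝ C) *
        (leftFun ℝ C)⁻¹ := by rw [← e3, one_mul]
      _ = _ := by
        rw [add_mul, add_mul, mul_assoc C, mul_assoc C, mul_inv_of_isUnit hk]
        noncomm_ring
  have hD : ∑ A, (logDerDiff C C (G.ad ((leftFun ℝ C)⁻¹ *ᵥ stdVec A)) *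
      G.ad (G.form⁻¹ *ᵥ stdVec A)).trace = G.diffTrace k +
      (G.theta h 1 (h + (1 / 2 : ℝ) • 1) - G.theta 1 h (h + (1 / 2 : ℝ) • 1)) := by
    rw [diffTrace, theta, theta, ← Finset.sum_sub_distrib, ← Finset.sum_add_distrib]
    refine Finset.sum_congr rfl fun A _ => ?_
    rw [hX, Matrix.add_mulVec, Matrix.one_mulVec, map_add, logDerDiff_add,
      ← Matrix.mulVec_mulVec, hC, G.jacobi, ← hC, logDerDiff_commutator hk hk, add_mul,
      Matrix.trace_add, mul_one, one_mul, ← Matrix.trace_sub, ← sub_mul]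
    set u := G.ad ((h + (1 / 2 : ℝ) • 1) *ᵥ stdVec A)
    have : logDer C * u - u * logDer C = h * u - u * h := by
      rw [hh, oddLog, add_mul, mul_add]
      simp
    rw [this]
  have p2 : G.theta h 1 h = -G.theta 1 h h := by
    rw [G.theta_adj_swap, G.adj_one, hadj, theta_neg_mid]
  -- A theta graph with the anti-self-adjoint `h` on one edge only equals its own negative.
  have p3 : G.theta h 1 1 = 0 := by
    have q1 : G.theta h 1 1 = -G.theta 1 h 1 := by
      rw [G.theta_adj_swap, G.adj_one, hadj, theta_neg_mid]
    have q2 : G.theta 1 h 1 = G.theta h 1 1 := by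
      let Q : (ι → ℝ) →ₗ[ℝ] (ι → ℝ) →ₗ[ℝ] ℝ := LinearMap.mk₂ ℝ
        (fun x y => (h * (G.ad x * G.ad y)).trace)
        (fun x y z => by simp [Matrix.mul_add, Matrix.add_mul]) (fun r x y => by simp)
        (fun x y z => by simp [Matrix.mul_add]) (fun r x y => by simp)
      have hQ : ∀ x y, Q x y = (h * (G.ad x * G.ad y)).trace := fun x y => rfl
      have := G.sum_bilin_form_inv Q 1
      simp only [one_mul, Matrix.one_mulVec, hQ] at this
      simp only [theta, one_mul, mul_one, Matrix.one_mulVec]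
      simp only [mul_assoc h]
      rw [← this]
      refine Finset.sum_congr rfl fun A _ => ?_
      rw [mul_assoc, Matrix.trace_mul_comm, mul_assoc]
    linarith
  have p4 : G.theta 1 h 1 = 0 := by
    have q1 : G.theta h 1 1 = -G.theta 1 h 1 := by
      rw [G.theta_adj_swap, G.adj_one, hadj, theta_neg_mid]
    linarith
  simp only [htr]
  rw [G.sum_trace_mul_trace hadj, hD, theta_add_right, theta_add_right, theta_smul_right,
    theta_smul_right, p3, p4, p2, G.diffTrace_eq hk]
  ring

end

end QuadraticLieAlgebra

end

end CurvatureGroup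

/-! ### The Jacobian of the exponential map: derivatives, invariance and positivity. -/

namespace CurvatureGroup

noncomputable section

open Matrix
open scoped Matrix.Norms.Operator

section DetDeriv

variable {ι : Type*} [Fintype ι] [DecidableEq ι] {𝕜 : Type*} [RCLike 𝕜]

theorem contDiff_det {n : WithTop ℕ∞} :
    ContDiff 𝕜 n (fun M : Matrix ι ι 𝕜 => M.det) := by
  have hentry : ∀ i j, ContDiff 𝕜 n (fun M : Matrix ι ι 𝕜 => M i j) := fun i j =>
    (LinearMap.toContinuousLinearMap (Matrix.entryLinearMap 𝕜 𝕜 i j)).contDiff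
  simp only [Matrix.det_apply]
  exact ContDiff.sum fun σ _ => (contDiff_prod fun i _ => hentry _ _).const_smul _

/-- Jacobi's formula. -/
theorem hasFDerivAt_det {M : Matrix ι ι 𝕜} (hM : IsUnit M.det) :
    ∃ L : Matrix ι ι 𝕜 →L[𝕜] 𝕜, HasFDerivAt (fun M : Matrix ι ι 𝕜 => M.det) L M ∧
      ∀ V, L V = M.det * (M⁻¹ * V).trace := by
  have hd : DifferentiableAt 𝕜 (fun M : Matrix ι ι 𝕜 => M.det) M :=
    (contDiff_det (n := 1)).differentiable one_ne_zero |>.differentiableAt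
  refine ⟨_, hd.hasFDerivAt, fun V => ?_⟩
  have hpath : HasDerivAt (fun r : 𝕜 => M + r • V) V 0 := by
    have h := ((hasDerivAt_id (0 : 𝕜)).smul_const V).const_add M
    rw [one_smul] at h
    exact h
  have h0 : M + (0 : 𝕜) • V = M := by simp
  have h1 : HasDerivAt (fun r : 𝕜 => (M + r • V).det)
      (fderiv 𝕜 (fun M : Matrix ι ι 𝕜 => M.det) M V) 0 := by
    have h := hd.hasFDerivAt
    rw [← h0] at h
    have := h.comp_hasDerivAt (0 : 𝕜) hpath
    rw [h0] at this
    exact this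
  have h2 : (fun r : 𝕜 => (M + r • V).det) = fun r =>
      M.det * (1 + (M⁻¹ * V).trace * r +
        ((det (1 + (Polynomial.X : Polynomial 𝕜) • (M⁻¹ * V).map Polynomial.C)).divX.divX).eval r
          * r ^ 2) := by
    funext r
    rw [← Matrix.det_one_add_smul, ← Matrix.det_mul, mul_add, mul_one, Matrix.mul_smul,
      ← mul_assoc, Matrix.mul_nonsing_inv _ hM, one_mul]
  set p := ((det (1 + (Polynomial.X : Polynomial 𝕜) • (M⁻¹ * V).map Polynomial.C)).divX.divX)
  have h3 : HasDerivAt (fun r : 𝕜 => M.det * (1 + (M⁻¹ * V).trace * r + p.eval r * r ^ 2))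
      (M.det * (M⁻¹ * V).trace) 0 := by
    have hp := (p.hasDerivAt 0).mul ((hasDerivAt_id (0 : 𝕜)).pow 2)
    have := ((((hasDerivAt_id (0 : 𝕜)).const_mul (M⁻¹ * V).trace).const_add 1).add hp).const_mul
      M.det
    convert! this using 1
    simp
  rw [h2] at h1
  exact h1.unique h3

end DetDeriv

section GroupCalculus

variable {ι : Type*} [Fintype ι] [DecidableEq ι]

/-- Since `f` commutes with `M`, cyclicity makes the `m + 1` summands equal. The first derivative of
`log j` therefore involves only the ordinary derivative of the series. -/
theorem trace_mul_dividedDiff {c : ℕ → ℝ} (hc : FactorialBound c) {f M : Matrix ι ι ℝ}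
    (hf : Commute f M) (V : Matrix ι ι ℝ) :
    (f * dividedDiff c M M V).trace = (f * powerSum (derivCoeff c) M * V).trace := by
  let L : Matrix ι ι ℝ →ₗ[ℝ] ℝ := (Matrix.traceLinearMap ι ℝ ℝ).comp (LinearMap.mulLeft ℝ f)
  let L' : Matrix ι ι ℝ →ₗ[ℝ] ℝ :=
    (Matrix.traceLinearMap ι ℝ ℝ).comp ((LinearMap.mulRight ℝ V).comp (LinearMap.mulLeft ℝ f))
  have h1 := (hasSum_dividedDiff hc M M V).mapL (LinearMap.toContinuousLinearMap L)
  have h2 := (hasSum_powerSum hc.deriv M).mapL (LinearMap.toContinuousLinearMap L')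
  refine h1.unique ?_
  change HasSum _ (LinearMap.toContinuousLinearMap L' (powerSum (derivCoeff c) M))
  refine (congrArg (HasSum · _) (funext fun m => ?_)).mpr h2
  change (f * (c (m + 1) • _)).trace = (f * (derivCoeff c m • M ^ m) * V).trace
  rw [Matrix.mul_smul, Matrix.trace_smul, Matrix.mul_smul, Matrix.smul_mul, Matrix.trace_smul,
    Matrix.mul_sum, Matrix.trace_sum]
  have : ∀ i ∈ Finset.range (m + 1), (f * (M ^ (m - i) * V * M ^ i)).trace =
      (f * M ^ m * V).trace := by
    intro i hi
    have him : i ≤ m := Nat.lt_succ_iff.mp (Finset.mem_range.mp hi)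
    rw [← mul_assoc, Matrix.trace_mul_comm, ← mul_assoc, ← mul_assoc, ← (hf.pow_right i).eq,
      mul_assoc f, ← pow_add, Nat.add_sub_cancel' him]
  rw [Finset.sum_congr rfl this, Finset.sum_const, Finset.card_range, derivCoeff]
  simp only [nsmul_eq_mul, smul_eq_mul]
  push_cast
  ring

namespace QuadraticLieAlgebra

variable (G : QuadraticLieAlgebra ι)

/-- The Jacobian determinant of the exponential map. -/
def jac (k : ι → ℝ) : ℝ := (leftFun ℝ (G.ad k)).det

/-- The logarithmic derivative of the Jacobian. -/
def logJac (k v : ι → ℝ) : ℝ := (logDer (G.ad k) * G.ad v).trace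

theorem contDiff_ad {n : WithTop ℕ∞} : ContDiff ℝ n G.ad :=
  (LinearMap.toContinuousLinearMap G.ad).contDiff

theorem contDiff_jac {n : WithTop ℕ∞} : ContDiff ℝ n G.jac :=
  contDiff_det.comp ((contDiff_powerSum factorialBound_leftCoeff).comp G.contDiff_ad)

theorem isUnit_leftFun_iff {k : ι → ℝ} : IsUnit (leftFun ℝ (G.ad k)) ↔ G.jac k ≠ 0 := by
  rw [Matrix.isUnit_iff_isUnit_det, isUnit_iff_ne_zero, jac]

theorem hasFDerivAt_ad (k : ι → ℝ) :
    HasFDerivAt G.ad (LinearMap.toContinuousLinearMap G.ad) k :=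
  (LinearMap.toContinuousLinearMap G.ad).hasFDerivAt

theorem hasFDerivAt_powerSum_ad {c : ℕ → ℝ} (hc : FactorialBound c) (k : ι → ℝ) :
    ∃ L : (ι → ℝ) →L[ℝ] Matrix ι ι ℝ, HasFDerivAt (fun k => powerSum c (G.ad k)) L k ∧
      ∀ v, L v = dividedDiff c (G.ad k) (G.ad k) (G.ad v) := by
  obtain ⟨L, hL, hL'⟩ := hasFDerivAt_powerSum hc (G.ad k)
  exact ⟨L.comp (LinearMap.toContinuousLinearMap G.ad),
    HasFDerivAt.comp (g := powerSum c) k hL (G.hasFDerivAt_ad k), fun v => hL' _⟩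

theorem hasFDerivAt_jac {k : ι → ℝ} (hk : G.jac k ≠ 0) :
    ∃ L : (ι → ℝ) →L[ℝ] ℝ, HasFDerivAt G.jac L k ∧ ∀ v, L v = G.jac k * G.logJac k v := by
  obtain ⟨L, hL, hL'⟩ := G.hasFDerivAt_powerSum_ad (factorialBound_leftCoeff (𝕜 := ℝ)) k
  obtain ⟨D, hD, hD'⟩ := hasFDerivAt_det (isUnit_iff_ne_zero.mpr hk)
  refine ⟨D.comp L, HasFDerivAt.comp (g := fun M : Matrix ι ι ℝ => M.det) k hD hL, fun v => ?_⟩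
  change D (L v) = _
  rw [hD', hL', trace_mul_dividedDiff factorialBound_leftCoeff
    (commute_inv (commute_leftFun (Commute.refl _))).symm]
  rfl

theorem hasFDerivAt_logJac {k : ι → ℝ} (hk : G.jac k ≠ 0) (w : ι → ℝ) :
    ∃ L : (ι → ℝ) →L[ℝ] ℝ, HasFDerivAt (fun k => G.logJac k w) L k ∧
      ∀ v, L v = (logDerDiff (G.ad k) (G.ad k) (G.ad v) * G.ad w).trace := by
  have hu := G.isUnit_leftFun_iff.mpr hk
  obtain ⟨L, hL, hL'⟩ := G.hasFDerivAt_powerSum_ad (factorialBound_leftCoeff (𝕜 := ℝ)) k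
  obtain ⟨L₁, hL₁, hL₁'⟩ := G.hasFDerivAt_powerSum_ad (factorialBound_leftCoeff (𝕜 := ℝ)).deriv k
  have hinv : HasFDerivAt (fun k => (leftFun ℝ (G.ad k))⁻¹)
      ((-ContinuousLinearMap.mulLeftRight ℝ (Matrix ι ι ℝ) (leftFun ℝ (G.ad k))⁻¹
        (leftFun ℝ (G.ad k))⁻¹).comp L) k := by
    have h1 := hasFDerivAt_ringInverse (𝕜 := ℝ) hu.unit
    have h2 : ((hu.unit⁻¹ : (Matrix ι ι ℝ)ˣ) : Matrix ι ι ℝ) = (leftFun ℝ (G.ad k))⁻¹ := by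
      rw [Matrix.coe_units_inv, IsUnit.unit_spec]
    rw [h2, IsUnit.unit_spec] at h1
    have h3 : (fun k => (leftFun ℝ (G.ad k))⁻¹) = fun k => Ring.inverse (leftFun ℝ (G.ad k)) := by
      funext k
      rw [Matrix.nonsing_inv_eq_ringInverse]
    rw [h3]
    exact HasFDerivAt.comp (g := Ring.inverse) k h1 hL
  have hprod := hinv.mul' hL₁
  let T : Matrix ι ι ℝ →L[ℝ] ℝ := LinearMap.toContinuousLinearMap
    ((Matrix.traceLinearMap ι ℝ ℝ).comp (LinearMap.mulRight ℝ (G.ad w)))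
  refine ⟨_, T.hasFDerivAt.comp k hprod, fun v => ?_⟩
  change T _ = _
  have hT : ∀ M, T M = (M * G.ad w).trace := fun M => rfl
  rw [hT]
  congr 2
  change (leftFun ℝ (G.ad k))⁻¹ * L₁ v +
    -((leftFun ℝ (G.ad k))⁻¹ * L v * (leftFun ℝ (G.ad k))⁻¹) * leftFunDeriv ℝ (G.ad k) = _
  rw [hL', hL₁', logDerDiff, logDer]
  noncomm_ring

theorem logJac_add (k v w : ι → ℝ) : G.logJac k (v + w) = G.logJac k v + G.logJac k w := by
  simp [logJac, Matrix.mul_add]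

theorem logJac_smul (r : ℝ) (k v : ι → ℝ) : G.logJac k (r • v) = r * G.logJac k v := by
  simp [logJac]

/-- `logJac` as a row vector. -/
def logJacVec (k : ι → ℝ) : ι → ℝ := fun A => G.logJac k (stdVec A)

theorem logJac_eq_dotProduct (k v : ι → ℝ) : G.logJac k v = G.logJacVec k ⬝ᵥ v := by
  have hexp : v = ∑ A, v A • stdVec A := by
    ext C
    simp [stdVec, Finset.sum_apply, Pi.single_apply]
  conv_lhs => rw [hexp]
  simp only [logJac, map_sum, map_smul, Matrix.mul_sum, Matrix.mul_smul, Matrix.trace_sum,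
    Matrix.trace_smul, smul_eq_mul, dotProduct, logJacVec]
  exact Finset.sum_congr rfl fun A _ => mul_comm _ _

theorem ad_mulVec_self (k : ι → ℝ) : G.ad k *ᵥ k = 0 := by
  have h := G.skew k k
  exact self_eq_neg.mp h

/-- Infinitesimal invariance of `j` under the adjoint action: the trace of a function of `C` against
a commutator with `C` vanishes. -/
theorem logJac_ad (k v : ι → ℝ) : G.logJac k (G.ad k *ᵥ v) = 0 := by
  rw [logJac, G.jacobi, mul_sub, Matrix.trace_sub, ← mul_assoc, ← mul_assoc,
    ← (commute_logDer (Commute.refl (G.ad k))).eq, mul_assoc, Matrix.trace_mul_comm,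
    mul_assoc, sub_self]

theorem vecMul_leftFun_of_vecMul_eq_zero {M : Matrix ι ι ℝ} {v : ι → ℝ} (h : v ᵥ* M = 0) :
    v ᵥ* leftFun ℝ M = v := by
  rw [leftFun, powerSum_eq_add_mul factorialBound_leftCoeff, Matrix.vecMul_add,
    ← Matrix.vecMul_vecMul, h]
  simp [leftCoeff]

theorem vecMul_inv_of_vecMul_eq {M : Matrix ι ι ℝ} {v : ι → ℝ} (hM : IsUnit M) (h : v ᵥ* M = v) :
    v ᵥ* M⁻¹ = v := by
  conv_lhs => rw [← h]
  rw [Matrix.vecMul_vecMul, mul_inv_of_isUnit hM, Matrix.vecMul_one]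

variable {k : ι → ℝ}

/-- A row vector killed by `C` is fixed by `Y = 1 + C(⋯)` and hence by `Y⁻¹`. Thus `X_A` and `∂_A`
agree on `log j`; the next lemma treats the gradient of the invariant form in the same way. -/
theorem logJacVec_vecMul_inv (hk : G.jac k ≠ 0) :
    G.logJacVec k ᵥ* (leftFun ℝ (G.ad k))⁻¹ = G.logJacVec k := by
  refine vecMul_inv_of_vecMul_eq (G.isUnit_leftFun_iff.mpr hk)
    (vecMul_leftFun_of_vecMul_eq_zero ?_)
  ext A
  have h := G.logJac_ad k (stdVec A)
  rw [logJac_eq_dotProduct, Matrix.dotProduct_mulVec] at h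
  simpa [stdVec] using h

theorem form_vecMul_inv (hk : G.jac k ≠ 0) :
    (G.form *ᵥ k) ᵥ* (leftFun ℝ (G.ad k))⁻¹ = G.form *ᵥ k := by
  refine vecMul_inv_of_vecMul_eq (G.isUnit_leftFun_iff.mpr hk)
    (vecMul_leftFun_of_vecMul_eq_zero ?_)
  rw [← Matrix.mulVec_transpose, Matrix.mulVec_mulVec, G.invariant, Matrix.neg_mulVec,
    ← Matrix.mulVec_mulVec, G.ad_mulVec_self, Matrix.mulVec_zero, neg_zero]

/-- From `Y' C = 1 - Y - Y C` and `tr C = 0`. In the heat equation this radial derivative cancels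
the trace of `Y⁻¹` arising from the Gaussian. -/
theorem logJac_self (hk : G.jac k ≠ 0) :
    G.logJac k k = ((leftFun ℝ (G.ad k))⁻¹).trace - Fintype.card ι := by
  have hu := G.isUnit_leftFun_iff.mpr hk
  set C := G.ad k with hC
  have e1 := leftFun_add_mul_deriv ℝ C
  have e2 := mul_leftFun ℝ C
  have e3 : leftFunDeriv ℝ C * C = 1 - leftFun ℝ C - leftFun ℝ C * C := by
    rw [← (commute_leftFunDeriv (Commute.refl C)).eq, ← (commute_leftFun (Commute.refl C)).eq, e2,
      ← e1]
    abel
  rw [logJac, ← hC, logDer, mul_assoc, e3, mul_sub, mul_sub, inv_mul_of_isUnit hu, mul_one,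
    ← mul_assoc, inv_mul_of_isUnit hu, one_mul, Matrix.trace_sub, Matrix.trace_sub, hC, G.trace_ad,
    Matrix.trace_one, sub_zero]

/-- Positivity of the Jacobian, and its expression through the hyperbolic sine. -/
theorem jac_eq_det_sinhSqrt (k : ι → ℝ) :
    G.jac k = (sinhSqrt ℝ (((1 / 2 : ℝ) • G.ad k) ^ 2)).det := by
  -- Adjunction for the form exchanges `exp M` and `exp (-M)`, so their determinants are equal; they
  -- are positive with product `1`.
  have hdet : (expFun ℝ (-((1 / 2 : ℝ) • G.ad k))).det = 1 := by
    set M := (1 / 2 : ℝ) • G.ad k with hM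
    have hadj : G.adj M = -M := by rw [hM, G.adj_smul, G.adj_ad, smul_neg]
    have hdadj : ∀ f, (G.adj f).det = f.det := fun f => by
      rw [adj, Matrix.det_mul, Matrix.det_mul, mul_right_comm, ← Matrix.det_mul, G.inv_mul_form,
        Matrix.det_one, one_mul, Matrix.det_transpose]
    have h1 : (expFun ℝ (-M)).det = (expFun ℝ M).det := by
      rw [← hadj, expFun, ← G.adj_powerSum factorialBound_expCoeff, hdadj]
      rfl
    have h2 : (expFun ℝ (-M)).det * (expFun ℝ M).det = 1 := by
      rw [← Matrix.det_mul, ← expFun_add ℝ ((Commute.refl M).neg_left), neg_add_cancel,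
        expFun_zero, Matrix.det_one]
    have h3 := det_exp_pos M
    rw [h1] at h2 ⊢
    nlinarith
  rw [jac]
  have h' : leftFun ℝ (G.ad k) = expFun ℝ (-((1 / 2 : ℝ) • G.ad k)) *
      sinhSqrt ℝ (((1 / 2 : ℝ) • G.ad k) ^ 2) := by
    have h := leftFun_two_smul ((1 / 2 : ℝ) • G.ad k)
    rwa [smul_smul, mul_one_div_cancel two_ne_zero, one_smul] at h
  rw [h', Matrix.det_mul, hdet, one_mul]

theorem jac_nonneg (k : ι → ℝ) : 0 ≤ G.jac k := by
  rw [jac_eq_det_sinhSqrt]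
  exact det_sinhSqrt_sq_nonneg _

end QuadraticLieAlgebra

end GroupCalculus

end

end CurvatureGroup

/-! ### Time derivatives of the matrix cotangent and of `det (sinh √x / √x)`. -/

namespace CurvatureGroup

noncomputable section

open Matrix
open scoped Matrix.Norms.Operator

section Coth

variable {ι : Type*} [Fintype ι] [DecidableEq ι]

theorem hasDerivAt_matrix_inv {f : ℝ → Matrix ι ι ℝ} {f' : Matrix ι ι ℝ} {s : ℝ}
    (hf : HasDerivAt f f' s) (hu : IsUnit (f s)) :
    HasDerivAt (fun s => (f s)⁻¹) (-((f s)⁻¹ * f' * (f s)⁻¹)) s := by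
  have h1 := hasFDerivAt_ringInverse (𝕜 := ℝ) hu.unit
  have h2 : ((hu.unit⁻¹ : (Matrix ι ι ℝ)ˣ) : Matrix ι ι ℝ) = (f s)⁻¹ := by
    rw [Matrix.coe_units_inv, IsUnit.unit_spec]
  rw [h2, IsUnit.unit_spec] at h1
  have h3 : (fun s => (f s)⁻¹) = fun s => Ring.inverse (f s) := by
    funext k
    rw [Matrix.nonsing_inv_eq_ringInverse]
  rw [h3]
  exact h1.comp_hasDerivAt s hf

theorem hasDerivAt_powerSum_sq_smul {c : ℕ → ℝ} (hc : FactorialBound c) (K : Matrix ι ι ℝ)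
    (s : ℝ) : HasDerivAt (fun s : ℝ => powerSum c ((s ^ 2) • K))
      ((2 * s) • (powerSum (derivCoeff c) ((s ^ 2) • K) * K)) s := by
  obtain ⟨L, hL, hL'⟩ := hasFDerivAt_powerSum hc ((s ^ 2) • K)
  have h1 : HasDerivAt (fun s : ℝ => (s ^ 2) • K) ((2 * s) • K) s := by
    have h := ((hasDerivAt_id s).pow 2).smul_const K
    convert! h using 1
    simp
  have h2 := hL.comp_hasDerivAt s h1
  rw [hL', dividedDiff_of_commute hc (((Commute.refl K).smul_left _).smul_right _),
    Matrix.mul_smul] at h2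
  exact h2

/-- `√x coth √x`. -/
def cothSqrt (M : Matrix ι ι ℝ) : Matrix ι ι ℝ := coshSqrt ℝ M * (sinhSqrt ℝ M)⁻¹

theorem commute_sinhSqrt {x M : Matrix ι ι ℝ} (h : Commute x M) : Commute x (sinhSqrt ℝ M) :=
  commute_powerSum factorialBound_sinhCoeff h

theorem commute_coshSqrt {x M : Matrix ι ι ℝ} (h : Commute x M) : Commute x (coshSqrt ℝ M) :=
  commute_powerSum factorialBound_coshCoeff h

theorem commute_cothSqrt {x M : Matrix ι ι ℝ} (h : Commute x M) : Commute x (cothSqrt M) :=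
  (commute_coshSqrt h).mul_right (commute_inv (commute_sinhSqrt h))

theorem transpose_powerSum {c : ℕ → ℝ} (hc : FactorialBound c) (M : Matrix ι ι ℝ) :
    (powerSum c M)ᵀ = powerSum c Mᵀ := by
  have h := (hasSum_powerSum hc M).mapL
    (LinearMap.toContinuousLinearMap (Matrix.transposeLinearEquiv ι ι ℝ ℝ).toLinearMap)
  refine h.unique ?_
  refine (congrArg (HasSum · _) (funext fun m => ?_)).mpr (hasSum_powerSum hc Mᵀ)
  change (c m • M ^ m)ᵀ = _
  rw [Matrix.transpose_smul, Matrix.transpose_pow]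

theorem transpose_cothSqrt {M : Matrix ι ι ℝ} (h : Mᵀ = M) : (cothSqrt M)ᵀ = cothSqrt M := by
  rw [cothSqrt, Matrix.transpose_mul, Matrix.transpose_nonsing_inv, coshSqrt, sinhSqrt,
    transpose_powerSum factorialBound_coshCoeff, transpose_powerSum factorialBound_sinhCoeff, h]
  exact (commute_inv (commute_sinhSqrt (commute_coshSqrt (Commute.refl M)).symm)).symm.eq

/-- The quotient of `√x coth √x - 1` by `x` is explicit from `coshSqrt_eq_add`; as a function of `M`
it commutes with everything that commutes with `M`. -/
theorem exists_cothSqrt_sub_one {M : Matrix ι ι ℝ} (hu : IsUnit (sinhSqrt ℝ M)) :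
    ∃ V, (∀ x, Commute x M → Commute x V) ∧ cothSqrt M = 1 + M * V := by
  refine ⟨(2 : ℝ) • (powerSum (derivCoeff (sinhCoeff ℝ)) M * (sinhSqrt ℝ M)⁻¹),
    fun x hx => ((commute_powerSum factorialBound_sinhCoeff.deriv hx).mul_right
      (commute_inv (commute_sinhSqrt hx))).smul_right _, ?_⟩
  rw [cothSqrt, ← coshSqrt_eq_add, add_mul, mul_inv_of_isUnit hu, Matrix.smul_mul, Matrix.mul_smul,
    mul_assoc]

theorem hasDerivAt_sinhSqrt_sq_smul (K : Matrix ι ι ℝ) {s : ℝ} (hs : s ≠ 0) :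
    HasDerivAt (fun s : ℝ => sinhSqrt ℝ ((s ^ 2) • K))
      (s⁻¹ • (coshSqrt ℝ ((s ^ 2) • K) - sinhSqrt ℝ ((s ^ 2) • K))) s := by
  have h := hasDerivAt_powerSum_sq_smul (factorialBound_sinhCoeff (𝕜 := ℝ)) K s
  convert! h using 1
  rw [← coshSqrt_eq_add ℝ ((s ^ 2) • K), add_sub_cancel_left, Matrix.smul_mul, smul_smul, smul_smul,
    (commute_powerSum factorialBound_sinhCoeff.deriv
      ((Commute.refl K).smul_right (s ^ 2))).eq]
  congr 1
  field_simp

theorem hasDerivAt_coshSqrt_sq_smul (K : Matrix ι ι ℝ) (s : ℝ) :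
    HasDerivAt (fun s : ℝ => coshSqrt ℝ ((s ^ 2) • K))
      (s • (sinhSqrt ℝ ((s ^ 2) • K) * K)) s := by
  have h := hasDerivAt_powerSum_sq_smul (factorialBound_coshCoeff (𝕜 := ℝ)) K s
  rw [powerSum_derivCoeff_coshCoeff, Matrix.smul_mul, smul_smul] at h
  convert! h using 2
  ring

/-- The Riccati equation of `√K coth (s √K)`, written without the root so that `K` may be singular
or have negative eigenvalues. -/
theorem hasDerivAt_inv_smul_cothSqrt (K : Matrix ι ι ℝ) {s : ℝ} (hs : s ≠ 0)
    (hu : IsUnit (sinhSqrt ℝ ((s ^ 2) • K))) :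
    HasDerivAt (fun s : ℝ => s⁻¹ • cothSqrt ((s ^ 2) • K))
      (K - (s⁻¹ • cothSqrt ((s ^ 2) • K)) ^ 2) s := by
  have h := (hasDerivAt_inv hs).smul ((hasDerivAt_coshSqrt_sq_smul K s).mul
    (hasDerivAt_matrix_inv (hasDerivAt_sinhSqrt_sq_smul K hs) hu))
  convert! h using 1
  have hK : Commute K ((s ^ 2) • K) := (Commute.refl K).smul_right _
  have hcs : Commute (coshSqrt ℝ ((s ^ 2) • K)) (sinhSqrt ℝ ((s ^ 2) • K)) :=
    commute_sinhSqrt (commute_coshSqrt (Commute.refl _)).symm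
  have hKs := commute_inv (commute_sinhSqrt hK)
  have hsi := mul_inv_of_isUnit hu
  have his := inv_mul_of_isUnit hu
  set c := coshSqrt ℝ ((s ^ 2) • K)
  set S := sinhSqrt ℝ ((s ^ 2) • K)
  have e1 : S * K * S⁻¹ = K := by rw [mul_assoc, hKs.eq, ← mul_assoc, hsi, one_mul]
  have e2 : S⁻¹ * (s⁻¹ • (c - S)) * S⁻¹ = s⁻¹ • (S⁻¹ * c * S⁻¹ - S⁻¹) := by
    rw [Matrix.mul_smul, Matrix.smul_mul, mul_sub, sub_mul, his, one_mul]
  change K - (s⁻¹ • (c * S⁻¹)) ^ 2 = s⁻¹ • (s • (S * K) * S⁻¹ +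
    c * -(S⁻¹ * (s⁻¹ • (c - S)) * S⁻¹)) + -(s ^ 2)⁻¹ • (c * S⁻¹)
  rw [e2, Matrix.smul_mul, e1, mul_neg, Matrix.mul_smul, mul_sub, smul_pow, smul_add, smul_neg,
    smul_smul, smul_smul, inv_mul_cancel₀ hs, one_smul, smul_sub, neg_smul,
    show c * (S⁻¹ * c * S⁻¹) = (c * S⁻¹) ^ 2 by rw [pow_two]; simp only [mul_assoc],
    show s⁻¹ * s⁻¹ = s⁻¹ ^ 2 by ring, inv_pow]
  abel

theorem hasDerivAt_det_sinhSqrt (K : Matrix ι ι ℝ) {s : ℝ} (hs : s ≠ 0)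
    (hu : IsUnit (sinhSqrt ℝ ((s ^ 2) • K))) :
    HasDerivAt (fun s : ℝ => (sinhSqrt ℝ ((s ^ 2) • K)).det)
      ((sinhSqrt ℝ ((s ^ 2) • K)).det *
        (s⁻¹ * ((cothSqrt ((s ^ 2) • K)).trace - Fintype.card ι))) s := by
  obtain ⟨L, hL, hL'⟩ := hasFDerivAt_det ((Matrix.isUnit_iff_isUnit_det _).mp hu)
  have h := hL.comp_hasDerivAt s (hasDerivAt_sinhSqrt_sq_smul K hs)
  refine h.congr_deriv ((hL' _).trans ?_)
  rw [Matrix.mul_smul, Matrix.trace_smul, mul_sub, inv_mul_of_isUnit hu, Matrix.trace_sub,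
    Matrix.trace_one, Matrix.trace_mul_comm]
  rfl

end Coth

end

end CurvatureGroup

/-! ### The flat part of the bundle curvature and its contractions with the group data. -/

namespace CurvatureGroup

noncomputable section

open Matrix
open scoped Matrix.Norms.Operator

variable {ι : Type*} [Fintype ι] [DecidableEq ι]

/-- An antisymmetric matrix on the directions that are flat for the Lie algebra and on which the
invariant form is the Euclidean one. -/
structure FlatForm (G : QuadraticLieAlgebra ι) where
  /-- the matrix -/
  mat : Matrix ι ι ℝ
  transpose_eq : matᵀ = -mat
  ad_mul : ∀ x, G.ad x * mat = 0
  form_mul : G.form * mat = mat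

namespace FlatForm

variable {G : QuadraticLieAlgebra ι} (b : FlatForm G)

theorem mul_form : b.mat * G.form = b.mat := by
  have h := congrArg Matrix.transpose b.form_mul
  rw [Matrix.transpose_mul, b.transpose_eq, G.form_symm, Matrix.neg_mul] at h
  exact neg_injective h

theorem inv_form_mul : G.form⁻¹ * b.mat = b.mat := by
  conv_lhs => rw [← b.form_mul]
  rw [← Matrix.mul_assoc, G.inv_mul_form, Matrix.one_mul]

theorem mul_ad (x : ι → ℝ) : b.mat * G.ad x = 0 := by
  have h := congrArg (fun M => Mᵀ * G.form) (b.ad_mul x)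
  simp only [Matrix.transpose_mul, b.transpose_eq, Matrix.transpose_zero, Matrix.zero_mul] at h
  rw [Matrix.mul_assoc, G.invariant, Matrix.neg_mul, Matrix.mul_neg, neg_neg, ← Matrix.mul_assoc,
    b.mul_form] at h
  exact h

theorem ad_mat_mulVec (v : ι → ℝ) : G.ad (b.mat *ᵥ v) = 0 := by
  refine Matrix.ext_of_mulVec_single fun A => ?_
  rw [G.skew, Matrix.mulVec_mulVec, b.ad_mul, Matrix.zero_mulVec, Matrix.zero_mulVec, neg_zero]

theorem mul_leftFun_inv {k : ι → ℝ} (hk : G.jac k ≠ 0) :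
    b.mat * (leftFun ℝ (G.ad k))⁻¹ = b.mat := by
  have h : b.mat * leftFun ℝ (G.ad k) = b.mat := by
    rw [leftFun, powerSum_eq_add_mul factorialBound_leftCoeff, mul_add, ← mul_assoc, b.mul_ad]
    simp [leftCoeff]
  conv_lhs => rw [← h]
  rw [mul_assoc, mul_inv_of_isUnit (G.isUnit_leftFun_iff.mpr hk), mul_one]

theorem logJacVec_vecMul (k : ι → ℝ) : G.logJacVec k ᵥ* b.mat = 0 := by
  ext A
  have h : G.logJac k (b.mat *ᵥ stdVec A) = 0 := by
    rw [QuadraticLieAlgebra.logJac, b.ad_mat_mulVec, Matrix.mul_zero, Matrix.trace_zero]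
  rw [QuadraticLieAlgebra.logJac_eq_dotProduct, Matrix.dotProduct_mulVec] at h
  simpa [stdVec] using h

theorem commute_form : Commute G.form b.mat := b.form_mul.trans b.mul_form.symm

/-- The argument of the hyperbolic functions at time `s`. -/
def arg (σ s : ℝ) : Matrix ι ι ℝ := (s ^ 2) • (σ • b.mat ^ 2)

theorem commute_arg {M : Matrix ι ι ℝ} (h : Commute M b.mat) (σ s : ℝ) : Commute M (b.arg σ s) :=
  ((h.pow_right 2).smul_right _).smul_right _

theorem transpose_arg (σ s : ℝ) : (b.arg σ s)ᵀ = b.arg σ s := by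
  rw [arg, Matrix.transpose_smul, Matrix.transpose_smul, Matrix.transpose_pow, b.transpose_eq,
    neg_sq]

theorem arg_eq_mul (σ s : ℝ) : b.arg σ s = b.mat * ((s ^ 2 * σ) • b.mat) := by
  rw [arg, smul_smul, Matrix.mul_smul, pow_two b.mat]

/-- `t𝓑 coth (t𝓑)`. -/
def coth (σ s : ℝ) : Matrix ι ι ℝ := cothSqrt (b.arg σ s)

/-- `det (sinh (t𝓑) / t𝓑)`. -/
def detSinh (σ s : ℝ) : ℝ := (sinhSqrt ℝ (b.arg σ s)).det

theorem transpose_coth (σ s : ℝ) : (b.coth σ s)ᵀ = b.coth σ s :=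
  transpose_cothSqrt (b.transpose_arg σ s)

theorem commute_form_coth (σ s : ℝ) : Commute G.form (b.coth σ s) :=
  commute_cothSqrt (b.commute_arg b.commute_form σ s)

theorem commute_mat_coth (σ s : ℝ) : Commute b.mat (b.coth σ s) :=
  commute_cothSqrt (b.commute_arg (Commute.refl _) σ s)

theorem isUnit_sinhSqrt {σ s : ℝ} (h : b.detSinh σ s ≠ 0) : IsUnit (sinhSqrt ℝ (b.arg σ s)) := by
  rw [Matrix.isUnit_iff_isUnit_det, isUnit_iff_ne_zero]
  exact h

/-- The cotangent differs from `1` by a multiple of `b` on either side. Since `b Y⁻¹ = b` and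
`logJacVec` kills `b`, the contractions below reduce to those with `1`. -/
theorem exists_coth_eq {σ s : ℝ} (h : b.detSinh σ s ≠ 0) :
    ∃ V, b.coth σ s = 1 + b.mat * V ∧ b.coth σ s = 1 + V * b.mat := by
  obtain ⟨V, hV, e⟩ := exists_cothSqrt_sub_one (b.isUnit_sinhSqrt h)
  have e1 : b.coth σ s = 1 + b.mat * (((s ^ 2 * σ) • b.mat) * V) := by
    rw [coth, e, ← mul_assoc, ← b.arg_eq_mul]
  refine ⟨_, e1, e1.trans ?_⟩
  rw [(((Commute.refl b.mat).smul_right _).mul_right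
    (hV _ (b.commute_arg (Commute.refl _) σ s))).eq]

/-- The matrix of the quadratic form in the exponent of the heat kernel. -/
def quad (σ s : ℝ) : Matrix ι ι ℝ := G.form * b.coth σ s

theorem transpose_quad (σ s : ℝ) : (b.quad σ s)ᵀ = b.quad σ s := by
  rw [quad, Matrix.transpose_mul, b.transpose_coth, G.form_symm, (b.commute_form_coth σ s).eq]

omit [DecidableEq ι] in
theorem mulVec_dotProduct_eq (M : Matrix ι ι ℝ) (x y : ι → ℝ) :
    (M *ᵥ x) ⬝ᵥ y = x ⬝ᵥ Mᵀ *ᵥ y := by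
  rw [← Matrix.vecMul_transpose, ← Matrix.dotProduct_mulVec]

omit [DecidableEq ι] in
theorem dotProduct_mulVec_eq_zero {M : Matrix ι ι ℝ} (h : Mᵀ = -M) (k : ι → ℝ) :
    k ⬝ᵥ M *ᵥ k = 0 := by
  have h1 : k ⬝ᵥ M *ᵥ k = -(k ⬝ᵥ M *ᵥ k) := by
    conv_lhs => rw [dotProduct_comm, ← Matrix.vecMul_transpose, h, Matrix.vecMul_neg,
      neg_dotProduct, ← Matrix.dotProduct_mulVec]
  linarith

section Contractions

variable {k : ι → ℝ} {σ s : ℝ}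

theorem sum_dotProduct_mul (x y : ι → ℝ) :
    ∑ A, (x ⬝ᵥ stdVec A) * (y ⬝ᵥ G.form⁻¹ *ᵥ stdVec A) = x ⬝ᵥ G.form⁻¹ *ᵥ y := by
  have h : ∀ A, y ⬝ᵥ G.form⁻¹ *ᵥ stdVec A = (G.form⁻¹ *ᵥ y) A := fun A => by
    rw [Matrix.dotProduct_mulVec, ← Matrix.mulVec_transpose, G.form_inv_symm]
    simp [stdVec]
  have h' : ∀ A, x ⬝ᵥ stdVec A = x A := fun A => by simp [stdVec]
  simp only [h, h']
  rfl

theorem mul_leftFun_inv_of_coth (hk : G.jac k ≠ 0) (he : b.detSinh σ s ≠ 0) :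
    (b.coth σ s * (leftFun ℝ (G.ad k))⁻¹).trace =
      ((leftFun ℝ (G.ad k))⁻¹).trace + (b.coth σ s).trace - Fintype.card ι := by
  obtain ⟨V, -, hV⟩ := b.exists_coth_eq he
  rw [hV, add_mul, one_mul, mul_assoc, b.mul_leftFun_inv hk, Matrix.trace_add, Matrix.trace_add,
    Matrix.trace_one]
  ring

theorem quad_vecMul_inv (hk : G.jac k ≠ 0) (he : b.detSinh σ s ≠ 0) :
    (b.quad σ s *ᵥ k) ᵥ* (leftFun ℝ (G.ad k))⁻¹ = b.quad σ s *ᵥ k := by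
  obtain ⟨V, hV, -⟩ := b.exists_coth_eq he
  have h : b.quad σ s *ᵥ k = G.form *ᵥ k + b.mat *ᵥ (V *ᵥ k) := by
    rw [quad, hV, mul_add, mul_one, ← mul_assoc, b.form_mul, Matrix.add_mulVec,
      ← Matrix.mulVec_mulVec]
  rw [h, Matrix.add_vecMul, G.form_vecMul_inv hk, ← Matrix.vecMul_transpose b.mat, b.transpose_eq,
    Matrix.vecMul_vecMul, Matrix.neg_mul, b.mul_leftFun_inv hk]

theorem logJacVec_inv_quad (hk : G.jac k ≠ 0) (he : b.detSinh σ s ≠ 0) :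
    G.logJacVec k ⬝ᵥ G.form⁻¹ *ᵥ (b.quad σ s *ᵥ k) =
      ((leftFun ℝ (G.ad k))⁻¹).trace - Fintype.card ι := by
  obtain ⟨V, hV, -⟩ := b.exists_coth_eq he
  rw [Matrix.mulVec_mulVec, quad, ← Matrix.mul_assoc, G.inv_mul_form, Matrix.one_mul, hV,
    Matrix.add_mulVec, ← Matrix.mulVec_mulVec, dotProduct_add, Matrix.dotProduct_mulVec _ b.mat,
    b.logJacVec_vecMul, zero_dotProduct, add_zero, Matrix.one_mulVec,
    ← G.logJac_eq_dotProduct, G.logJac_self hk]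

theorem logJacVec_inv_mat (k v : ι → ℝ) :
    G.logJacVec k ⬝ᵥ G.form⁻¹ *ᵥ (b.mat *ᵥ v) = 0 := by
  rw [Matrix.mulVec_mulVec, b.inv_form_mul, Matrix.dotProduct_mulVec, b.logJacVec_vecMul,
    zero_dotProduct]

/-- This is the quadratic form of a product of commuting symmetric and antisymmetric matrices, which
is antisymmetric. -/
theorem quad_inv_mat (k : ι → ℝ) (σ s : ℝ) :
    (b.quad σ s *ᵥ k) ⬝ᵥ G.form⁻¹ *ᵥ (b.mat *ᵥ k) = 0 := by
  rw [Matrix.mulVec_mulVec, b.inv_form_mul, ← Matrix.vecMul_transpose, b.transpose_quad,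
    ← Matrix.dotProduct_mulVec, Matrix.mulVec_mulVec]
  refine dotProduct_mulVec_eq_zero ?_ k
  rw [Matrix.transpose_mul, b.transpose_eq, b.transpose_quad, quad, Matrix.neg_mul,
    ← Matrix.mul_assoc, b.mul_form, mul_assoc, ← (b.commute_mat_coth σ s).eq, ← mul_assoc,
    b.form_mul]

theorem mat_inv_mat (k : ι → ℝ) :
    (b.mat *ᵥ k) ⬝ᵥ G.form⁻¹ *ᵥ (b.mat *ᵥ k) = -(k ⬝ᵥ b.mat ^ 2 *ᵥ k) := by
  rw [Matrix.mulVec_mulVec, b.inv_form_mul, mulVec_dotProduct_eq, b.transpose_eq,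
    Matrix.neg_mulVec, Matrix.mulVec_mulVec, dotProduct_neg, pow_two]

theorem quad_inv_quad (k : ι → ℝ) (σ s : ℝ) :
    (b.quad σ s *ᵥ k) ⬝ᵥ G.form⁻¹ *ᵥ (b.quad σ s *ᵥ k) =
      k ⬝ᵥ (G.form * b.coth σ s ^ 2) *ᵥ k := by
  rw [mulVec_dotProduct_eq, b.transpose_quad, Matrix.mulVec_mulVec, Matrix.mulVec_mulVec, quad,
    mul_assoc (G.form * b.coth σ s), ← mul_assoc (G.form⁻¹), G.inv_mul_form, one_mul, mul_assoc,
    pow_two]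

theorem sum_quad (hk : G.jac k ≠ 0) (he : b.detSinh σ s ≠ 0) :
    ∑ A, (G.form⁻¹ *ᵥ stdVec A) ⬝ᵥ b.quad σ s *ᵥ ((leftFun ℝ (G.ad k))⁻¹ *ᵥ stdVec A) =
      ((leftFun ℝ (G.ad k))⁻¹).trace + (b.coth σ s).trace - Fintype.card ι := by
  rw [← b.mul_leftFun_inv_of_coth hk he, trace_eq_sum_stdVec]
  refine Finset.sum_congr rfl fun A _ => ?_
  rw [← Matrix.vecMul_transpose, G.form_inv_symm, ← Matrix.dotProduct_mulVec,
    Matrix.mulVec_mulVec, Matrix.mulVec_mulVec, quad, ← mul_assoc, G.inv_mul_form, one_mul]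

theorem sum_mat (hk : G.jac k ≠ 0) :
    ∑ A, (G.form⁻¹ *ᵥ stdVec A) ⬝ᵥ b.mat *ᵥ ((leftFun ℝ (G.ad k))⁻¹ *ᵥ stdVec A) = 0 := by
  have h : b.mat.trace = 0 := by
    have h := congrArg Matrix.trace b.transpose_eq
    rw [Matrix.trace_transpose, Matrix.trace_neg] at h
    linarith
  rw [← h, trace_eq_sum_stdVec]
  refine Finset.sum_congr rfl fun A _ => ?_
  rw [← Matrix.vecMul_transpose, G.form_inv_symm, ← Matrix.dotProduct_mulVec,
    Matrix.mulVec_mulVec, Matrix.mulVec_mulVec, b.inv_form_mul, b.mul_leftFun_inv hk]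

end Contractions

end FlatForm

end

end CurvatureGroup

/-! ### The scalar heat equation. -/

namespace CurvatureGroup

noncomputable section

open Matrix
open scoped Matrix.Norms.Operator

variable {ι : Type*} [Fintype ι] [DecidableEq ι]

namespace FlatForm

variable {G : QuadraticLieAlgebra ι} (b : FlatForm G)

/-- The exponent of the scalar heat kernel at the complex time `u s`. -/
def exponent (u : ℂ) (σ s : ℝ) (k : ι → ℝ) : ℂ :=
  -(1 / (2 * (u * s)) * (1 / 2 * ((k ⬝ᵥ b.quad σ s *ᵥ k : ℝ) : ℂ))) +
    ((-(1 / 4) * G.theta 1 1 1 : ℝ) : ℂ) * (u * s) / 6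

/-- The scalar heat kernel at the complex time `u s`, where `u ^ 2 = -σ`. -/
def heat (u : ℂ) (σ s : ℝ) (k : ι → ℝ) : ℂ :=
  (4 * (Real.pi : ℂ) * (u * s)) ^ (-((Fintype.card ι : ℕ) : ℂ) / 2) *
    ((((G.jac k * b.detSinh σ s) ^ (-(1 / 2) : ℝ) : ℝ) : ℂ) * Complex.exp (b.exponent u σ s k))

/-- The covariant derivative along the left-invariant vector field `w`. -/
def cov (w : ι → ℝ) (f : (ι → ℝ) → ℂ) (k : ι → ℝ) : ℂ :=
  fderiv ℝ f k ((leftFun ℝ (G.ad k))⁻¹ *ᵥ w) -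
    1 / 2 * (Complex.I * ((w ⬝ᵥ b.mat *ᵥ k : ℝ) : ℂ)) * f k

/-- The logarithmic covariant derivative of the heat kernel. -/
def drift (u : ℂ) (σ s : ℝ) (w k : ι → ℝ) : ℂ :=
  -(1 / 2) * ((G.logJac k w : ℝ) : ℂ) - 1 / (2 * (u * s)) * ((w ⬝ᵥ b.quad σ s *ᵥ k : ℝ) : ℂ) -
    1 / 2 * (Complex.I * ((w ⬝ᵥ b.mat *ᵥ k : ℝ) : ℂ))

variable {k : ι → ℝ} {u : ℂ} {σ s : ℝ}

/-- The linear functional `v ↦ w ⬝ᵥ M *ᵥ v`. -/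
def dotMulVecCLM (M : Matrix ι ι ℝ) (w : ι → ℝ) : (ι → ℝ) →L[ℝ] ℝ :=
  LinearMap.toContinuousLinearMap (Matrix.toLinearMap₂' ℝ M w)

theorem dotMulVecCLM_apply (M : Matrix ι ι ℝ) (w v : ι → ℝ) :
    dotMulVecCLM M w v = w ⬝ᵥ M *ᵥ v := Matrix.toLinearMap₂'_apply' _ _ _

theorem hasFDerivAt_dotMulVec (M : Matrix ι ι ℝ) (w k : ι → ℝ) :
    HasFDerivAt (fun k => ((w ⬝ᵥ M *ᵥ k : ℝ) : ℂ)) (Complex.ofRealCLM.comp (dotMulVecCLM M w)) k := by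
  have h := (Complex.ofRealCLM.comp (dotMulVecCLM M w)).hasFDerivAt (x := k)
  convert! h using 2 with v
  simp [dotMulVecCLM_apply]

omit [DecidableEq ι] in
theorem contDiff_quadratic (M : Matrix ι ι ℝ) {n : WithTop ℕ∞} :
    ContDiff ℝ n (fun k : ι → ℝ => ((k ⬝ᵥ M *ᵥ k : ℝ) : ℂ)) := by
  refine Complex.ofRealCLM.contDiff.comp ?_
  refine ContDiff.sum fun A _ => (contDiff_apply ℝ ℝ A).mul ?_
  exact ContDiff.sum fun C _ => contDiff_const.mul (contDiff_apply ℝ ℝ C)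

theorem hasFDerivAt_quadratic {M : Matrix ι ι ℝ} (hM : Mᵀ = M) (k : ι → ℝ) :
    HasFDerivAt (fun k => ((k ⬝ᵥ M *ᵥ k : ℝ) : ℂ))
      ((2 : ℝ) • Complex.ofRealCLM.comp (dotMulVecCLM M k)) k := by
  have hd : DifferentiableAt ℝ (fun k : ι → ℝ => ((k ⬝ᵥ M *ᵥ k : ℝ) : ℂ)) k :=
    (contDiff_quadratic M (n := 1)).differentiable one_ne_zero |>.differentiableAt
  have hs : ∀ v, k ⬝ᵥ M *ᵥ v = v ⬝ᵥ M *ᵥ k := fun v => by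
    rw [dotProduct_comm, mulVec_dotProduct_eq, hM]
  convert! hd.hasFDerivAt using 1
  ext v
  have h1 := hd.hasFDerivAt.hasLineDerivAt v
  have h2 : HasDerivAt (fun r : ℝ => (((k + r • v) ⬝ᵥ M *ᵥ (k + r • v) : ℝ) : ℂ))
      ((2 * (k ⬝ᵥ M *ᵥ v) : ℝ) : ℂ) 0 := by
    refine HasDerivAt.ofReal_comp ?_
    have e : (fun r : ℝ => (k + r • v) ⬝ᵥ M *ᵥ (k + r • v)) = fun r : ℝ =>
        k ⬝ᵥ M *ᵥ k + r * (2 * (k ⬝ᵥ M *ᵥ v)) + r ^ 2 * (v ⬝ᵥ M *ᵥ v) := by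
      funext r
      simp only [Matrix.mulVec_add, Matrix.mulVec_smul, dotProduct_add, add_dotProduct,
        smul_dotProduct, dotProduct_smul, smul_eq_mul, hs v]
      ring
    rw [e]
    have h3 := (((hasDerivAt_id (0 : ℝ)).mul_const (2 * (k ⬝ᵥ M *ᵥ v))).const_add
      (k ⬝ᵥ M *ᵥ k)).add (((hasDerivAt_id (0 : ℝ)).pow 2).mul_const (v ⬝ᵥ M *ᵥ v))
    convert! h3 using 1
    simp
  have h3 := h1.unique h2
  rw [h3]
  simp [dotMulVecCLM_apply]

theorem jac_ne_zero_of_eventually (hk : G.jac k ≠ 0) : ∀ᶠ k' in 𝓝 k, G.jac k' ≠ 0 :=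
  ((G.contDiff_jac (n := 0)).continuous.continuousAt).eventually_ne hk

theorem contDiffAt_heat (hk : G.jac k ≠ 0) (he : b.detSinh σ s ≠ 0) {n : WithTop ℕ∞} :
    ContDiffAt ℝ n (b.heat u σ s) k := by
  refine contDiffAt_const.mul (ContDiffAt.mul ?_ ?_)
  · exact Complex.ofRealCLM.contDiff.contDiffAt.comp k
      ((G.contDiff_jac.contDiffAt.mul contDiffAt_const).rpow_const_of_ne (mul_ne_zero hk he))
  · refine ContDiffAt.cexp ?_
    exact ((contDiffAt_const.mul (contDiffAt_const.mul
      (contDiff_quadratic (b.quad σ s)).contDiffAt)).neg).add contDiffAt_const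

theorem hasFDerivAt_heat (hk : G.jac k ≠ 0) (he : b.detSinh σ s ≠ 0) :
    ∃ L : (ι → ℝ) →L[ℝ] ℂ, HasFDerivAt (b.heat u σ s) L k ∧ ∀ v, L v =
      (-(1 / 2) * ((G.logJac k v : ℝ) : ℂ) -
        1 / (2 * (u * s)) * ((v ⬝ᵥ b.quad σ s *ᵥ k : ℝ) : ℂ)) * b.heat u σ s k := by
  obtain ⟨L, hL, hL'⟩ := G.hasFDerivAt_jac hk
  have h1 := Complex.ofRealCLM.hasFDerivAt.comp k
    ((hL.mul_const (b.detSinh σ s)).rpow_const (p := (-(1 / 2) : ℝ)) (Or.inl (mul_ne_zero hk he)))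
  have h2 := (((hasFDerivAt_quadratic (b.transpose_quad σ s) k).const_mul (1 / 2 : ℂ)).const_mul
    (1 / (2 * (u * s)) : ℂ)).neg.add_const
      (((-(1 / 4) * G.theta 1 1 1 : ℝ) : ℂ) * (u * s) / 6)
  have h3 := (h1.mul h2.cexp).const_mul
    ((4 * (Real.pi : ℂ) * (u * s)) ^ (-((Fintype.card ι : ℕ) : ℂ) / 2))
  refine ⟨_, h3, fun v => ?_⟩
  have hs : k ⬝ᵥ b.quad σ s *ᵥ v = v ⬝ᵥ b.quad σ s *ᵥ k := by
    rw [dotProduct_comm, mulVec_dotProduct_eq, b.transpose_quad]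
  have hr : (G.jac k * b.detSinh σ s) ^ (-(1 / 2) - 1 : ℝ) * (G.jac k * b.detSinh σ s) =
      (G.jac k * b.detSinh σ s) ^ (-(1 / 2) : ℝ) := by
    rw [Real.rpow_sub_one (mul_ne_zero hk he), div_mul_cancel₀ _ (mul_ne_zero hk he)]
  have hr' := congrArg (fun x : ℝ => (x : ℂ)) hr
  simp only [_root_.smul_apply, _root_.add_apply,
    _root_.neg_apply, ContinuousLinearMap.comp_apply, dotMulVecCLM_apply, hL', hs,
    Complex.ofRealCLM_apply, smul_eq_mul, Complex.real_smul, heat, exponent, Pi.neg_apply,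
    Function.comp_apply]
  push_cast at hr' ⊢
  rw [← hr']
  ring

/-- Both logarithmic gradients are fixed by `Y⁻¹`, which therefore drops out. -/
theorem cov_heat (hk : G.jac k ≠ 0) (he : b.detSinh σ s ≠ 0) (w : ι → ℝ) :
    b.cov w (b.heat u σ s) k = b.drift u σ s w k * b.heat u σ s k := by
  obtain ⟨L, hL, hL'⟩ := b.hasFDerivAt_heat (u := u) hk he
  have h1 : G.logJac k ((leftFun ℝ (G.ad k))⁻¹ *ᵥ w) = G.logJac k w := by
    rw [G.logJac_eq_dotProduct, Matrix.dotProduct_mulVec, G.logJacVec_vecMul_inv hk,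
      ← G.logJac_eq_dotProduct]
  have h2 : ((leftFun ℝ (G.ad k))⁻¹ *ᵥ w) ⬝ᵥ b.quad σ s *ᵥ k = w ⬝ᵥ b.quad σ s *ᵥ k := by
    rw [dotProduct_comm, Matrix.dotProduct_mulVec, b.quad_vecMul_inv hk he, dotProduct_comm]
  rw [cov, hL.fderiv, hL', h1, h2, drift]
  ring

theorem hasFDerivAt_drift (hk : G.jac k ≠ 0) (w : ι → ℝ) :
    ∃ L : (ι → ℝ) →L[ℝ] ℂ, HasFDerivAt (b.drift u σ s w) L k ∧ ∀ v, L v =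
      -(1 / 2) * (((logDerDiff (G.ad k) (G.ad k) (G.ad v) * G.ad w).trace : ℝ) : ℂ) -
        1 / (2 * (u * s)) * ((w ⬝ᵥ b.quad σ s *ᵥ v : ℝ) : ℂ) -
        1 / 2 * (Complex.I * ((w ⬝ᵥ b.mat *ᵥ v : ℝ) : ℂ)) := by
  obtain ⟨L, hL, hL'⟩ := G.hasFDerivAt_logJac hk w
  have h1 := (Complex.ofRealCLM.hasFDerivAt.comp k hL).const_mul (-(1 / 2) : ℂ)
  have h2 := (hasFDerivAt_dotMulVec (b.quad σ s) w k).const_mul (1 / (2 * (u * s)) : ℂ)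
  have h3 := ((hasFDerivAt_dotMulVec b.mat w k).const_mul Complex.I).const_mul (1 / 2 : ℂ)
  refine ⟨_, (h1.sub h2).sub h3, fun v => ?_⟩
  simp only [_root_.smul_apply, _root_.sub_apply, ContinuousLinearMap.comp_apply,
    dotMulVecCLM_apply, hL', Complex.ofRealCLM_apply, smul_eq_mul]

/-- Regularity is an open condition, so `cov_heat` holds near `k` and may be differentiated. In the
derivative of `drift` the matrix `Y⁻¹` remains. -/
theorem cov_cov_heat (hk : G.jac k ≠ 0) (he : b.detSinh σ s ≠ 0) (v w : ι → ℝ) :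
    b.cov v (b.cov w (b.heat u σ s)) k =
      (-(1 / 2) * (((logDerDiff (G.ad k) (G.ad k) (G.ad ((leftFun ℝ (G.ad k))⁻¹ *ᵥ v)) *
          G.ad w).trace : ℝ) : ℂ) -
        1 / (2 * (u * s)) * ((w ⬝ᵥ b.quad σ s *ᵥ ((leftFun ℝ (G.ad k))⁻¹ *ᵥ v) : ℝ) : ℂ) -
        1 / 2 * (Complex.I * ((w ⬝ᵥ b.mat *ᵥ ((leftFun ℝ (G.ad k))⁻¹ *ᵥ v) : ℝ) : ℂ)) +
        b.drift u σ s v k * b.drift u σ s w k) * b.heat u σ s k := by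
  have hev : b.cov w (b.heat u σ s) =ᶠ[𝓝 k] fun k => b.drift u σ s w k * b.heat u σ s k :=
    (jac_ne_zero_of_eventually hk).mono fun k' hk' => b.cov_heat hk' he w
  obtain ⟨L, hL, hL'⟩ := b.hasFDerivAt_drift (u := u) (σ := σ) (s := s) hk w
  obtain ⟨M, hM, hM'⟩ := b.hasFDerivAt_heat (u := u) hk he
  have h1 := b.cov_heat (u := u) hk he v
  rw [cov, hM.fderiv] at h1
  rw [cov, hev.fderiv_eq, hev.self_of_nhds, (hL.fun_mul hM).fderiv]
  simp only [_root_.smul_apply, _root_.add_apply, smul_eq_mul, hL']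
  linear_combination (b.drift u σ s w k) * h1

/-- The terms in `log j` alone give `logDer_laplacian`. The quantity `tr Y⁻¹ - N` from
differentiating the Gaussian exponent cancels against the two cross terms with `log j`, and the
mixed terms linear in `b` vanish. -/
theorem sum_cov_cov_heat (hk : G.jac k ≠ 0) (he : b.detSinh σ s ≠ 0) :
    ∑ A, b.cov (stdVec A) (b.cov (G.form⁻¹ *ᵥ stdVec A) (b.heat u σ s)) k =
      (((-(1 / 24) * G.theta 1 1 1 : ℝ) : ℂ) - 1 / (2 * (u * s)) * (((b.coth σ s).trace : ℝ) : ℂ) +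
        (1 / (2 * (u * s))) ^ 2 * ((k ⬝ᵥ (G.form * b.coth σ s ^ 2) *ᵥ k : ℝ) : ℂ) +
        1 / 4 * ((k ⬝ᵥ b.mat ^ 2 *ᵥ k : ℝ) : ℂ)) * b.heat u σ s k := by
  simp only [b.cov_cov_heat hk he]
  rw [← Finset.sum_mul]
  congr 1
  set z := G.logJacVec k
  set x := b.quad σ s *ᵥ k with hx
  set y := b.mat *ᵥ k with hy
  have hdrift : ∀ w, b.drift u σ s w k = -(1 / 2) * ((z ⬝ᵥ w : ℝ) : ℂ) -
      1 / (2 * (u * s)) * ((x ⬝ᵥ w : ℝ) : ℂ) - 1 / 2 * (Complex.I * ((y ⬝ᵥ w : ℝ) : ℂ)) := by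
    intro w
    rw [drift, G.logJac_eq_dotProduct, dotProduct_comm w, dotProduct_comm w]
  have hc : ∀ a c : ι → ℝ, a ⬝ᵥ G.form⁻¹ *ᵥ c = c ⬝ᵥ G.form⁻¹ *ᵥ a := fun a c => by
    rw [dotProduct_comm, mulVec_dotProduct_eq, G.form_inv_symm]
  have e1 := congrArg (fun r : ℝ => (r : ℂ)) (G.logDer_laplacian (G.isUnit_leftFun_iff.mpr hk))
  have e2 := congrArg (fun r : ℝ => (r : ℂ)) (b.sum_quad hk he)
  have e3 := congrArg (fun r : ℝ => (r : ℂ)) (b.sum_mat hk)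
  have s1 := fun a c : ι → ℝ => congrArg (fun r : ℝ => (r : ℂ)) (sum_dotProduct_mul (G := G) a c)
  have i1 := b.logJacVec_inv_quad hk he
  have i2 := b.logJacVec_inv_mat k k
  have i3 := b.quad_inv_mat k σ s
  have i4 := b.mat_inv_mat k
  have i5 := b.quad_inv_quad k σ s
  rw [← hx] at i1 i3 i5
  rw [← hy] at i2 i3 i4
  have s11 := s1 z z
  have s12 := s1 z x
  have s13 := s1 z y
  have s21 := s1 x z
  have s22 := s1 x x
  have s23 := s1 x y
  have s31 := s1 y z
  have s32 := s1 y x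
  have s33 := s1 y y
  rw [hc x z] at s21
  rw [hc y z] at s31
  rw [hc y x] at s32
  rw [i1] at s12 s21
  rw [i2] at s13 s31
  rw [i3] at s23 s32
  rw [i4] at s33
  rw [i5] at s22
  have e1' : (1 / 4 : ℂ) * ∑ A, ((z ⬝ᵥ stdVec A : ℝ) : ℂ) * ((z ⬝ᵥ G.form⁻¹ *ᵥ stdVec A : ℝ) : ℂ)
      - 1 / 2 * ∑ A, (((logDerDiff (G.ad k) (G.ad k) (G.ad ((leftFun ℝ (G.ad k))⁻¹ *ᵥ stdVec A)) *
          G.ad (G.form⁻¹ *ᵥ stdVec A)).trace : ℝ) : ℂ) = ((-(1 / 24) * G.theta 1 1 1 : ℝ) : ℂ) := by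
    rw [← e1]
    simp only [z, ← G.logJac_eq_dotProduct]
    push_cast
    rfl
  simp only [hdrift]
  clear_value x y z
  clear e1 hdrift hx hy
  push_cast at e2 e3 s11 s12 s13 s21 s22 s23 s31 s32 s33 ⊢
  push_cast at e1'
  rw [← e1']
  generalize hr : (1 / (2 * (u * s)) : ℂ) = r
  set LD : ι → ℂ := fun A => (((logDerDiff (G.ad k) (G.ad k)
    (G.ad ((leftFun ℝ (G.ad k))⁻¹ *ᵥ stdVec A)) * G.ad (G.form⁻¹ *ᵥ stdVec A)).trace : ℝ) : ℂ)
  set q : ι → ℂ := fun A => ((G.form⁻¹ *ᵥ stdVec A ⬝ᵥ b.quad σ s *ᵥ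
    (leftFun ℝ (G.ad k))⁻¹ *ᵥ stdVec A : ℝ) : ℂ)
  set m : ι → ℂ := fun A => ((G.form⁻¹ *ᵥ stdVec A ⬝ᵥ b.mat *ᵥ
    (leftFun ℝ (G.ad k))⁻¹ *ᵥ stdVec A : ℝ) : ℂ)
  set z₁ : ι → ℂ := fun A => ((z ⬝ᵥ stdVec A : ℝ) : ℂ)
  set z₂ : ι → ℂ := fun A => ((z ⬝ᵥ G.form⁻¹ *ᵥ stdVec A : ℝ) : ℂ)
  set x₁ : ι → ℂ := fun A => ((x ⬝ᵥ stdVec A : ℝ) : ℂ)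
  set x₂ : ι → ℂ := fun A => ((x ⬝ᵥ G.form⁻¹ *ᵥ stdVec A : ℝ) : ℂ)
  set y₁ : ι → ℂ := fun A => ((y ⬝ᵥ stdVec A : ℝ) : ℂ)
  set y₂ : ι → ℂ := fun A => ((y ⬝ᵥ G.form⁻¹ *ᵥ stdVec A : ℝ) : ℂ)
  have key : ∑ A, (-(1 / 2) * LD A - r * q A - 1 / 2 * (Complex.I * m A) +
      (-(1 / 2) * z₁ A - r * x₁ A - 1 / 2 * (Complex.I * y₁ A)) *
        (-(1 / 2) * z₂ A - r * x₂ A - 1 / 2 * (Complex.I * y₂ A))) =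
      (1 / 4 * ∑ A, z₁ A * z₂ A - 1 / 2 * ∑ A, LD A) - r * ∑ A, q A
        - 1 / 2 * Complex.I * ∑ A, m A + r / 2 * ∑ A, z₁ A * x₂ A + r / 2 * ∑ A, x₁ A * z₂ A
        + r ^ 2 * ∑ A, x₁ A * x₂ A + Complex.I / 4 * ∑ A, z₁ A * y₂ A
        + Complex.I / 4 * ∑ A, y₁ A * z₂ A + r * Complex.I / 2 * ∑ A, x₁ A * y₂ A
        + r * Complex.I / 2 * ∑ A, y₁ A * x₂ A - 1 / 4 * ∑ A, y₁ A * y₂ A := by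
    simp only [Finset.mul_sum, ← Finset.sum_add_distrib, ← Finset.sum_sub_distrib]
    refine Finset.sum_congr rfl fun A _ => ?_
    linear_combination (1 / 4 * y₁ A * y₂ A) * Complex.I_sq
  rw [key, e2, e3, s12, s21, s22, s13, s31, s23, s32, s33]
  ring

theorem hasDerivAt_coth_form (hs : s ≠ 0) (he : b.detSinh σ s ≠ 0) (k : ι → ℝ) :
    HasDerivAt (fun s => k ⬝ᵥ (G.form * (s⁻¹ • b.coth σ s)) *ᵥ k)
      (k ⬝ᵥ (G.form * (σ • b.mat ^ 2 - (s⁻¹ • b.coth σ s) ^ 2)) *ᵥ k) s := by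
  have h := hasDerivAt_inv_smul_cothSqrt (σ • b.mat ^ 2) hs (b.isUnit_sinhSqrt he)
  let L : Matrix ι ι ℝ →ₗ[ℝ] ℝ :=
    { toFun := fun M => k ⬝ᵥ (G.form * M) *ᵥ k
      map_add' := fun M N => by rw [mul_add, Matrix.add_mulVec, dotProduct_add]
      map_smul' := fun r M => by
        rw [Matrix.mul_smul, Matrix.smul_mulVec, dotProduct_smul, RingHom.id_apply] }
  exact (LinearMap.toContinuousLinearMap L).hasFDerivAt.comp_hasDerivAt s h

/-- The factor `1/s` is moved into the cotangent to match the Riccati equation. -/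
theorem exponent_eq (k : ι → ℝ) : (fun s : ℝ => b.exponent u σ s k) = fun s : ℝ =>
    -(1 / (4 * u)) * ((k ⬝ᵥ (G.form * (s⁻¹ • b.coth σ s)) *ᵥ k : ℝ) : ℂ) +
      ((-(1 / 24) * G.theta 1 1 1 : ℝ) : ℂ) * u * ((s : ℝ) : ℂ) := by
  funext s
  rw [exponent, Matrix.mul_smul, Matrix.smul_mulVec, dotProduct_smul, quad]
  push_cast
  rw [smul_eq_mul]
  push_cast
  ring

theorem mul_mem_slitPlane {u : ℂ} (hu : u ∈ Complex.slitPlane) (hs : 0 < s) :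
    4 * (Real.pi : ℂ) * (u * s) ∈ Complex.slitPlane := by
  have h : 4 * (Real.pi : ℂ) * (u * s) = ((4 * Real.pi * s : ℝ) : ℂ) * u := by
    push_cast
    ring
  have hp : 0 < 4 * Real.pi * s := by positivity
  rw [h, Complex.mem_slitPlane_iff] at *
  rw [Complex.re_ofReal_mul, Complex.im_ofReal_mul]
  exact hu.imp (fun h => mul_pos hp h) fun h => mul_ne_zero hp.ne' h

/-- The scalar heat equation. -/
theorem hasDerivAt_heat (hu : u ∈ Complex.slitPlane) (hσ : u ^ 2 = -σ) (hs : 0 < s)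
    (hk : G.jac k ≠ 0) (he : b.detSinh σ s ≠ 0) :
    HasDerivAt (fun s : ℝ => b.heat u σ s k)
      (u * ∑ A, b.cov (stdVec A) (b.cov (G.form⁻¹ *ᵥ stdVec A) (b.heat u σ s)) k) s := by
  have hu0 : u ≠ 0 := Complex.slitPlane_ne_zero hu
  have hs0 : (s : ℂ) ≠ 0 := Complex.ofReal_ne_zero.mpr hs.ne'
  have h4 := mul_mem_slitPlane hu hs
  have h40 := Complex.slitPlane_ne_zero h4
  have h1 : HasDerivAt (fun s : ℝ =>
      (4 * (Real.pi : ℂ) * (u * s)) ^ (-((Fintype.card ι : ℕ) : ℂ) / 2))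
      (-((Fintype.card ι : ℕ) : ℂ) / 2 * (s : ℂ)⁻¹ *
        (4 * (Real.pi : ℂ) * (u * s)) ^ (-((Fintype.card ι : ℕ) : ℂ) / 2)) s := by
    have h := ((((hasDerivAt_id (s : ℂ)).const_mul u).const_mul
      (4 * (Real.pi : ℂ))).cpow_const (c := -((Fintype.card ι : ℕ) : ℂ) / 2) h4).comp_ofReal
    refine h.congr_deriv ?_
    simp only [id]
    rw [Complex.cpow_sub _ _ h40, Complex.cpow_one]
    have hpi : (Real.pi : ℂ) ≠ 0 := Complex.ofReal_ne_zero.mpr Real.pi_ne_zero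
    field_simp
  have h2 : HasDerivAt (fun s : ℝ => (((G.jac k * b.detSinh σ s) ^ (-(1 / 2) : ℝ) : ℝ) : ℂ))
      (((-(1 / 2) * (s⁻¹ * ((b.coth σ s).trace - Fintype.card ι)) *
        (G.jac k * b.detSinh σ s) ^ (-(1 / 2) : ℝ) : ℝ)) : ℂ) s := by
    refine HasDerivAt.ofReal_comp ?_
    have h := ((hasDerivAt_det_sinhSqrt (σ • b.mat ^ 2) hs.ne' (b.isUnit_sinhSqrt he)).const_mul
      (G.jac k)).rpow_const (p := (-(1 / 2) : ℝ)) (Or.inl (mul_ne_zero hk he))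
    refine h.congr_deriv ?_
    have hr : (G.jac k * b.detSinh σ s) ^ (-(1 / 2) - 1 : ℝ) * (G.jac k * b.detSinh σ s) =
        (G.jac k * b.detSinh σ s) ^ (-(1 / 2) : ℝ) := by
      rw [Real.rpow_sub_one (mul_ne_zero hk he), div_mul_cancel₀ _ (mul_ne_zero hk he)]
    rw [← hr]
    change G.jac k * (b.detSinh σ s * (s⁻¹ * ((b.coth σ s).trace - Fintype.card ι))) *
      (-(1 / 2)) * (G.jac k * b.detSinh σ s) ^ (-(1 / 2) - 1 : ℝ) = _
    ring
  have h3 : HasDerivAt (fun s : ℝ => Complex.exp (b.exponent u σ s k))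
      ((-(1 / (4 * u)) * ((k ⬝ᵥ (G.form * (σ • b.mat ^ 2 - (s⁻¹ • b.coth σ s) ^ 2)) *ᵥ k : ℝ) : ℂ) +
        ((-(1 / 24) * G.theta 1 1 1 : ℝ) : ℂ) * u) * Complex.exp (b.exponent u σ s k)) s := by
    have h := (((b.hasDerivAt_coth_form hs.ne' he k).ofReal_comp.const_mul (-(1 / (4 * u)))).add
      ((hasDerivAt_id (s : ℂ)).comp_ofReal.const_mul
        (((-(1 / 24) * G.theta 1 1 1 : ℝ) : ℂ) * u)))
    have h' : HasDerivAt (fun s : ℝ => b.exponent u σ s k)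
        (-(1 / (4 * u)) * ((k ⬝ᵥ (G.form * (σ • b.mat ^ 2 - (s⁻¹ • b.coth σ s) ^ 2)) *ᵥ k : ℝ) : ℂ) +
          ((-(1 / 24) * G.theta 1 1 1 : ℝ) : ℂ) * u * 1) s := by
      rw [b.exponent_eq]
      exact h
    refine h'.cexp.congr_deriv ?_
    ring
  refine (h1.mul (h2.mul h3)).congr_deriv ?_
  rw [b.sum_cov_cov_heat hk he]
  have e : k ⬝ᵥ (G.form * (σ • b.mat ^ 2 - (s⁻¹ • b.coth σ s) ^ 2)) *ᵥ k =
      σ * (k ⬝ᵥ b.mat ^ 2 *ᵥ k) - s⁻¹ ^ 2 * (k ⬝ᵥ (G.form * b.coth σ s ^ 2) *ᵥ k) := by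
    rw [mul_sub, Matrix.mul_smul, pow_two b.mat, ← mul_assoc, b.form_mul, smul_pow,
      Matrix.mul_smul, Matrix.sub_mulVec, Matrix.smul_mulVec, Matrix.smul_mulVec, dotProduct_sub,
      dotProduct_smul, dotProduct_smul, smul_eq_mul, smul_eq_mul]
  rw [e, heat]
  simp only [Pi.mul_apply]
  generalize (4 * (Real.pi : ℂ) * (u * s)) ^ (-((Fintype.card ι : ℕ) : ℂ) / 2) = P
  generalize (G.jac k * b.detSinh σ s) ^ (-(1 / 2) : ℝ) = Q
  generalize Complex.exp (b.exponent u σ s k) = T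
  generalize k ⬝ᵥ (G.form * b.coth σ s ^ 2) *ᵥ k = c
  generalize k ⬝ᵥ b.mat ^ 2 *ᵥ k = d
  -- This turns the coefficient `-σ / (4u)` of `k b² k` from the Riccati equation into the `u / 4`
  -- of the spatial side.
  have hσ' : (σ : ℂ) = -u ^ 2 := by rw [hσ, neg_neg]
  push_cast
  rw [hσ']
  field_simp
  ring

end FlatForm

end

end CurvatureGroup

/-! ### The Lie algebra generated by the curvature. -/

namespace CurvatureGroup

noncomputable section

open Matrix

namespace SymmetricSpaceCurvature

variable {n p : ℕ} (S : SymmetricSpaceCurvature n p)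

theorem D_apply (i : Fin p) (a b : Fin n) : S.D i a b = -∑ k, S.β i k * S.E k a b := by
  simp [D, Matrix.sum_apply]

theorem D_transpose (i : Fin p) : (S.D i)ᵀ = -S.D i := by
  simp [D, Matrix.transpose_sum, S.E_antisymm]

theorem E_swap (i : Fin p) (a b : Fin n) : S.E i a b = -S.E i b a := by
  have h := congrFun (congrFun (S.E_antisymm i) b) a
  simpa using h

theorem D_swap (i : Fin p) (a b : Fin n) : S.D i a b = -S.D i b a := by
  have h := congrFun (congrFun (S.D_transpose i) b) a
  simpa using h

theorem β_swap (i k : Fin p) : S.β i k = S.β k i := by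
  have h := congrFun (congrFun S.β_symm k) i
  simpa using h

theorem riemann_sum_eq (a b c d : Fin n) :
    ∑ i, ∑ k, S.β i k * S.E i a b * S.E k c d = -∑ i, S.E i a b * S.D i c d := by
  simp only [D_apply, Finset.mul_sum, mul_neg, Finset.sum_neg_distrib, neg_neg]
  exact Finset.sum_congr rfl fun i _ => Finset.sum_congr rfl fun k _ => by ring

theorem riemann_sum_eq' (a b c d : Fin n) :
    ∑ i, ∑ k, S.β i k * S.E i a b * S.E k c d = -∑ i, S.D i a b * S.E i c d := by
  rw [Finset.sum_comm]
  simp only [D_apply, Finset.sum_mul, neg_mul, Finset.sum_neg_distrib, neg_neg]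
  exact Finset.sum_congr rfl fun i _ => Finset.sum_congr rfl fun k _ => by rw [S.β_swap]

/-- The commutators `[D_i, E^j]`. -/
def commDE (i j : Fin p) : Matrix (Fin n) (Fin n) ℝ := S.D i * S.E j - S.E j * S.D i

theorem commDE_apply (i j : Fin p) (a b : Fin n) : S.commDE i j a b =
    -∑ e, (S.D i e a * S.E j e b - S.D i e b * S.E j e a) := by
  rw [commDE, Matrix.sub_apply, Matrix.mul_apply, Matrix.mul_apply, ← Finset.sum_sub_distrib,
    ← Finset.sum_neg_distrib]
  refine Finset.sum_congr rfl fun e _ => ?_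
  rw [S.D_swap i a e, S.E_swap j a e]
  ring

/-- The integrability condition is a combination of the matrices `E^i_{fg}`; by their independence
it holds for each `i` separately. -/
theorem sum_D_commDE (i : Fin p) (a b c d : Fin n) :
    ∑ j, (S.D j c d * S.commDE i j a b + S.D j a b * S.commDE i j c d) = 0 := by
  have h : ∑ i, (∑ j, (S.D j c d * S.commDE i j a b + S.D j a b * S.commDE i j c d)) • S.E i =
      0 := by
    ext f g
    have h := S.parallel f g a b c d
    simp only [riemann_sum_eq] at h
    rw [Matrix.zero_apply, Matrix.sum_apply, ← neg_eq_zero, ← h, ← Finset.sum_neg_distrib]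
    simp only [Matrix.smul_apply, smul_eq_mul, Finset.sum_mul, commDE_apply,
      Finset.mul_sum, ← Finset.sum_sub_distrib, ← Finset.sum_add_distrib, mul_neg, neg_mul,
      ← Finset.sum_neg_distrib]
    rw [Finset.sum_comm_cycle]
    refine Finset.sum_congr rfl fun e _ => ?_
    rw [Finset.sum_comm]
    refine Finset.sum_congr rfl fun i _ => Finset.sum_congr rfl fun j _ => ?_
    ring
  exact Fintype.linearIndependent_iff.mp S.E_linearIndependent _ h i

theorem D_linearIndependent : LinearIndependent ℝ S.D := by
  rw [Fintype.linearIndependent_iff]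
  intro x hx
  have h1 : ∑ k, (x ᵥ* S.β) k • S.E k = 0 := by
    have h2 : ∑ k, (x ᵥ* S.β) k • S.E k = -∑ i, x i • S.D i := by
      simp only [D, smul_neg, Finset.sum_neg_distrib, neg_neg, Finset.smul_sum, Matrix.vecMul,
        dotProduct, Finset.sum_smul, smul_smul]
      rw [Finset.sum_comm]
    rw [h2, hx, neg_zero]
  have h3 : x ᵥ* S.β = 0 := funext fun k =>
    Fintype.linearIndependent_iff.mp S.E_linearIndependent _ h1 k
  have h4 := Matrix.eq_zero_of_vecMul_eq_zero S.β_nondegenerate h3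
  exact fun i => congrFun h4 i

/-- `D(x) = x^i D_i`. -/
def holonomy (x : Fin p → ℝ) : Matrix (Fin n) (Fin n) ℝ := ∑ i, x i • S.D i

/-- Identities for `F` are read off from the faithful matrices `D(x)`, where the bracket is a
commutator. -/
theorem holonomy_injective : Function.Injective S.holonomy := by
  intro x y h
  rw [holonomy, holonomy, ← sub_eq_zero, ← Finset.sum_sub_distrib] at h
  simp only [← sub_smul] at h
  exact funext fun i => sub_eq_zero.mp (Fintype.linearIndependent_iff.mp S.D_linearIndependent _ h i)

theorem commutator_D_eq (i k : Fin p) :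
    S.D i * S.D k - S.D k * S.D i = -∑ j, S.β k j • S.commDE i j := by
  simp only [commDE, smul_sub, Finset.sum_sub_distrib]
  conv_lhs => rw [D.eq_def S k]
  simp only [Matrix.mul_neg, Matrix.neg_mul, Matrix.mul_sum, Matrix.sum_mul, Matrix.mul_smul,
    Matrix.smul_mul]
  abel

/-- As `F` is a choice, the content is closure. The tensor `∑ D_j ⊗ [D_i, E^j]` is antisymmetric
under exchange of its factors by `sum_D_commDE`; functionals dual to the independent `D_j` then put
each `[D_i, E^m]` into the span of the `D_j`, and contraction with `β` gives `[D_i, D_k]`. -/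
theorem F_spec (i k : Fin p) : S.D i * S.D k - S.D k * S.D i = ∑ j, S.F j i k • S.D j := by
  have hex : ∃ F : Fin p → Fin p → Fin p → ℝ,
      ∀ i k, S.D i * S.D k - S.D k * S.D i = ∑ j, F j i k • S.D j := by
    let T : (Fin p → ℝ) →ₗ[ℝ] Matrix (Fin n) (Fin n) ℝ :=
      Fintype.linearCombination ℝ S.D
    obtain ⟨φ, hφ⟩ := T.exists_leftInverse_of_injective
      (LinearMap.ker_eq_bot.mpr S.holonomy_injective)
    have hφD : ∀ j m, φ (S.D j) m = if j = m then 1 else 0 := by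
      intro j m
      have h := congrFun (LinearMap.congr_fun hφ (Pi.single j 1)) m
      have hT : T (Pi.single j 1) = S.D j := by simp [T]
      rw [LinearMap.comp_apply, hT] at h
      rw [h]
      simp [Pi.single_apply, eq_comm]
    have key : ∀ i m, S.commDE i m = -∑ j, φ (S.commDE i j) m • S.D j := by
      intro i m
      ext a b
      have h : ∑ j, (S.commDE i j a b • S.D j + S.D j a b • S.commDE i j) = 0 := by
        ext c d
        have h := S.sum_D_commDE i a b c d
        rw [Matrix.zero_apply, ← h, Matrix.sum_apply]
        refine Finset.sum_congr rfl fun j _ => ?_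
        simp
        ring
      have h' := congrFun (congrArg φ h) m
      simp only [map_sum, map_add, map_smul, Finset.sum_apply, Pi.add_apply, Pi.smul_apply,
        smul_eq_mul, hφD, Finset.sum_add_distrib, mul_ite, mul_one, mul_zero,
        Finset.sum_ite_eq', Finset.mem_univ, if_true, map_zero, Pi.zero_apply] at h'
      rw [Matrix.neg_apply, Matrix.sum_apply, eq_neg_iff_add_eq_zero, ← h']
      congr 1
      exact Finset.sum_congr rfl fun j _ => by simp [mul_comm]
    refine ⟨fun j i k => ∑ m, S.β k m * φ (S.commDE i j) m, fun i k => ?_⟩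
    rw [commutator_D_eq]
    conv_lhs => enter [1, 2, j]; rw [key i j]
    simp only [smul_neg, Finset.sum_neg_distrib, neg_neg, Finset.smul_sum, Finset.sum_smul,
      smul_smul]
    rw [Finset.sum_comm]
  exact Classical.epsilon_spec hex i k

theorem sum_D_smul_commDE (i : Fin p) (a b : Fin n) :
    ∑ j, (S.commDE i j a b + ∑ m, S.F j i m * S.E m a b) • S.D j = 0 := by
  ext c d
  have h := S.sum_D_commDE i a b c d
  rw [Finset.sum_add_distrib] at h
  have h2 : ∑ j, S.D j a b * S.commDE i j c d = ∑ j, ∑ m, S.F j i m * S.E m a b * S.D j c d := by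
    have h3 : ∀ k, -∑ j, S.β k j * S.commDE i j c d = ∑ j, S.F j i k * S.D j c d := fun k => by
      have := congrFun (congrFun ((S.commutator_D_eq i k).symm.trans (S.F_spec i k)) c) d
      simpa [Matrix.sum_apply] using this
    rw [Finset.sum_comm]
    calc _ = ∑ k, S.E k a b * -∑ j, S.β k j * S.commDE i j c d := by
          simp only [D_apply, neg_mul, Finset.sum_mul, Finset.sum_neg_distrib, mul_neg,
            Finset.mul_sum]
          rw [Finset.sum_comm]
          congr 1
          exact Finset.sum_congr rfl fun j _ => Finset.sum_congr rfl fun k _ => by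
            rw [S.β_swap]; ring
      _ = _ := by
          simp only [h3, Finset.mul_sum]
          exact Finset.sum_congr rfl fun j _ => Finset.sum_congr rfl fun k _ => by ring
  rw [h2] at h
  rw [Matrix.zero_apply, Matrix.sum_apply, ← h, ← Finset.sum_add_distrib]
  refine Finset.sum_congr rfl fun j _ => ?_
  rw [Matrix.smul_apply, smul_eq_mul, add_mul, Finset.sum_mul]
  ring

/-- The `E^j` transform dually to the `D_j`: the coefficients of the independent `D_j` in the
preceding sum vanish. -/
theorem commDE_eq (i j : Fin p) : S.commDE i j = -∑ m, S.F j i m • S.E m := by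
  ext a b
  have h := Fintype.linearIndependent_iff.mp S.D_linearIndependent _ (S.sum_D_smul_commDE i a b) j
  rw [Matrix.neg_apply, Matrix.sum_apply]
  simp only [Matrix.smul_apply, smul_eq_mul]
  linarith

/-- Invariance of `β`: `F_spec` and `commDE_eq` expand `[D_i, D_k]` in the independent `E^m` in two
ways. -/
theorem F_invariant (i k m : Fin p) :
    ∑ j, S.β k j * S.F j i m = -∑ j, S.F j i k * S.β j m := by
  have h := (S.commutator_D_eq i k).symm.trans (S.F_spec i k)
  simp only [commDE_eq, D, smul_neg, Finset.sum_neg_distrib, neg_neg, Finset.smul_sum,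
    smul_smul] at h
  rw [Finset.sum_comm, Finset.sum_comm (f := fun x y => (S.F x i k * S.β x y) • S.E y),
    ← sub_eq_zero, sub_neg_eq_add, ← Finset.sum_add_distrib] at h
  simp only [← Finset.sum_smul, ← add_smul] at h
  have := Fintype.linearIndependent_iff.mp S.E_linearIndependent _ h m
  linarith

/-- The bracket of the holonomy algebra. -/
def holBracket (x y : Fin p → ℝ) : Fin p → ℝ := fun j => ∑ i, ∑ k, S.F j i k * x i * y k

/-- The holonomy component of the bracket of two translations. -/
def transBracket (u v : Fin n → ℝ) : Fin p → ℝ := fun i => u ⬝ᵥ S.E i *ᵥ v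

theorem holonomy_add (x y : Fin p → ℝ) : S.holonomy (x + y) = S.holonomy x + S.holonomy y := by
  simp [holonomy, add_smul, Finset.sum_add_distrib]

theorem holonomy_sub (x y : Fin p → ℝ) : S.holonomy (x - y) = S.holonomy x - S.holonomy y := by
  simp [holonomy, sub_smul]

theorem holonomy_transpose (x : Fin p → ℝ) : (S.holonomy x)ᵀ = -S.holonomy x := by
  simp [holonomy, Matrix.transpose_sum, S.D_transpose]

theorem holonomy_holBracket (x y : Fin p → ℝ) : S.holonomy (S.holBracket x y) =
    S.holonomy x * S.holonomy y - S.holonomy y * S.holonomy x := by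
  have h : S.holonomy x * S.holonomy y - S.holonomy y * S.holonomy x =
      ∑ i, ∑ k, (x i * y k) • (S.D i * S.D k - S.D k * S.D i) := by
    simp only [holonomy, Matrix.sum_mul, Matrix.mul_sum, Matrix.smul_mul, Matrix.mul_smul,
      smul_sub, Finset.sum_sub_distrib, Finset.smul_sum, smul_smul]
    congr 1
    rw [Finset.sum_comm]
    exact Finset.sum_congr rfl fun i _ => Finset.sum_congr rfl fun k _ => by rw [mul_comm]
  rw [h]
  simp only [S.F_spec, holonomy, holBracket, Finset.sum_smul, Finset.smul_sum, smul_smul]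
  rw [Finset.sum_comm_cycle, Finset.sum_comm_cycle]
  exact Finset.sum_congr rfl fun i _ => Finset.sum_congr rfl fun k _ =>
    Finset.sum_congr rfl fun j _ => by congr 1; ring

theorem holBracket_swap (x y : Fin p → ℝ) : S.holBracket x y = -S.holBracket y x := by
  apply S.holonomy_injective
  have : S.holonomy (-S.holBracket y x) = -S.holonomy (S.holBracket y x) := by simp [holonomy]
  rw [this, holonomy_holBracket, holonomy_holBracket]
  abel

theorem holBracket_add_left (x x' y : Fin p → ℝ) :
    S.holBracket (x + x') y = S.holBracket x y + S.holBracket x' y := by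
  apply S.holonomy_injective
  simp only [holonomy_holBracket, holonomy_add, Matrix.add_mul, Matrix.mul_add]
  abel

theorem holBracket_add_right (x y y' : Fin p → ℝ) :
    S.holBracket x (y + y') = S.holBracket x y + S.holBracket x y' := by
  apply S.holonomy_injective
  simp only [holonomy_holBracket, holonomy_add, Matrix.add_mul, Matrix.mul_add]
  abel

theorem holBracket_jacobi (x y z : Fin p → ℝ) : S.holBracket (S.holBracket x y) z =
    S.holBracket x (S.holBracket y z) - S.holBracket y (S.holBracket x z) := by
  apply S.holonomy_injective
  simp only [holonomy_holBracket, holonomy_sub]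
  noncomm_ring

theorem transBracket_swap (u v : Fin n → ℝ) : S.transBracket u v = -S.transBracket v u := by
  funext i
  rw [Pi.neg_apply, transBracket, transBracket, dotProduct_comm,
    FlatForm.mulVec_dotProduct_eq, S.E_antisymm, Matrix.neg_mulVec, dotProduct_neg]

theorem transBracket_sub_left (u u' v : Fin n → ℝ) :
    S.transBracket (u - u') v = S.transBracket u v - S.transBracket u' v := by
  funext i
  simp [transBracket, sub_dotProduct]

theorem transBracket_sub_right (u v v' : Fin n → ℝ) :
    S.transBracket u (v - v') = S.transBracket u v - S.transBracket u v' := by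
  funext i
  simp [transBracket, Matrix.mulVec_sub, dotProduct_sub]

theorem transBracket_holonomy (x : Fin p → ℝ) (u v : Fin n → ℝ) :
    S.transBracket (S.holonomy x *ᵥ u) v + S.transBracket u (S.holonomy x *ᵥ v) =
      S.holBracket x (S.transBracket u v) := by
  funext j
  rw [Pi.add_apply, transBracket, transBracket, FlatForm.mulVec_dotProduct_eq,
    S.holonomy_transpose, Matrix.neg_mulVec, Matrix.mulVec_mulVec, Matrix.mulVec_mulVec,
    dotProduct_neg]
  have h : S.E j * S.holonomy x - S.holonomy x * S.E j = ∑ i, ∑ m, (S.F j i m * x i) • S.E m := by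
    have h1 : S.E j * S.holonomy x - S.holonomy x * S.E j = -∑ i, x i • S.commDE i j := by
      simp only [holonomy, commDE, Matrix.mul_sum, Matrix.sum_mul, Matrix.mul_smul,
        Matrix.smul_mul, smul_sub, Finset.sum_sub_distrib]
      abel
    rw [h1]
    simp only [commDE_eq, smul_neg, Finset.sum_neg_distrib, neg_neg, Finset.smul_sum, smul_smul]
    exact Finset.sum_congr rfl fun i _ => Finset.sum_congr rfl fun k _ => by rw [mul_comm]
  rw [neg_add_eq_sub, ← dotProduct_sub, ← Matrix.sub_mulVec, h]
  simp only [Matrix.sum_mulVec, Matrix.smul_mulVec, dotProduct_sum, dotProduct_smul, smul_eq_mul,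
    holBracket, transBracket]

theorem holonomy_transBracket_apply (u v : Fin n → ℝ) (a b : Fin n) :
    S.holonomy (S.transBracket u v) a b = -∑ c, ∑ d, S.riemann a b c d * u c * v d := by
  simp only [holonomy, transBracket, Matrix.sum_apply, Matrix.smul_apply, smul_eq_mul, riemann,
    riemann_sum_eq', dotProduct, Matrix.mulVec, Finset.sum_mul, Finset.mul_sum, neg_mul,
    Finset.sum_neg_distrib, neg_neg]
  rw [Finset.sum_comm]
  refine Finset.sum_congr rfl fun c _ => ?_
  rw [Finset.sum_comm]
  exact Finset.sum_congr rfl fun d _ => Finset.sum_congr rfl fun i _ => by ring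

/-- The double bracket of three translations is minus the curvature, so the cyclic sum is the first
Bianchi identity. -/
theorem holonomy_transBracket_cyclic (u v w : Fin n → ℝ) :
    S.holonomy (S.transBracket u v) *ᵥ w + S.holonomy (S.transBracket v w) *ᵥ u +
      S.holonomy (S.transBracket w u) *ᵥ v = 0 := by
  funext a
  have hb := fun b c d => S.bianchi a b c d
  have e : ∀ u v w : Fin n → ℝ, (S.holonomy (S.transBracket u v) *ᵥ w) a =
      -∑ b, ∑ c, ∑ d, S.riemann a b c d * w b * u c * v d := fun u v w => by
    simp only [Matrix.mulVec, dotProduct, holonomy_transBracket_apply, neg_mul,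
      Finset.sum_neg_distrib, Finset.sum_mul]
    congr 1
    exact Finset.sum_congr rfl fun b _ => Finset.sum_congr rfl fun c _ =>
      Finset.sum_congr rfl fun d _ => by ring
  have e2 : ∑ b, ∑ c, ∑ d, S.riemann a b c d * u b * v c * w d =
      ∑ b, ∑ c, ∑ d, S.riemann a c d b * w b * u c * v d := by
    rw [Finset.sum_comm_cycle]
    exact Finset.sum_congr rfl fun b _ => Finset.sum_congr rfl fun c _ =>
      Finset.sum_congr rfl fun d _ => by ring
  have e3 : ∑ b, ∑ c, ∑ d, S.riemann a b c d * v b * w c * u d =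
      ∑ b, ∑ c, ∑ d, S.riemann a d b c * w b * u c * v d := by
    rw [Finset.sum_comm_cycle, Finset.sum_comm_cycle]
    exact Finset.sum_congr rfl fun b _ => Finset.sum_congr rfl fun c _ =>
      Finset.sum_congr rfl fun d _ => by ring
  rw [Pi.add_apply, Pi.add_apply, e, e, e, e2, e3, ← neg_add, ← neg_add, Pi.zero_apply,
    neg_eq_zero, ← Finset.sum_add_distrib, ← Finset.sum_add_distrib]
  refine Finset.sum_eq_zero fun b _ => ?_
  rw [← Finset.sum_add_distrib, ← Finset.sum_add_distrib]
  refine Finset.sum_eq_zero fun c _ => ?_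
  rw [← Finset.sum_add_distrib, ← Finset.sum_add_distrib]
  refine Finset.sum_eq_zero fun d _ => ?_
  have h := hb b c d
  change S.riemann a b c d + S.riemann a c d b + S.riemann a d b c = 0 at h
  linear_combination (w b * u c * v d) * h

theorem ad_apply (k : Idx n p → ℝ) (A B : Idx n p) :
    S.ad k A B = ∑ C, k C * S.structConst A C B := by
  simp [ad, adGen, Matrix.sum_apply]

theorem ad_mulVec (k m : Idx n p → ℝ) : S.ad k *ᵥ m = Sum.elim
    (S.holonomy (k ∘ Sum.inr) *ᵥ (m ∘ Sum.inl) - S.holonomy (m ∘ Sum.inr) *ᵥ (k ∘ Sum.inl))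
    (S.transBracket (k ∘ Sum.inl) (m ∘ Sum.inl) + S.holBracket (k ∘ Sum.inr) (m ∘ Sum.inr)) := by
  funext A
  rcases A with a | i
  · simp only [Matrix.mulVec, dotProduct, ad_apply, Fintype.sum_sum_type, structConst, mul_zero,
      Finset.sum_const_zero, add_zero, zero_add, Sum.elim_inl, Pi.sub_apply, holonomy,
      Matrix.sum_apply, Matrix.smul_apply, smul_eq_mul, Function.comp_apply, Finset.sum_mul]
    rw [sub_eq_add_neg, ← Finset.sum_neg_distrib]
    congr 1
    rw [Finset.sum_comm]
    refine Finset.sum_congr rfl fun b _ => ?_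
    rw [← Finset.sum_neg_distrib]
    exact Finset.sum_congr rfl fun i _ => by ring
  · simp only [Matrix.mulVec, dotProduct, ad_apply, Fintype.sum_sum_type, structConst, mul_zero,
      Finset.sum_const_zero, add_zero, zero_add, Sum.elim_inr, Pi.add_apply, holBracket,
      transBracket, Function.comp_apply, Finset.sum_mul, Finset.mul_sum]
    congr 1
    · rw [Finset.sum_comm]
      exact Finset.sum_congr rfl fun b _ => Finset.sum_congr rfl fun i _ => by ring
    · rw [Finset.sum_comm]
      exact Finset.sum_congr rfl fun b _ => Finset.sum_congr rfl fun i _ => by ring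

/-- The translation component combines the Bianchi identity with the representation property of `D`;
the holonomy component combines the equivariance of `transBracket` with the Jacobi identity of `F`.
-/
theorem ad_jacobi (x y : Idx n p → ℝ) :
    S.ad (S.ad x *ᵥ y) = S.ad x * S.ad y - S.ad y * S.ad x := by
  refine Matrix.ext_of_mulVec_single fun A => ?_
  generalize (Pi.single A 1 : Idx n p → ℝ) = z
  rw [Matrix.sub_mulVec, ← Matrix.mulVec_mulVec, ← Matrix.mulVec_mulVec]
  simp only [ad_mulVec, Sum.elim_comp_inl, Sum.elim_comp_inr]
  generalize x ∘ Sum.inl = u, x ∘ Sum.inr = x'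
  generalize y ∘ Sum.inl = v, y ∘ Sum.inr = y'
  generalize z ∘ Sum.inl = w, z ∘ Sum.inr = z'
  have hsub : ∀ (a b : Fin n → ℝ) (c d : Fin p → ℝ),
      (Sum.elim a c - Sum.elim b d : Idx n p → ℝ) = Sum.elim (a - b) (c - d) := by
    intro a b c d
    funext A
    cases A <;> rfl
  rw [hsub]
  congr 1
  · have h := S.holonomy_transBracket_cyclic u v w
    rw [S.transBracket_swap w u] at h
    have hn : ∀ x, S.holonomy (-x) = -S.holonomy x := fun x => by simp [holonomy]
    rw [hn, Matrix.neg_mulVec] at h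
    simp only [holonomy_add, holonomy_holBracket, Matrix.add_mulVec, Matrix.sub_mulVec,
      Matrix.mulVec_sub, ← Matrix.mulVec_mulVec] at h ⊢
    rw [← sub_eq_zero, ← h]
    abel
  · have h1 := S.transBracket_holonomy x' v w
    have h2 := S.transBracket_holonomy y' u w
    have h3 := S.transBracket_holonomy z' u v
    have h4 := S.holBracket_jacobi x' y' z'
    rw [S.transBracket_swap (S.holonomy z' *ᵥ u)] at h3
    rw [S.holBracket_swap z'] at h3
    simp only [transBracket_sub_left, transBracket_sub_right, holBracket_add_left,
      holBracket_add_right, ← h1, ← h2, h4]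
    rw [show S.holBracket (S.transBracket u v) z' = S.transBracket v (S.holonomy z' *ᵥ u) -
      S.transBracket u (S.holonomy z' *ᵥ v) by rw [← neg_inj, ← h3]; abel]
    abel

end SymmetricSpaceCurvature

end

end CurvatureGroup

/-! ### The invariant form `γ` and the flat directions. -/

namespace CurvatureGroup

noncomputable section

open Matrix
open scoped Matrix.Norms.Operator

namespace SymmetricSpaceCurvature

variable {n p : ℕ} (S : SymmetricSpaceCurvature n p)

theorem ad_skew (x y : Idx n p → ℝ) : S.ad x *ᵥ y = -(S.ad y *ᵥ x) := by
  rw [ad_mulVec, ad_mulVec]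
  funext A
  rcases A with a | i
  · simp only [Sum.elim_inl, Pi.neg_apply, Pi.sub_apply]
    ring
  · simp only [Sum.elim_inr, Pi.neg_apply, Pi.add_apply]
    rw [S.transBracket_swap, S.holBracket_swap, Pi.neg_apply, Pi.neg_apply]
    ring

theorem γ_transpose : S.γᵀ = S.γ := by
  rw [γ, Matrix.fromBlocks_transpose, S.β_symm]
  simp

theorem γ_det : S.γ.det = S.β.det := by
  rw [γ, Matrix.det_fromBlocks_zero₂₁, Matrix.det_one, one_mul]

/-- Checked block by block: antisymmetry of `D`, then `D = -β E` in the two mixed blocks, and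
`F_invariant` in the holonomy block. -/
theorem ad_invariant (x : Idx n p → ℝ) : (S.ad x)ᵀ * S.γ = -(S.γ * S.ad x) := by
  have hDl : ∀ l a b, ∑ i, S.β l i * S.E i a b = -S.D l a b := fun l a b => by
    rw [D_apply, neg_neg]
  have hDl' : ∀ l a b, ∑ i, S.E i a b * S.β i l = -S.D l a b := fun l a b => by
    rw [← hDl]
    exact Finset.sum_congr rfl fun i _ => by rw [S.β_swap i l, mul_comm]
  ext A B
  rw [Matrix.neg_apply, Matrix.mul_apply, Matrix.mul_apply]
  rcases A with a | i <;> rcases B with b | l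
  · simp only [Matrix.transpose_apply, ad_apply, γ, Fintype.sum_sum_type, structConst,
      Matrix.fromBlocks_apply₁₁, Matrix.fromBlocks_apply₁₂, Matrix.fromBlocks_apply₂₁,
      Matrix.fromBlocks_apply₂₂, Matrix.one_apply, Matrix.zero_apply, mul_zero, zero_mul,
      Finset.sum_const_zero, add_zero, zero_add, mul_ite, ite_mul, mul_one, one_mul,
      Finset.sum_ite_eq, Finset.sum_ite_eq', Finset.mem_univ, if_true]
    rw [← Finset.sum_neg_distrib]
    exact Finset.sum_congr rfl fun i _ => by rw [S.D_swap i a b]; ring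
  · simp only [Matrix.transpose_apply, ad_apply, γ, Fintype.sum_sum_type, structConst,
      Matrix.fromBlocks_apply₁₁, Matrix.fromBlocks_apply₁₂, Matrix.fromBlocks_apply₂₁,
      Matrix.fromBlocks_apply₂₂, Matrix.one_apply, Matrix.zero_apply, mul_zero, zero_mul,
      Finset.sum_const_zero, add_zero, zero_add, mul_ite, ite_mul, mul_one, one_mul,
      Finset.sum_ite_eq, Finset.sum_ite_eq', Finset.mem_univ, if_true, Finset.sum_mul]
    rw [Finset.sum_comm, ← Finset.sum_neg_distrib]
    refine Finset.sum_congr rfl fun c _ => ?_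
    simp only [mul_assoc, ← Finset.mul_sum]
    rw [hDl', S.D_swap]
    ring
  · simp only [Matrix.transpose_apply, ad_apply, γ, Fintype.sum_sum_type, structConst,
      Matrix.fromBlocks_apply₁₁, Matrix.fromBlocks_apply₁₂, Matrix.fromBlocks_apply₂₁,
      Matrix.fromBlocks_apply₂₂, Matrix.one_apply, Matrix.zero_apply, mul_zero, zero_mul,
      Finset.sum_const_zero, add_zero, zero_add, mul_ite, ite_mul, mul_one, one_mul,
      Finset.sum_ite_eq, Finset.sum_ite_eq', Finset.mem_univ, if_true, Finset.mul_sum]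
    rw [Finset.sum_comm, ← Finset.sum_neg_distrib]
    refine Finset.sum_congr rfl fun c _ => ?_
    simp only [mul_left_comm _ (x _), ← Finset.mul_sum]
    rw [hDl, S.D_swap]
    ring
  · simp only [Matrix.transpose_apply, ad_apply, γ, Fintype.sum_sum_type, structConst,
      Matrix.fromBlocks_apply₁₁, Matrix.fromBlocks_apply₁₂, Matrix.fromBlocks_apply₂₁,
      Matrix.fromBlocks_apply₂₂, Matrix.zero_apply, mul_zero, zero_mul,
      Finset.sum_const_zero, zero_add, Finset.mul_sum, Finset.sum_mul]
    rw [Finset.sum_comm, Finset.sum_comm (f := fun y k => S.β i y * (x (Sum.inr k) * S.F y k l)),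
      ← Finset.sum_neg_distrib]
    refine Finset.sum_congr rfl fun c _ => ?_
    simp only [mul_left_comm _ (x _), mul_assoc, ← Finset.mul_sum]
    rw [S.F_invariant]
    ring

/-- The curvature algebra with its invariant form. -/
def curvatureAlgebra : QuadraticLieAlgebra (Idx n p) where
  ad :=
    { toFun := S.ad
      map_add' := fun x y => by simp [ad, add_smul, Finset.sum_add_distrib]
      map_smul' := fun r x => by simp [ad, Finset.smul_sum, smul_smul] }
  form := S.γ
  form_symm := S.γ_transpose
  form_det := by rw [γ_det]; exact S.β_nondegenerate
  skew := S.ad_skew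
  jacobi := S.ad_jacobi
  invariant := S.ad_invariant

theorem curvatureAlgebra_ad (k : Idx n p → ℝ) : S.curvatureAlgebra.ad k = S.ad k := rfl

theorem curvatureAlgebra_form : S.curvatureAlgebra.form = S.γ := rfl

theorem scalarCurvature_eq : S.scalarCurvature = -(1 / 4) * S.curvatureAlgebra.theta 1 1 1 := by
  rw [scalarCurvature, QuadraticLieAlgebra.theta]
  congr 1
  refine Finset.sum_congr rfl fun A _ => ?_
  rw [Matrix.one_mul, Matrix.mul_one, Matrix.one_mulVec, curvatureAlgebra_ad,
    curvatureAlgebra_ad, curvatureAlgebra_form]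
  have h1 : S.ad (stdVec A) = S.adGen A := by
    rw [ad, Finset.sum_eq_single A]
    · simp [stdVec]
    · intro B _ hB
      simp [stdVec, Pi.single_eq_of_ne hB]
    · simp
  have h2 : S.ad (S.γ⁻¹ *ᵥ stdVec A) = ∑ B, S.γ⁻¹ A B • S.adGen B := by
    rw [ad]
    refine Finset.sum_congr rfl fun B _ => ?_
    have h := congrFun (congrFun S.curvatureAlgebra.form_inv_symm A) B
    rw [curvatureAlgebra_form, Matrix.transpose_apply] at h
    simp [stdVec, h]
  rw [h1, h2, Matrix.mul_sum, Matrix.trace_sum]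
  refine Finset.sum_congr rfl fun B _ => ?_
  rw [Matrix.mul_smul, Matrix.trace_smul, smul_eq_mul]
  rfl

theorem Y_eq (k : Idx n p → ℝ) : S.Y k = leftFun ℝ (S.curvatureAlgebra.ad k) := rfl

theorem mem_regular_iff (k : Idx n p → ℝ) : k ∈ S.regular ↔ S.curvatureAlgebra.jac k ≠ 0 := Iff.rfl

/-- Flatness is a vanishing combination of the `D_i` with the components of `E^i v` as coefficients;
independence of the `D_i` separates them. -/
theorem E_mulVec_of_mem_flat {v : EuclideanSpace ℝ (Fin n)} (hv : v ∈ S.flat) (i : Fin p) :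
    S.E i *ᵥ v.ofLp = 0 := by
  funext b
  have hv' : ∀ b c d, ∑ a, S.riemann a b c d * v a = 0 := hv
  have h : ∑ i, (∑ a, S.E i a b * v a) • S.D i = 0 := by
    ext c d
    have h := hv' b c d
    simp only [riemann, riemann_sum_eq, neg_mul, Finset.sum_neg_distrib, neg_eq_zero,
      Finset.sum_mul] at h
    rw [Matrix.zero_apply, ← h, Matrix.sum_apply, Finset.sum_comm]
    refine Finset.sum_congr rfl fun i _ => ?_
    rw [Matrix.smul_apply, smul_eq_mul, Finset.sum_mul]
    exact Finset.sum_congr rfl fun a _ => by ring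
  have h1 := Fintype.linearIndependent_iff.mp S.D_linearIndependent _ h i
  rw [Pi.zero_apply, ← neg_eq_zero, ← h1, Matrix.mulVec, dotProduct, ← Finset.sum_neg_distrib]
  exact Finset.sum_congr rfl fun a _ => by rw [S.E_swap i b a]; ring

theorem sum_E_mul_q (i : Fin p) (a b : Fin n) : ∑ c, S.E i a c * S.q c b = 0 :=
  congrFun (S.E_mulVec_of_mem_flat (S.flat.starProjection_apply_mem (EuclideanSpace.single b 1)) i) a

theorem q_symm (a b : Fin n) : S.q a b = S.q b a := by
  have h := S.flat.inner_starProjection_left_eq_right (EuclideanSpace.single a (1 : ℝ))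
    (EuclideanSpace.single b 1)
  rw [EuclideanSpace.inner_single_right, EuclideanSpace.inner_single_left] at h
  simpa [q] using h.symm

theorem sum_riemann_mul_q (f a d b : Fin n) : ∑ c, S.riemann f a c d * S.q c b = 0 := by
  have h : ∀ c, S.riemann f a c d * S.q c b = ∑ i, S.D i f a * (S.E i d c * S.q c b) := fun c => by
    rw [riemann, riemann_sum_eq', ← Finset.sum_neg_distrib, Finset.sum_mul]
    exact Finset.sum_congr rfl fun i _ => by rw [S.E_swap i c d]; ring
  simp only [h]
  rw [Finset.sum_comm]
  exact Finset.sum_eq_zero fun i _ => by rw [← Finset.mul_sum, S.sum_E_mul_q, mul_zero]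

variable {S} in
/-- The extension by zero of an antisymmetric matrix annihilated by the holonomy algebra. -/
def flatForm (b : Matrix (Fin n) (Fin n) ℝ) (hb : bᵀ = -b) (hE : ∀ i, S.E i * b = 0) :
    FlatForm S.curvatureAlgebra where
  mat := Matrix.fromBlocks b 0 0 0
  transpose_eq := by
    rw [Matrix.fromBlocks_transpose, hb, Matrix.fromBlocks_neg]
    simp
  ad_mul := by
    intro x
    refine Matrix.ext_of_mulVec_single fun A => ?_
    rw [← Matrix.mulVec_mulVec, curvatureAlgebra_ad, ad_mulVec, Matrix.zero_mulVec]
    generalize (Pi.single A 1 : Idx n p → ℝ) = z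
    have h1 : (Matrix.fromBlocks b 0 0 (0 : Matrix (Fin p) (Fin p) ℝ) *ᵥ z) =
        Sum.elim (b *ᵥ (z ∘ Sum.inl)) 0 := by
      rw [Matrix.fromBlocks_mulVec]
      simp
    have h2 : ∀ x, S.holonomy x * b = 0 := fun x => by
      have hD : ∀ i, S.D i * b = 0 := fun i => by
        simp [D, Matrix.sum_mul, hE]
      simp [holonomy, Matrix.sum_mul, hD]
    rw [h1, Sum.elim_comp_inl, Sum.elim_comp_inr, Matrix.mulVec_mulVec, h2]
    funext B
    rcases B with a | i
    · simp [holonomy]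
    · simp [transBracket, holBracket, hE, Matrix.mulVec_mulVec]
  form_mul := by
    rw [curvatureAlgebra_form, γ, Matrix.fromBlocks_multiply]
    simp

end SymmetricSpaceCurvature

end

end CurvatureGroup

/-! ### Operators diagonal in an orthonormal basis. -/

namespace CurvatureGroup

noncomputable section

section Diagonal

variable {W : Type*} [NormedAddCommGroup W] [InnerProductSpace ℂ W] [CompleteSpace W]
  [FiniteDimensional ℂ W]

/-- The operators `i T_j` are symmetric and commute, so their joint eigenspaces decompose `W`
orthogonally. -/
theorem exists_joint_eigenbasis {J : Type*} [Finite J] {T : J → (W →L[ℂ] W)}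
    (hT : ∀ j, star (T j) = -T j) (hC : ∀ i j, Commute (T i) (T j)) :
    ∃ (m : ℕ) (e : OrthonormalBasis (Fin m) ℂ W) (b : Fin m → J → ℝ),
      ∀ α j, T j (e α) = (Complex.I * (b α j : ℂ)) • e α := by
  classical
  let U : J → Module.End ℂ W := fun j => ((Complex.I • T j : W →L[ℂ] W) : W →ₗ[ℂ] W)
  have hU : ∀ j, (U j).IsSymmetric := fun j => by
    have hs : IsSelfAdjoint (Complex.I • T j) := by
      rw [isSelfAdjoint_iff, star_smul, hT]
      simp
    exact hs.isSymmetric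
  have hUC : Pairwise (Function.onFun Commute U) := fun i j _ => by
    have h : Commute (Complex.I • T i) (Complex.I • T j) :=
      ((hC i j).smul_left _).smul_right _
    ext w
    exact congrArg (fun S : W →L[ℂ] W => S w) h.eq
  have hint := LinearMap.IsSymmetric.directSum_isInternal_of_pairwise_commute hU hUC
  have horth := LinearMap.IsSymmetric.orthogonalFamily_iInf_eigenspaces (T := U) hU
  let V : (J → ℂ) → Submodule ℂ W := fun χ => ⨅ j, Module.End.eigenspace (U j) (χ j)
  let : Fintype {χ // V χ ≠ ⊥} :=
    (DirectSum.IsInternal.submodule_iSupIndep hint).fintypeNeBotOfFiniteDimensional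
  have hint' : DirectSum.IsInternal (fun χ : {χ // V χ ≠ ⊥} => V χ) :=
    DirectSum.isInternal_ne_bot_iff.mpr hint
  have horth' : OrthogonalFamily ℂ (fun χ : {χ // V χ ≠ ⊥} => V χ)
      (fun χ => (V χ).subtypeₗᵢ) := horth.comp Subtype.val_injective
  let e := hint'.subordinateOrthonormalBasis rfl horth'
  let χ := fun α => (hint'.subordinateOrthonormalBasisIndex rfl α horth').1
  have he : ∀ α j, U j (e α) = χ α j • e α := fun α j => by
    have h : e α ∈ V (χ α) := hint'.subordinateOrthonormalBasis_subordinate rfl α horth'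
    have h' := (Submodule.mem_iInf _).mp h j
    exact Module.End.mem_eigenspace_iff.mp h'
  refine ⟨_, e, fun α j => -(χ α j).re, fun α j => ?_⟩
  have hne : e α ≠ 0 := by
    have := e.orthonormal.1 α
    intro h0
    rw [h0, norm_zero] at this
    exact zero_ne_one this
  have hreal : (starRingEnd ℂ) (χ α j) = χ α j :=
    (hU j).conj_eigenvalue_eq_self
      (Module.End.hasEigenvalue_of_hasEigenvector ⟨Module.End.mem_eigenspace_iff.mpr (he α j), hne⟩)
  have hre : ((χ α j).re : ℂ) = χ α j := Complex.conj_eq_iff_re.mp hreal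
  have h1 : Complex.I • T j (e α) = χ α j • e α := he α j
  have h2 : T j (e α) = -(Complex.I • (Complex.I • T j (e α))) := by
    rw [smul_smul, Complex.I_mul_I, neg_smul, one_smul, neg_neg]
  rw [h2, h1, smul_smul, ← neg_smul]
  push_cast
  rw [hre, mul_neg]

variable {κ : Type*} [Fintype κ] (e : OrthonormalBasis κ ℂ W)

/-- The operator which is diagonal in an orthonormal basis. -/
def diagFun (f : κ → ℂ) : W →L[ℂ] W :=
  LinearMap.toContinuousLinearMap (e.toBasis.constr ℂ fun α => f α • e α)

omit [CompleteSpace W] in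
theorem diagFun_apply (f : κ → ℂ) (α : κ) : diagFun e f (e α) = f α • e α := by
  have h := e.toBasis.constr_basis ℂ (fun α => f α • e α) α
  rw [OrthonormalBasis.coe_toBasis] at h
  exact h

omit [CompleteSpace W] [FiniteDimensional ℂ W] in
theorem clm_ext_basis {S T : W →L[ℂ] W} (h : ∀ α, S (e α) = T (e α)) : S = T := by
  refine ContinuousLinearMap.coe_injective (e.toBasis.ext fun α => ?_)
  rw [OrthonormalBasis.coe_toBasis]
  exact h α

/-- The algebra of diagonal operators. -/
def diagHom : (κ → ℂ) →ₐ[ℂ] (W →L[ℂ] W) where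
  toFun := diagFun e
  map_one' := clm_ext_basis e fun α => by simp [diagFun_apply]
  map_mul' := fun f g => clm_ext_basis e fun α => by
    simp [diagFun_apply, smul_smul, mul_comm]
  map_zero' := clm_ext_basis e fun α => by simp [diagFun_apply]
  map_add' := fun f g => clm_ext_basis e fun α => by simp [diagFun_apply, add_smul]
  commutes' := fun r => clm_ext_basis e fun α => by
    simp [diagFun_apply, Algebra.algebraMap_eq_smul_one]

theorem diagHom_apply_basis (f : κ → ℂ) (α : κ) : diagHom e f (e α) = f α • e α :=
  diagFun_apply e f α

theorem continuous_diagHom : Continuous (diagHom e) :=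
  (diagHom e).toLinearMap.continuous_of_finiteDimensional

/-- The diagonal operators as a continuous real-linear map. -/
def diagCLM : (κ → ℂ) →L[ℝ] (W →L[ℂ] W) :=
  { (diagHom e).toLinearMap.restrictScalars ℝ with cont := continuous_diagHom e }

theorem diagCLM_apply (f : κ → ℂ) : diagCLM e f = diagHom e f := rfl

theorem isUnit_diagHom_iff {f : κ → ℂ} : IsUnit (diagHom e f) ↔ ∀ α, f α ≠ 0 := by
  constructor
  · rintro ⟨u, hu⟩ α h0
    have h1 := diagHom_apply_basis e f α
    rw [h0, zero_smul, ← hu] at h1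
    have h2 : ((u⁻¹ : (W →L[ℂ] W)ˣ) : W →L[ℂ] W) ((u : W →L[ℂ] W) (e α)) = e α :=
      congrArg (fun S : W →L[ℂ] W => S (e α)) u.inv_mul
    rw [h1, map_zero] at h2
    have := e.orthonormal.1 α
    rw [← h2, norm_zero] at this
    exact zero_ne_one this
  · intro h
    have : IsUnit f := Pi.isUnit_iff.mpr fun α => isUnit_iff_ne_zero.mpr (h α)
    exact this.map (diagHom e)

theorem isSelfAdjoint_diagHom (d : κ → ℝ) :
    IsSelfAdjoint (diagHom e fun α => (d α : ℂ)) := by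
  classical
  rw [isSelfAdjoint_iff]
  refine clm_ext_basis e fun α => InnerProductSpace.ext_inner_right_basis e.toBasis fun β => ?_
  rw [OrthonormalBasis.coe_toBasis, ContinuousLinearMap.star_eq_adjoint,
    ContinuousLinearMap.adjoint_inner_left, diagHom_apply_basis, diagHom_apply_basis,
    inner_smul_left, inner_smul_right, orthonormal_iff_ite.mp e.orthonormal, Complex.conj_ofReal]
  by_cases h : α = β <;> simp [h]

/-- The spectrum lies in the finite set of entries, where `f` agrees with an interpolating
polynomial, and polynomials pass through algebra homomorphisms. No continuity of `f` is needed. -/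
theorem cfc_diagHom (f : ℝ → ℝ) (d : κ → ℝ) :
    cfc f (diagHom e fun α => (d α : ℂ)) = diagHom e fun α => (f (d α) : ℂ) := by
  classical
  have hsa := isSelfAdjoint_diagHom e d
  have hspec : spectrum ℝ (diagHom e fun α => (d α : ℂ)) ⊆ Set.range d := by
    intro x hx
    by_contra hne
    refine hx ?_
    have h : algebraMap ℝ (W →L[ℂ] W) x - diagHom e (fun α => (d α : ℂ)) =
        diagHom e fun α => ((x - d α : ℝ) : ℂ) := by
      refine clm_ext_basis e fun α => ?_
      have h1 : algebraMap ℝ (W →L[ℂ] W) x (e α) = (x : ℂ) • e α := by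
        rw [Algebra.algebraMap_eq_smul_one]
        change x • e α = _
        exact (Complex.coe_smul x (e α)).symm
      rw [sub_apply, h1, diagHom_apply_basis, diagHom_apply_basis, ← sub_smul]
      push_cast
      rfl
    rw [spectrum.mem_resolventSet_iff, h, isUnit_diagHom_iff]
    intro α h0
    exact hne ⟨α, (sub_eq_zero.mp (Complex.ofReal_eq_zero.mp h0)).symm⟩
  let q : Polynomial ℝ := Lagrange.interpolate (Finset.univ.image d) id f
  have hq : ∀ α, q.eval (d α) = f (d α) := fun α =>
    Lagrange.eval_interpolate_at_node (v := id) f (Function.injective_id.injOn)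
      (Finset.mem_image_of_mem d (Finset.mem_univ α))
  have h1 : cfc f (diagHom e fun α => (d α : ℂ)) =
      cfc q.eval (diagHom e fun α => (d α : ℂ)) := by
    refine cfc_congr fun x hx => ?_
    obtain ⟨α, rfl⟩ := hspec hx
    exact (hq α).symm
  rw [h1, cfc_polynomial q _ hsa, ← AlgHom.coe_restrictScalars' ℝ (diagHom e),
    Polynomial.aeval_algHom_apply]
  congr 1
  funext α
  have h2 := Polynomial.aeval_algHom_apply (Pi.evalAlgHom ℝ (fun _ : κ => ℂ) α)
    (fun α => (d α : ℂ)) q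
  rw [Pi.evalAlgHom_apply, Pi.evalAlgHom_apply] at h2
  rw [← h2, ← hq α]
  exact Polynomial.aeval_algebraMap_apply ℂ (d α) q

theorem exp_diagHom (f : κ → ℂ) :
    NormedSpace.exp (diagHom e f) = diagHom e fun α => Complex.exp (f α) := by
  rw [← expFun_eq_exp (𝕜 := ℂ)]
  have h := map_powerSum (factorialBound_expCoeff (𝕜 := ℂ)) (diagHom e) (continuous_diagHom e) f
  rw [expFun, powerSum, ← h]
  congr 1
  funext α
  have h2 := map_powerSum (factorialBound_expCoeff (𝕜 := ℂ)) (Pi.evalAlgHom ℂ (fun _ : κ => ℂ) α)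
    (continuous_apply α) f
  rw [Pi.evalAlgHom_apply] at h2
  rw [h2, Complex.exp_eq_exp_ℂ, ← expFun_eq_exp (𝕜 := ℂ)]
  rfl

end Diagonal

end

end CurvatureGroup

/-! ### Matrices of diagonal operators, and the passage from real to complex matrices. -/

namespace CurvatureGroup

noncomputable section

open Matrix
open scoped Matrix.Norms.Operator

section MatrixDiagonal

variable {W : Type*} [NormedAddCommGroup W] [InnerProductSpace ℂ W] [CompleteSpace W]
  [FiniteDimensional ℂ W] {κ : Type*} [Fintype κ] (e : OrthonormalBasis κ ℂ W)
  {ι : Type*} [Fintype ι] [DecidableEq ι]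

/-- Matrices of diagonal operators. -/
def matDiag : (κ → Matrix ι ι ℂ) →ₐ[ℂ] Matrix ι ι (W →L[ℂ] W) where
  toFun M := Matrix.of fun i j => diagHom e fun α => M α i j
  map_one' := by
    ext1 i j
    by_cases h : i = j
    · subst h
      simp only [Pi.one_apply, Matrix.one_apply_eq, Matrix.of_apply]
      exact map_one (diagHom e)
    · simp only [Pi.one_apply, Matrix.one_apply_ne h, Matrix.of_apply]
      exact map_zero (diagHom e)
  map_mul' := fun M N => by
    ext1 i j
    simp only [Matrix.mul_apply, Matrix.of_apply, Pi.mul_apply, ← map_mul, ← map_sum]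
    congr 1
    funext α
    simp
  map_zero' := by
    ext1 i j
    exact map_zero (diagHom e)
  map_add' := fun M N => by
    ext1 i j
    exact map_add (diagHom e) _ _
  commutes' := fun r => by
    ext1 i j
    by_cases h : i = j
    · subst h
      simp only [Pi.algebraMap_apply, Matrix.algebraMap_matrix_apply, Matrix.of_apply, if_true]
      exact (diagHom e).commutes r
    · simp only [Pi.algebraMap_apply, Matrix.algebraMap_matrix_apply, Matrix.of_apply, if_neg h]
      exact map_zero (diagHom e)

theorem matDiag_apply (M : κ → Matrix ι ι ℂ) (i j : ι) :
    matDiag e M i j = diagHom e fun α => M α i j := rfl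

theorem continuous_matDiag : Continuous (matDiag e (ι := ι)) := by
  refine continuous_pi fun i => continuous_pi fun j => ?_
  refine (continuous_diagHom e).comp (continuous_pi fun α => ?_)
  exact ((LinearMap.toContinuousLinearMap (Matrix.entryLinearMap ℂ ℂ i j)).continuous).comp
    (continuous_apply α)

theorem tsum_smul_matDiag {c : ℕ → ℂ} (hc : FactorialBound c) (M : κ → Matrix ι ι ℂ) :
    ∑' m, c m • (matDiag e M) ^ m = matDiag e fun α => powerSum c (M α) := by
  have h := map_powerSum hc (matDiag e (ι := ι)) (continuous_matDiag e) M
  rw [← h]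
  congr 1
  funext α
  exact map_powerSum hc (Pi.evalAlgHom ℂ (fun _ : κ => Matrix ι ι ℂ) α) (continuous_apply α) M

theorem sinhc_matDiag (M : κ → Matrix ι ι ℂ) :
    sinhc (matDiag e M) = matDiag e fun α => sinhSqrt ℂ (M α ^ 2) := by
  rw [sinhc]
  have h := tsum_smul_matDiag e (factorialBound_sinhCoeff (𝕜 := ℂ)) (M ^ 2)
  simp only [map_pow, ← pow_mul] at h
  exact h

theorem coshM_matDiag (M : κ → Matrix ι ι ℂ) :
    coshM (matDiag e M) = matDiag e fun α => coshSqrt ℂ (M α ^ 2) := by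
  rw [coshM]
  have h := tsum_smul_matDiag e (factorialBound_coshCoeff (𝕜 := ℂ)) (M ^ 2)
  simp only [map_pow, ← pow_mul] at h
  exact h

theorem commDet_matDiag (M : κ → Matrix ι ι ℂ) :
    commDet (matDiag e M) = diagHom e fun α => (M α).det := by
  have h : (fun α => (M α).det) = ∑ σ : Equiv.Perm ι, ((Equiv.Perm.sign σ : ℤˣ) : ℤ) •
      ((Finset.univ : Finset ι).toList.map fun i => fun α => M α (σ i) i).prod := by
    funext α
    rw [Matrix.det_apply, Finset.sum_apply]
    refine Finset.sum_congr rfl fun σ _ => ?_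
    rw [Pi.smul_apply, Finset.prod_map_toList, Finset.prod_apply, Units.smul_def]
  rw [h, map_sum, commDet]
  refine Finset.sum_congr rfl fun σ _ => ?_
  rw [map_zsmul, map_list_prod, List.map_map]
  rfl

theorem ringInverse_matDiag {M : κ → Matrix ι ι ℂ} (hM : ∀ α, IsUnit (M α)) :
    Ring.inverse (matDiag e M) = matDiag e fun α => (M α)⁻¹ := by
  have hdet := fun α => (Matrix.isUnit_iff_isUnit_det _).mp (hM α)
  have h1 : matDiag e M * matDiag e (fun α => (M α)⁻¹) = 1 := by
    rw [← map_mul, ← map_one (matDiag e)]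
    exact congrArg _ (funext fun α => Matrix.mul_nonsing_inv _ (hdet α))
  have h2 : matDiag e (fun α => (M α)⁻¹) * matDiag e M = 1 := by
    rw [← map_mul, ← map_one (matDiag e)]
    exact congrArg _ (funext fun α => Matrix.nonsing_inv_mul _ (hdet α))
  exact Ring.inverse_unit ⟨matDiag e M, matDiag e fun α => (M α)⁻¹, h1, h2⟩

end MatrixDiagonal

section Complexify

variable {ι : Type*} [Fintype ι] [DecidableEq ι]

theorem powerSum_map_ofReal {c : ℕ → ℝ} (hc : FactorialBound c) (M : Matrix ι ι ℝ) :
    powerSum (fun m => (c m : ℂ)) (M.map Complex.ofReal) = (powerSum c M).map Complex.ofReal := by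
  let φ : Matrix ι ι ℝ →ₐ[ℝ] Matrix ι ι ℂ := (Complex.ofRealAm).mapMatrix
  have hφ : Continuous φ := φ.toLinearMap.continuous_of_finiteDimensional
  have h := map_powerSum hc φ hφ M
  refine Eq.trans ?_ h.symm
  rfl

theorem sinhSqrt_map_ofReal (M : Matrix ι ι ℝ) :
    sinhSqrt ℂ (M.map Complex.ofReal) = (sinhSqrt ℝ M).map Complex.ofReal := by
  rw [sinhSqrt, sinhSqrt, ← powerSum_map_ofReal factorialBound_sinhCoeff]
  congr 1
  funext m
  simp [sinhCoeff]

theorem coshSqrt_map_ofReal (M : Matrix ι ι ℝ) :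
    coshSqrt ℂ (M.map Complex.ofReal) = (coshSqrt ℝ M).map Complex.ofReal := by
  rw [coshSqrt, coshSqrt, ← powerSum_map_ofReal factorialBound_coshCoeff]
  congr 1
  funext m
  simp [coshCoeff]

theorem det_map_ofReal (M : Matrix ι ι ℝ) : (M.map Complex.ofReal).det = (M.det : ℂ) :=
  (RingHom.map_det Complex.ofRealHom M).symm

theorem inv_map_ofReal {M : Matrix ι ι ℝ} (hM : IsUnit M) :
    (M.map Complex.ofReal)⁻¹ = (M⁻¹).map Complex.ofReal := by
  refine Matrix.inv_eq_right_inv ?_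
  have h := congrArg (fun N : Matrix ι ι ℝ => N.map Complex.ofRealHom) (mul_inv_of_isUnit hM)
  simp only [Matrix.map_mul] at h
  exact h.trans (Matrix.map_one _ (map_zero _) (map_one _))

/-- Powers of the sum are sums of powers, and in `(1 + P g(P)) (1 + Q g(Q))` the cross term
vanishes. This separates `C(k)/2` from `t𝓑` in the determinant. -/
theorem sinhSqrt_add_of_mul_eq_zero {P Q : Matrix ι ι ℝ} (h : P * Q = 0) (h' : Q * P = 0) :
    sinhSqrt ℝ (P + Q) = sinhSqrt ℝ P * sinhSqrt ℝ Q := by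
  have hpow : ∀ m : ℕ, (P + Q) ^ (m + 1) = P ^ (m + 1) + Q ^ (m + 1) := by
    intro m
    induction m with
    | zero => simp
    | succ m ih =>
      rw [pow_succ, ih, add_mul, mul_add, mul_add, ← pow_succ, ← pow_succ, pow_succ P m,
        mul_assoc (P ^ m), h, pow_succ Q m, mul_assoc (Q ^ m), h']
      simp
  have hs := fun M : Matrix ι ι ℝ => hasSum_powerSum (factorialBound_sinhCoeff (𝕜 := ℝ)).succ M
  have e0 := fun M : Matrix ι ι ℝ => powerSum_eq_add_mul (factorialBound_sinhCoeff (𝕜 := ℝ)) M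
  have hc0 : sinhCoeff ℝ 0 = 1 := by simp [sinhCoeff]
  simp only [hc0, one_smul] at e0
  set g := fun M : Matrix ι ι ℝ => powerSum (fun m => sinhCoeff ℝ (m + 1)) M
  have hg : (P + Q) * g (P + Q) = P * g P + Q * g Q := by
    have h1 := (hs (P + Q)).mul_left (P + Q)
    have h2 := ((hs P).mul_left P).add ((hs Q).mul_left Q)
    refine h1.unique ?_
    refine (congrArg (HasSum · _) (funext fun m => ?_)).mpr h2
    simp only [Matrix.mul_smul, ← pow_succ', hpow, smul_add]
  have hPg : Commute P (g P) := commute_powerSum (factorialBound_sinhCoeff (𝕜 := ℝ)).succ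
    (Commute.refl P)
  have e1 : ∀ M : Matrix ι ι ℝ, sinhSqrt ℝ M = 1 + M * g M := e0
  have h3 : P * g P * (Q * g Q) = 0 := by
    rw [hPg.eq, mul_assoc, ← mul_assoc P, h, zero_mul, mul_zero]
  rw [e1, e1 P, e1 Q, hg, mul_add, mul_one, add_mul, one_mul, h3, add_zero, add_assoc]

end Complexify

end

end CurvatureGroup

/-! ### Joint diagonalization of the flat curvature. -/

namespace CurvatureGroup

noncomputable section

open Matrix
open scoped Matrix.Norms.Operator

namespace ParallelBundleCurvature

variable {n p : ℕ} {S : SymmetricSpaceCurvature n p} {W : Type*}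
  [NormedAddCommGroup W] [InnerProductSpace ℂ W] [CompleteSpace W]
  (Ω : ParallelBundleCurvature S W)

theorem flatCurv_apply (a b : Fin n) : Ω.flatCurv a b =
    ∑ c, ∑ d, ((S.q c a * S.q d b : ℝ) : ℂ) • Ω.curv c d := rfl

theorem flatCurv_antisymm (a b : Fin n) : Ω.flatCurv a b = -Ω.flatCurv b a := by
  rw [flatCurv_apply, flatCurv_apply, Finset.sum_comm, ← Finset.sum_neg_distrib]
  refine Finset.sum_congr rfl fun c _ => ?_
  rw [← Finset.sum_neg_distrib]
  refine Finset.sum_congr rfl fun d _ => ?_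
  rw [Ω.antisymm d c, smul_neg, mul_comm]

theorem star_flatCurv (a b : Fin n) : star (Ω.flatCurv a b) = -Ω.flatCurv a b := by
  rw [flatCurv_apply, star_sum, ← Finset.sum_neg_distrib]
  refine Finset.sum_congr rfl fun c _ => ?_
  rw [star_sum, ← Finset.sum_neg_distrib]
  refine Finset.sum_congr rfl fun d _ => ?_
  rw [star_smul, Ω.skewAdjoint, smul_neg]
  simp

/-- In the integrability condition, projecting the indices `c, d` to the flat part kills the
curvature terms. -/
theorem commute_flatCurv_curv (c' d' a b : Fin n) : Commute (Ω.flatCurv c' d') (Ω.curv a b) := by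
  have h : ∀ c d, Ω.curv c d * Ω.curv a b - Ω.curv a b * Ω.curv c d =
      (∑ f, (S.riemann f a c d : ℂ) • Ω.curv f b) + ∑ f, (S.riemann f b c d : ℂ) • Ω.curv a f :=
    fun c d => by
      have := Ω.parallel a b c d
      rw [sub_sub, sub_eq_zero] at this
      exact this
  have hz : ∀ (f a : Fin n) (T : W →L[ℂ] W),
      ∑ c, ∑ d, ((S.q c c' * S.q d d' : ℝ) : ℂ) • (S.riemann f a c d : ℂ) • T = 0 := by
    intro f a T
    rw [Finset.sum_comm]
    refine Finset.sum_eq_zero fun d _ => ?_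
    have h1 : ∀ c, ((S.q c c' * S.q d d' : ℝ) : ℂ) • (S.riemann f a c d : ℂ) • T =
        ((S.q d d' * (S.riemann f a c d * S.q c c') : ℝ) : ℂ) • T := fun c => by
      rw [smul_smul]
      congr 1
      push_cast
      ring
    simp only [h1]
    rw [← Finset.sum_smul, ← Complex.ofReal_sum, ← Finset.mul_sum, S.sum_riemann_mul_q]
    simp
  rw [commute_iff_eq, ← sub_eq_zero, flatCurv_apply]
  have h2 : (∑ c, ∑ d, ((S.q c c' * S.q d d' : ℝ) : ℂ) • Ω.curv c d) * Ω.curv a b -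
      Ω.curv a b * ∑ c, ∑ d, ((S.q c c' * S.q d d' : ℝ) : ℂ) • Ω.curv c d =
      ∑ c, ∑ d, ((S.q c c' * S.q d d' : ℝ) : ℂ) •
        (Ω.curv c d * Ω.curv a b - Ω.curv a b * Ω.curv c d) := by
    simp only [Finset.sum_mul, Finset.mul_sum, smul_mul_assoc, mul_smul_comm, smul_sub,
      Finset.sum_sub_distrib]
  rw [h2]
  simp only [h, smul_add, Finset.sum_add_distrib, Finset.smul_sum]
  rw [Finset.sum_comm_cycle, Finset.sum_comm_cycle
    (f := fun c d f => ((S.q c c' * S.q d d' : ℝ) : ℂ) • (S.riemann f b c d : ℂ) • Ω.curv a f),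
    Finset.sum_eq_zero fun f _ => hz f a _, Finset.sum_eq_zero fun f _ => hz f b _, add_zero]

theorem commute_flatCurv (a b c d : Fin n) : Commute (Ω.flatCurv a b) (Ω.flatCurv c d) := by
  rw [flatCurv_apply Ω c d]
  exact Commute.sum_right _ _ _ fun c' _ => Commute.sum_right _ _ _ fun d' _ =>
    (Ω.commute_flatCurv_curv a b c' d').smul_right _

theorem sum_E_smul_flatCurv (i : Fin p) (c b : Fin n) :
    ∑ a, (S.E i c a : ℂ) • Ω.flatCurv a b = 0 := by
  simp only [flatCurv_apply, Finset.smul_sum]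
  rw [Finset.sum_comm]
  refine Finset.sum_eq_zero fun f _ => ?_
  rw [Finset.sum_comm]
  refine Finset.sum_eq_zero fun d _ => ?_
  have h1 : ∀ a, (S.E i c a : ℂ) • ((S.q f a * S.q d b : ℝ) : ℂ) • Ω.curv f d =
      ((S.E i c a * S.q a f * S.q d b : ℝ) : ℂ) • Ω.curv f d := fun a => by
    rw [smul_smul, S.q_symm a f]
    congr 1
    push_cast
    ring
  simp only [h1]
  rw [← Finset.sum_smul, ← Complex.ofReal_sum, ← Finset.sum_mul, S.sum_E_mul_q]
  simp

variable [FiniteDimensional ℂ W]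

/-- A diagonal operator determines its entries, so the linear relations satisfied by `flatCurv` pass
to the real matrices of eigenvalues, which are the data of a `FlatForm`. -/
theorem exists_diagonalization : ∃ (m : ℕ) (e : OrthonormalBasis (Fin m) ℂ W)
    (b : Fin m → FlatForm S.curvatureAlgebra), Ω.B =
      matDiag e fun α => Complex.I • (b α).mat.map Complex.ofReal := by
  obtain ⟨m, e, b, hb⟩ := exists_joint_eigenbasis
    (T := fun j : Fin n × Fin n => Ω.flatCurv j.1 j.2) (fun j => Ω.star_flatCurv _ _)
    fun i j => Ω.commute_flatCurv _ _ _ _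
  have hdiag : ∀ a c, Ω.flatCurv a c = diagHom e fun α => Complex.I * (b α (a, c) : ℂ) :=
    fun a c => clm_ext_basis e fun α => by rw [hb α (a, c), diagHom_apply_basis]
  have hinj : ∀ f g : Fin m → ℂ, diagHom e f = diagHom e g → f = g := fun f g h => by
    funext α
    have h1 := congrArg (fun T : W →L[ℂ] W => T (e α)) h
    simp only [diagHom_apply_basis] at h1
    refine smul_left_injective ℂ (e.orthonormal.ne_zero α) h1
  have hanti : ∀ α a c, b α (c, a) = -b α (a, c) := fun α a c => by
    have h := Ω.flatCurv_antisymm c a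
    rw [hdiag, hdiag, ← map_neg] at h
    have h' := congrFun (hinj _ _ h) α
    rw [Pi.neg_apply, ← mul_neg] at h'
    exact_mod_cast mul_left_cancel₀ Complex.I_ne_zero h'
  have hE : ∀ α i c a, ∑ d, S.E i c d * b α (d, a) = 0 := fun α i c a => by
    have h := Ω.sum_E_smul_flatCurv i c a
    simp only [hdiag, ← map_smul, ← map_sum] at h
    have h' := congrFun (hinj _ 0 (h.trans (map_zero _).symm)) α
    simp only [Finset.sum_apply, Pi.smul_apply, smul_eq_mul, Pi.zero_apply] at h'
    have h3 : Complex.I * ((∑ d, S.E i c d * b α (d, a) : ℝ) : ℂ) = 0 := by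
      rw [← h']
      push_cast
      rw [Finset.mul_sum]
      exact Finset.sum_congr rfl fun d _ => by ring
    exact_mod_cast (mul_eq_zero.mp h3).resolve_left Complex.I_ne_zero
  refine ⟨m, e, fun α => SymmetricSpaceCurvature.flatForm (Matrix.of fun a c => b α (a, c))
    (by ext a c; exact hanti α a c) (fun i => by ext c a; exact hE α i c a), ?_⟩
  ext1 A C
  rw [matDiag_apply]
  rcases A with a | i <;> rcases C with c | l
  · exact hdiag a c
  all_goals
    refine (map_zero (diagHom e)).symm.trans (congrArg _ (funext fun α => ?_))
    change (0 : ℂ) = Complex.I * ((0 : ℝ) : ℂ)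
    simp

end ParallelBundleCurvature

end

end CurvatureGroup

/-! ### Reduction of the operator-valued kernel to scalar kernels. -/

namespace CurvatureGroup

noncomputable section

open Matrix
open scoped Matrix.Norms.Operator

namespace ParallelBundleCurvature

variable {n p : ℕ} {S : SymmetricSpaceCurvature n p} {W : Type*}
  [NormedAddCommGroup W] [InnerProductSpace ℂ W] [CompleteSpace W] [FiniteDimensional ℂ W]
  (Ω : ParallelBundleCurvature S W)
  {κ : Type*} [Fintype κ] {e : OrthonormalBasis κ ℂ W} {b : κ → FlatForm S.curvatureAlgebra}

/-- For `t = u s` with `u² = -σ` the square of `t · i b` is the real matrix `s² σ b²`; even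
functions of `t𝓑` are then real on both time axes. -/
theorem sq_smul_map_ofReal {b : FlatForm S.curvatureAlgebra} {u : ℂ} {σ s : ℝ}
    (hσ : u ^ 2 = -σ) :
    ((u * s) • Complex.I • b.mat.map Complex.ofReal) ^ 2 = (b.arg σ s).map Complex.ofReal := by
  have h1 : (b.mat.map Complex.ofReal) ^ 2 = (b.mat ^ 2).map Complex.ofReal := by
    rw [pow_two, pow_two]
    exact (Matrix.map_mul (f := Complex.ofRealHom)).symm
  have h2 : ((u * s) * Complex.I) ^ 2 = ((s ^ 2 * σ : ℝ) : ℂ) := by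
    rw [mul_pow, mul_pow, hσ, Complex.I_sq]
    push_cast
    ring
  rw [smul_smul, smul_pow, h1, h2, FlatForm.arg, smul_smul]
  ext A C
  simp

theorem sq_add_map_ofReal {b : FlatForm S.curvatureAlgebra} {u : ℂ} {σ s : ℝ}
    (hσ : u ^ 2 = -σ) (k : Idx n p → ℝ) :
    (((1 / 2 : ℝ) • S.ad k).map Complex.ofReal +
        (u * s) • Complex.I • b.mat.map Complex.ofReal) ^ 2 =
      (((1 / 2 : ℝ) • S.ad k) ^ 2 + b.arg σ s).map Complex.ofReal := by
  have hmul : ∀ M N : Matrix (Idx n p) (Idx n p) ℝ,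
      (M * N).map Complex.ofReal = M.map Complex.ofReal * N.map Complex.ofReal := fun M N =>
    Matrix.map_mul (f := Complex.ofRealHom)
  have h1 : (S.ad k).map Complex.ofReal * b.mat.map Complex.ofReal = 0 := by
    rw [← hmul, ← S.curvatureAlgebra_ad, b.ad_mul]
    simp
  have h2 : b.mat.map Complex.ofReal * (S.ad k).map Complex.ofReal = 0 := by
    rw [← hmul, ← S.curvatureAlgebra_ad, b.mul_ad]
    simp
  have h3 : ((1 / 2 : ℝ) • S.ad k).map Complex.ofReal =
      (1 / 2 : ℂ) • (S.ad k).map Complex.ofReal := by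
    ext A C
    simp
  have h4 : ((((1 / 2 : ℝ) • S.ad k) ^ 2 + b.arg σ s)).map Complex.ofReal =
      (((1 / 2 : ℝ) • S.ad k).map Complex.ofReal) ^ 2 + (b.arg σ s).map Complex.ofReal := by
    rw [pow_two, pow_two, ← hmul]
    ext A C
    simp
  rw [h4, ← sq_smul_map_ofReal hσ, h3, pow_two, add_mul, mul_add, mul_add, ← pow_two, ← pow_two]
  simp only [Matrix.mul_smul, Matrix.smul_mul, h1, h2, smul_zero, add_zero, zero_add]

variable (hB : Ω.B = matDiag e fun α => Complex.I • (b α).mat.map Complex.ofReal)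
include hB

theorem smul_B_eq (t : ℂ) :
    t • Ω.B = matDiag e fun α => t • Complex.I • (b α).mat.map Complex.ofReal := by
  rw [hB, ← map_smul]
  rfl

theorem detSinhc_eq {u : ℂ} {σ s : ℝ} (hσ : u ^ 2 = -σ) (k : Idx n p → ℝ) :
    Ω.detSinhc (u * s) k =
      diagHom e fun α => ((S.curvatureAlgebra.jac k * (b α).detSinh σ s : ℝ) : ℂ) := by
  have h1 : (S.ad k).map (fun x : ℝ => ((x / 2 : ℝ) : ℂ) • (1 : W →L[ℂ] W)) =
      matDiag e fun _ => ((1 / 2 : ℝ) • S.ad k).map Complex.ofReal := by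
    ext1 A C
    rw [matDiag_apply, Matrix.map_apply]
    rw [← Algebra.algebraMap_eq_smul_one, ← (diagHom e).commutes]
    congr 1
    funext α
    simp
    ring
  rw [detSinhc, h1, Ω.smul_B_eq hB, ← map_add, sinhc_matDiag, commDet_matDiag]
  congr 1
  funext α
  rw [Pi.add_apply, sq_add_map_ofReal hσ, sinhSqrt_map_ofReal, det_map_ofReal,
    sinhSqrt_add_of_mul_eq_zero, Matrix.det_mul, S.curvatureAlgebra.jac_eq_det_sinhSqrt]
  · rfl
  · have h := (b α).ad_mul k
    rw [S.curvatureAlgebra_ad] at h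
    rw [(b α).arg_eq_mul, pow_two, mul_assoc, ← mul_assoc _ (b α).mat, Matrix.smul_mul _ _ (b α).mat,
      h, smul_zero, zero_mul, mul_zero]
  · have h := (b α).mul_ad k
    rw [S.curvatureAlgebra_ad] at h
    rw [(b α).arg_eq_mul, Matrix.mul_smul, ← Matrix.smul_mul, pow_two (_ • S.ad k), mul_assoc,
      ← mul_assoc (b α).mat]
    simp only [Matrix.mul_smul, h, smul_zero, zero_mul, mul_zero]

variable {u : ℂ} {σ s : ℝ}

theorem thetaHat_eq (hσ : u ^ 2 = -σ) (he : ∀ α, (b α).detSinh σ s ≠ 0) :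
    Ω.thetaHat (u * s) = matDiag e fun α => ((b α).coth σ s).map Complex.ofReal := by
  have hsin : ∀ α, sinhSqrt ℂ (((u * s) • Complex.I • (b α).mat.map Complex.ofReal) ^ 2) =
      (sinhSqrt ℝ ((b α).arg σ s)).map Complex.ofReal := fun α => by
    rw [sq_smul_map_ofReal hσ, sinhSqrt_map_ofReal]
  have hu : ∀ α, IsUnit ((sinhSqrt ℝ ((b α).arg σ s)).map Complex.ofReal) := fun α => by
    rw [Matrix.isUnit_iff_isUnit_det, det_map_ofReal, isUnit_iff_ne_zero]
    exact Complex.ofReal_ne_zero.mpr (he α)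
  rw [thetaHat, Ω.smul_B_eq hB, sinhc_matDiag, coshM_matDiag]
  simp only [hsin]
  rw [ringInverse_matDiag e hu, ← map_mul]
  congr 1
  funext α
  rw [Pi.mul_apply, sq_smul_map_ofReal hσ, coshSqrt_map_ofReal,
    inv_map_ofReal ((b α).isUnit_sinhSqrt (he α)), FlatForm.coth, cothSqrt]
  exact (Matrix.map_mul (f := Complex.ofRealHom)).symm

theorem Θ_eq (hσ : u ^ 2 = -σ) (he : ∀ α, (b α).detSinh σ s ≠ 0) (k : Idx n p → ℝ) :
    Ω.Θ (u * s) k =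
      diagHom e fun α => 1 / 2 * ((k ⬝ᵥ (b α).quad σ s *ᵥ k : ℝ) : ℂ) := by
  rw [Θ, Ω.thetaHat_eq hB hσ he]
  simp only [matDiag_apply, ← map_smul, ← map_sum]
  congr 1
  funext α
  rw [Pi.smul_apply, smul_eq_mul]
  congr 1
  simp only [Finset.sum_apply, Pi.smul_apply, smul_eq_mul, Matrix.map_apply, FlatForm.quad,
    ← Complex.ofReal_mul, ← Complex.ofReal_sum]
  congr 1
  rw [← Matrix.mulVec_mulVec, S.curvatureAlgebra_form]
  simp only [dotProduct, Matrix.mulVec, Finset.mul_sum]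
  exact Finset.sum_congr rfl fun A _ => Finset.sum_congr rfl fun C _ =>
    Finset.sum_congr rfl fun D _ => by ring

/-- Valid at irregular `k` too: where `jac k = 0`, both sides use the same real power of zero. The
integrals below can thus be compared pointwise. -/
theorem Φ_eq (hσ : u ^ 2 = -σ) (he : ∀ α, (b α).detSinh σ s ≠ 0) (k : Idx n p → ℝ) :
    Ω.Φ (u * s) k = diagHom e fun α => (b α).heat u σ s k := by
  have hA : Ω.A (u * s) k = diagHom e fun α =>
      (((S.curvatureAlgebra.jac k * (b α).detSinh σ s) ^ (-(1 / 2) : ℝ) : ℝ) : ℂ) := by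
    rw [A, Ω.detSinhc_eq hB hσ, cfc_diagHom]
  have h1 : -((1 / (2 * (u * s))) • Ω.Θ (u * s) k) +
      ((S.scalarCurvature : ℂ) * (u * s) / 6) • (1 : W →L[ℂ] W) =
      diagHom e fun α => (b α).exponent u σ s k := by
    rw [Ω.Θ_eq hB hσ he, ← map_one (diagHom e), ← map_smul, ← map_smul, ← map_neg, ← map_add,
      S.scalarCurvature_eq]
    congr 1
    funext α
    simp [FlatForm.exponent]
  rw [Φ, hA, h1, exp_diagHom, ← map_mul, ← map_smul]
  congr 1
  funext α
  simp [FlatForm.heat]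

theorem B_row_eq (A : Idx n p) (k : Idx n p → ℝ) : ∑ C, (k C : ℂ) • Ω.B A C =
    diagHom e fun α => Complex.I * ((stdVec A ⬝ᵥ (b α).mat *ᵥ k : ℝ) : ℂ) := by
  rw [hB]
  simp only [matDiag_apply, ← map_smul, ← map_sum]
  congr 1
  funext α
  have h : stdVec A ⬝ᵥ (b α).mat *ᵥ k = ∑ C, (b α).mat A C * k C := by
    rw [stdVec, single_dotProduct, one_mul]
    rfl
  rw [h, Finset.sum_apply, Complex.ofReal_sum, Finset.mul_sum]
  refine Finset.sum_congr rfl fun C _ => ?_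
  simp only [Pi.smul_apply, Matrix.smul_apply, Matrix.map_apply, smul_eq_mul]
  push_cast
  ring

theorem J_diagHom (A : Idx n p) {φ : κ → (Idx n p → ℝ) → ℂ} {k : Idx n p → ℝ}
    (hφ : ∀ α, DifferentiableAt ℝ (φ α) k) :
    Ω.J A (fun k => diagHom e fun α => φ α k) k =
      diagHom e fun α => (b α).cov (stdVec A) (φ α) k := by
  have hd : HasFDerivAt (fun k => diagHom e fun α => φ α k)
      ((diagCLM e).comp (ContinuousLinearMap.pi fun α => fderiv ℝ (φ α) k)) k :=
    (diagCLM e).hasFDerivAt.comp k (hasFDerivAt_pi.mpr fun α => (hφ α).hasFDerivAt)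
  rw [J, hd.fderiv, Ω.B_row_eq hB, ← map_mul, ← map_smul]
  have h1 : ∀ M, (((S.Y k)⁻¹ M A : ℝ) : ℂ) • ((diagCLM e).comp
      (ContinuousLinearMap.pi fun α => fderiv ℝ (φ α) k)) (Pi.single M 1) =
      diagHom e fun α => (((S.Y k)⁻¹ M A : ℝ) : ℂ) * fderiv ℝ (φ α) k (Pi.single M 1) := fun M => by
    rw [ContinuousLinearMap.comp_apply, diagCLM_apply, ← map_smul]
    rfl
  simp only [h1]
  rw [← map_sum, ← map_sub]
  congr 1
  funext α
  rw [Pi.sub_apply, Finset.sum_apply, FlatForm.cov, ← S.Y_eq]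
  congr 1
  · have h2 : (S.Y k)⁻¹ *ᵥ stdVec A = ∑ M, (S.Y k)⁻¹ M A • (Pi.single M 1 : Idx n p → ℝ) := by
      ext C
      simp [stdVec, Finset.sum_apply, Pi.single_apply]
    rw [h2, map_sum]
    exact Finset.sum_congr rfl fun M _ => by rw [map_smul, Complex.real_smul]
  · simp [mul_assoc]

omit hB [FiniteDimensional ℂ W] in
theorem J_congr (A : Idx n p) {f g : (Idx n p → ℝ) → (W →L[ℂ] W)} {k : Idx n p → ℝ}
    (h : f =ᶠ[𝓝 k] g) : Ω.J A f k = Ω.J A g k := by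
  rw [J, J, h.fderiv_eq, h.self_of_nhds]

-- Linearity in `w` is read off from the closed formula. It replaces the contraction of `J_A J_B`
-- with `γ⁻¹` by a sum over a basis and its dual.
omit hB [FiniteDimensional ℂ W] [Fintype κ] in
theorem cov_cov_heat_linear (α : κ) {k : Idx n p → ℝ} (hk : S.curvatureAlgebra.jac k ≠ 0)
    (he : (b α).detSinh σ s ≠ 0) (v : Idx n p → ℝ) :
    ∃ L : (Idx n p → ℝ) →ₗ[ℝ] ℂ, ∀ w, (b α).cov v ((b α).cov w ((b α).heat u σ s)) k = L w := by
  refine ⟨⟨⟨fun w => (b α).cov v ((b α).cov w ((b α).heat u σ s)) k, ?_⟩, ?_⟩, fun w => rfl⟩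
  · intro w w'
    simp only [(b α).cov_cov_heat hk he, FlatForm.drift, map_add, Matrix.mul_add,
      Matrix.trace_add, add_dotProduct, QuadraticLieAlgebra.logJac_add]
    push_cast
    ring
  · intro r w
    simp only [(b α).cov_cov_heat hk he, FlatForm.drift, map_smul, Matrix.mul_smul,
      Matrix.trace_smul, smul_dotProduct, QuadraticLieAlgebra.logJac_smul, smul_eq_mul,
      RingHom.id_apply, Complex.real_smul]
    push_cast
    ring

theorem J2_Φ (hσ : u ^ 2 = -σ) (he : ∀ α, (b α).detSinh σ s ≠ 0) {k : Idx n p → ℝ}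
    (hk : S.curvatureAlgebra.jac k ≠ 0) :
    Ω.J2 (Ω.Φ (u * s)) k = diagHom e fun α => ∑ A, (b α).cov (stdVec A)
      ((b α).cov (S.curvatureAlgebra.form⁻¹ *ᵥ stdVec A) ((b α).heat u σ s)) k := by
  have hΦ : Ω.Φ (u * s) = fun k => diagHom e fun α => (b α).heat u σ s k :=
    funext fun k => Ω.Φ_eq hB hσ he k
  have hdiff : ∀ {k}, S.curvatureAlgebra.jac k ≠ 0 → ∀ α,
      DifferentiableAt ℝ ((b α).heat u σ s) k := fun hk α =>
    ((b α).contDiffAt_heat (n := 1) hk (he α)).differentiableAt one_ne_zero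
  have h1 : ∀ B, Ω.J B (Ω.Φ (u * s)) =ᶠ[𝓝 k] fun k => diagHom e fun α =>
      (b α).cov (stdVec B) ((b α).heat u σ s) k := fun B => by
    refine (FlatForm.jac_ne_zero_of_eventually hk).mono fun k' hk' => ?_
    simp only
    rw [hΦ]
    exact Ω.J_diagHom hB B (hdiff hk')
  have h2 : ∀ B α, DifferentiableAt ℝ ((b α).cov (stdVec B) ((b α).heat u σ s)) k := fun B α => by
    obtain ⟨L, hL, -⟩ := (b α).hasFDerivAt_drift (u := u) (σ := σ) (s := s) hk (stdVec B)
    exact (hL.differentiableAt.fun_mul (hdiff hk α)).congr_of_eventuallyEq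
      ((FlatForm.jac_ne_zero_of_eventually hk).mono fun k' hk' => (b α).cov_heat hk' (he α) _)
  have h3 : ∀ A B, Ω.J A (Ω.J B (Ω.Φ (u * s))) k = diagHom e fun α =>
      (b α).cov (stdVec A) ((b α).cov (stdVec B) ((b α).heat u σ s)) k := fun A B => by
    rw [Ω.J_congr A (h1 B), Ω.J_diagHom hB A (h2 B)]
  rw [J2]
  simp only [h3, ← map_smul, ← map_sum]
  congr 1
  funext α
  rw [Finset.sum_apply]
  refine Finset.sum_congr rfl fun A _ => ?_
  obtain ⟨L, hL⟩ := cov_cov_heat_linear (u := u) α hk (he α) (stdVec A)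
  have h4 : S.curvatureAlgebra.form⁻¹ *ᵥ stdVec A = ∑ B, S.γ⁻¹ A B • stdVec B := by
    ext C
    have h := congrFun (congrFun S.curvatureAlgebra.form_inv_symm A) C
    rw [Matrix.transpose_apply, S.curvatureAlgebra_form] at h
    rw [S.curvatureAlgebra_form, Finset.sum_apply]
    simp only [stdVec, Matrix.mulVec_single_one, Matrix.col_apply, Pi.smul_apply, smul_eq_mul,
      Pi.single_apply, mul_ite, mul_one, mul_zero, Finset.sum_ite_eq, Finset.mem_univ, if_true, h]
  rw [Finset.sum_apply, hL, h4, map_sum]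
  exact Finset.sum_congr rfl fun B _ => by rw [map_smul, Pi.smul_apply, hL, Complex.real_smul]; rfl

theorem contDiffAt_Φ (hσ : u ^ 2 = -σ) (he : ∀ α, (b α).detSinh σ s ≠ 0) {k : Idx n p → ℝ}
    (hk : S.curvatureAlgebra.jac k ≠ 0) : ContDiffAt ℝ ∞ (Ω.Φ (u * s)) k := by
  have hΦ : Ω.Φ (u * s) = fun k => diagHom e fun α => (b α).heat u σ s k :=
    funext fun k => Ω.Φ_eq hB hσ he k
  rw [hΦ]
  exact (diagCLM e).contDiff.contDiffAt.comp k
    (contDiffAt_pi.mpr fun α => (b α).contDiffAt_heat hk (he α))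

theorem hasDerivAt_Φ (hu : u ∈ Complex.slitPlane) (hσ : u ^ 2 = -σ) (hs : 0 < s)
    (he : ∀ α, (b α).detSinh σ s ≠ 0) {k : Idx n p → ℝ}
    (hk : S.curvatureAlgebra.jac k ≠ 0) :
    HasDerivAt (fun s : ℝ => Ω.Φ (u * s) k) (u • Ω.J2 (Ω.Φ (u * s)) k) s := by
  have hev : ∀ᶠ s' in 𝓝 s, ∀ α, (b α).detSinh σ s' ≠ 0 := by
    rw [Filter.eventually_all]
    intro α
    exact (hasDerivAt_det_sinhSqrt (σ • (b α).mat ^ 2) hs.ne'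
      ((b α).isUnit_sinhSqrt (he α))).continuousAt.eventually_ne (he α)
  have h1 : (fun s : ℝ => Ω.Φ (u * s) k) =ᶠ[𝓝 s] fun s => diagHom e fun α =>
      (b α).heat u σ s k := hev.mono fun s' hs' => Ω.Φ_eq hB hσ hs' k
  refine HasDerivAt.congr_of_eventuallyEq ?_ h1
  rw [Ω.J2_Φ hB hσ he hk, ← map_smul]
  exact (diagCLM e).hasFDerivAt.comp_hasDerivAt s
    (hasDerivAt_pi.mpr fun α => (b α).hasDerivAt_heat hu hσ hs hk (he α))

end ParallelBundleCurvature

end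

end CurvatureGroup

/-! ### Fourier analysis of Gaussians with complex widths. -/

namespace CurvatureGroup

noncomputable section

open Matrix MeasureTheory FourierTransform
open scoped RealInnerProductSpace SchwartzMap

variable {ι : Type*} [Fintype ι]

/-- The Gaussian with complex widths `b i` along the axes of an orthonormal basis. -/
def axisGaussian (v : OrthonormalBasis ι ℝ (EuclideanSpace ℝ ι)) (b : ι → ℂ)
    (x : EuclideanSpace ℝ ι) : ℂ :=
  Complex.exp (-∑ i, b i * ((⟪v i, x⟫ : ℝ) : ℂ) ^ 2)

section AxisGaussian

variable (v : OrthonormalBasis ι ℝ (EuclideanSpace ℝ ι)) {b : ι → ℂ}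

theorem continuous_axisGaussian (b : ι → ℂ) : Continuous (axisGaussian v b) := by
  unfold axisGaussian
  fun_prop

theorem continuous_axisGaussian_width (x : EuclideanSpace ℝ ι) :
    Continuous fun b => axisGaussian v b x := by
  unfold axisGaussian
  fun_prop

theorem norm_axisGaussian_le (hb : ∀ i, 0 ≤ (b i).re) (x : EuclideanSpace ℝ ι) :
    ‖axisGaussian v b x‖ ≤ 1 := by
  rw [axisGaussian, Complex.norm_exp, Real.exp_le_one_iff, Complex.neg_re, Complex.re_sum,
    neg_nonpos]
  refine Finset.sum_nonneg fun i _ => ?_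
  rw [← Complex.ofReal_pow, Complex.re_mul_ofReal]
  exact mul_nonneg (hb i) (sq_nonneg _)

theorem measurePreserving_axes :
    MeasurePreserving (fun y : ι → ℝ => v.repr.symm (WithLp.toLp 2 y)) volume volume :=
  v.measurePreserving_repr_symm.comp (PiLp.volume_preserving_toLp ι)

theorem measurableEmbedding_axes :
    MeasurableEmbedding (fun y : ι → ℝ => v.repr.symm (WithLp.toLp 2 y)) :=
  v.repr.symm.toHomeomorph.measurableEmbedding.comp
    (MeasurableEquiv.toLp 2 (ι → ℝ)).measurableEmbedding

theorem inner_axes (i : ι) (y : ι → ℝ) : ⟪v i, v.repr.symm (WithLp.toLp 2 y)⟫ = y i := by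
  rw [← OrthonormalBasis.repr_apply_apply]
  simp

theorem integrable_axisGaussian (hb : ∀ i, 0 < (b i).re) : Integrable (axisGaussian v b) := by
  rw [← (measurePreserving_axes v).integrable_comp_emb (measurableEmbedding_axes v)]
  have h := GaussianFourier.integrable_cexp_neg_sum_mul_add hb 0
  simpa [Function.comp_def, axisGaussian, inner_axes] using h

theorem fourier_axisGaussian (hb : ∀ i, 0 < (b i).re) (w : EuclideanSpace ℝ ι) :
    𝓕 (axisGaussian v b) w =
      (∏ i, ((Real.pi : ℂ) / b i) ^ (1 / 2 : ℂ)) *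
        axisGaussian v (fun i => (Real.pi : ℂ) ^ 2 / b i) w := by
  have h := GaussianFourier.integral_cexp_neg_sum_mul_add hb
    (fun i => -(2 * (Real.pi : ℂ) * Complex.I * ((⟪v i, w⟫ : ℝ) : ℂ)))
  rw [Real.fourier_eq', ← (measurePreserving_axes v).integral_comp (measurableEmbedding_axes v)]
  rw [Finset.prod_mul_distrib, ← Complex.exp_sum] at h
  have h1 : ∀ i, b i ≠ 0 := fun i h0 => by
    have := hb i
    simp [h0] at this
  convert! h using 1
  · congr 1
    funext y
    rw [smul_eq_mul, axisGaussian, ← Complex.exp_add, ← v.sum_inner_mul_inner]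
    congr 1
    simp only [inner_axes, real_inner_comm _ (v.repr.symm _)]
    push_cast
    rw [add_comm, Finset.mul_sum, Finset.sum_mul]
    congr 1
    refine Finset.sum_congr rfl fun i _ => ?_
    ring
  · rw [axisGaussian, ← Finset.sum_neg_distrib]
    congr 2
    refine Finset.sum_congr rfl fun i _ => ?_
    have hI : Complex.I ^ 2 = -1 := Complex.I_sq
    have h4 : b i ≠ 0 := h1 i
    field_simp
    rw [hI]
    ring

/-- Parseval's identity against a Gaussian of positive widths. -/
theorem integral_mul_axisGaussian_of_pos (hb : ∀ i, 0 < (b i).re)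
    (F : 𝓢(EuclideanSpace ℝ ι, ℂ)) :
    ∫ k, F k * axisGaussian v b k =
      (∏ i, ((Real.pi : ℂ) / b i) ^ (1 / 2 : ℂ)) *
        ∫ ξ, (𝓕⁻ F) ξ * axisGaussian v (fun i => (Real.pi : ℂ) ^ 2 / b i) ξ := by
  have h := VectorFourier.integral_fourierIntegral_smul_eq_flip
    (L := innerₗ (EuclideanSpace ℝ ι)) (μ := volume) (ν := volume)
    Real.continuous_fourierChar continuous_inner (𝓕⁻ F).integrable (integrable_axisGaussian v hb)
  have h1 : ∀ ξ, VectorFourier.fourierIntegral Real.fourierChar volume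
      (innerₗ (EuclideanSpace ℝ ι)) (𝓕⁻ F : 𝓢(EuclideanSpace ℝ ι, ℂ)) ξ = F ξ := fun ξ => by
    have h2 : 𝓕 (𝓕⁻ F) ξ = F ξ := by rw [fourier_fourierInv_eq]
    exact h2
  have h3 : ∀ x, VectorFourier.fourierIntegral Real.fourierChar volume
      (innerₗ (EuclideanSpace ℝ ι)).flip (axisGaussian v b) x = _ := fun x =>
    (congrArg (fun L => VectorFourier.fourierIntegral Real.fourierChar volume L
      (axisGaussian v b) x) (flip_innerₗ (EuclideanSpace ℝ ι))).trans (fourier_axisGaussian v hb x)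
  simp only [h1, h3, smul_eq_mul] at h
  rw [h, ← integral_const_mul]
  congr 1
  funext x
  ring

/-- Keeps the principal square roots in the Fourier prefactor continuous up to the imaginary axis.
-/
theorem div_mem_slitPlane {z : ℂ} (h : 0 ≤ z.re) (hz : z ≠ 0) :
    (Real.pi : ℂ) / z ∈ Complex.slitPlane := by
  have hpos : 0 < Complex.normSq z := Complex.normSq_pos.mpr hz
  rw [div_eq_mul_inv, Complex.mem_slitPlane_iff]
  simp only [Complex.re_ofReal_mul, Complex.im_ofReal_mul, Complex.inv_re, Complex.inv_im]
  rcases h.lt_or_eq with h | h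
  · exact Or.inl (by positivity)
  · refine Or.inr ?_
    have him : z.im ≠ 0 := fun h0 => hz (Complex.ext h.symm h0)
    exact mul_ne_zero Real.pi_ne_zero (div_ne_zero (neg_ne_zero.mpr him) hpos.ne')

theorem tendsto_integral_mul_axisGaussian {α : Type*} {l : Filter α} [l.IsCountablyGenerated]
    {c : α → ι → ℂ} {c₀ : ι → ℂ} (hc : Filter.Tendsto c l (𝓝 c₀))
    (hre : ∀ᶠ a in l, ∀ i, 0 ≤ (c a i).re) (F : 𝓢(EuclideanSpace ℝ ι, ℂ)) :
    Filter.Tendsto (fun a => ∫ k, F k * axisGaussian v (c a) k) l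
      (𝓝 (∫ k, F k * axisGaussian v c₀ k)) := by
  refine tendsto_integral_filter_of_dominated_convergence (fun k => ‖F k‖)
    (Filter.Eventually.of_forall fun a =>
      (F.continuous.mul (continuous_axisGaussian v _)).aestronglyMeasurable)
    (hre.mono fun a ha => Filter.Eventually.of_forall fun k => ?_) F.integrable.norm
    (Filter.Eventually.of_forall fun k => Filter.Tendsto.const_mul _
      (((continuous_axisGaussian_width v k).tendsto c₀).comp hc))
  rw [norm_mul]
  exact mul_le_of_le_one_right (norm_nonneg _) (norm_axisGaussian_le v ha k)

/-- Parseval's identity against a Gaussian of nonzero widths in the closed right half plane. -/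
theorem integral_mul_axisGaussian (hb : ∀ i, 0 ≤ (b i).re) (hb0 : ∀ i, b i ≠ 0)
    (F : 𝓢(EuclideanSpace ℝ ι, ℂ)) :
    ∫ k, F k * axisGaussian v b k =
      (∏ i, ((Real.pi : ℂ) / b i) ^ (1 / 2 : ℂ)) *
        ∫ ξ, (𝓕⁻ F) ξ * axisGaussian v (fun i => (Real.pi : ℂ) ^ 2 / b i) ξ := by
  -- Widths on the imaginary axis are approached by `b i + ε`. Both Gaussians remain bounded by `1`,
  -- so dominated convergence applies on both sides.
  have hε : Filter.Tendsto (fun ε : ℝ => (ε : ℂ)) (𝓝[>] 0) (𝓝 0) := by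
    have h := Complex.continuous_ofReal.tendsto 0
    rw [Complex.ofReal_zero] at h
    exact h.mono_left nhdsWithin_le_nhds
  have hbi : ∀ i, Filter.Tendsto (fun ε : ℝ => b i + ε) (𝓝[>] 0) (𝓝 (b i)) := fun i => by
    simpa using hε.const_add (b i)
  have hdiv : ∀ (c : ℂ) i, Filter.Tendsto (fun ε : ℝ => c / (b i + ε)) (𝓝[>] 0) (𝓝 (c / b i)) :=
    fun c i => tendsto_const_nhds.div (hbi i) (hb0 i)
  have hpos : ∀ᶠ ε : ℝ in 𝓝[>] 0, ∀ i, 0 < (b i + ε).re := by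
    filter_upwards [self_mem_nhdsWithin] with ε (hε : 0 < ε) i
    rw [Complex.add_re, Complex.ofReal_re]
    exact add_pos_of_nonneg_of_pos (hb i) hε
  have h1 := tendsto_integral_mul_axisGaussian v (tendsto_pi_nhds.mpr hbi)
    (hpos.mono fun ε h i => (h i).le) F
  have h2 := tendsto_integral_mul_axisGaussian v
    (tendsto_pi_nhds.mpr fun i => hdiv ((Real.pi : ℂ) ^ 2) i)
    (hpos.mono fun ε h i => by
      rw [← Complex.ofReal_pow, div_eq_mul_inv, Complex.re_ofReal_mul, Complex.inv_re]
      exact mul_nonneg (sq_nonneg _) (div_nonneg (h i).le (Complex.normSq_nonneg _))) (𝓕⁻ F)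
  have h3 : Filter.Tendsto (fun ε : ℝ => ∏ i, ((Real.pi : ℂ) / (b i + ε)) ^ (1 / 2 : ℂ)) (𝓝[>] 0)
      (𝓝 (∏ i, ((Real.pi : ℂ) / b i) ^ (1 / 2 : ℂ))) :=
    tendsto_finsetProd _ fun i _ =>
      (hdiv (Real.pi : ℂ) i).cpow tendsto_const_nhds (div_mem_slitPlane (hb i) (hb0 i))
  refine tendsto_nhds_unique h1 ((h3.mul h2).congr' (hpos.mono fun ε h => ?_))
  exact (integral_mul_axisGaussian_of_pos v h F).symm

theorem integral_fourierInv (F : 𝓢(EuclideanSpace ℝ ι, ℂ)) : ∫ ξ, (𝓕⁻ F) ξ = F 0 := by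
  have h : 𝓕 (𝓕⁻ F) 0 = F 0 := by rw [fourier_fourierInv_eq]
  rw [← h, SchwartzMap.fourier_coe, Real.fourier_eq']
  simp

end AxisGaussian

end

end CurvatureGroup

/-! ### Gaussian heat kernels of quadratic forms and their Dirac limit. -/

namespace CurvatureGroup

noncomputable section

open Matrix MeasureTheory FourierTransform
open scoped RealInnerProductSpace SchwartzMap

variable {ι : Type*} [Fintype ι] [DecidableEq ι]

/-- The Gaussian of a quadratic form with a complex coefficient. -/
def quadGaussian (z : ℂ) (M : Matrix ι ι ℝ) (x : EuclideanSpace ℝ ι) : ℂ :=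
  Complex.exp (-(z * ((x.ofLp ⬝ᵥ M *ᵥ x.ofLp : ℝ) : ℂ)))

omit [DecidableEq ι] in
theorem inner_eq_dotProduct (x y : EuclideanSpace ℝ ι) : ⟪x, y⟫ = x.ofLp ⬝ᵥ y.ofLp := by
  rw [EuclideanSpace.inner_eq_star_dotProduct, star_trivial, dotProduct_comm]

omit [DecidableEq ι] in
theorem quadGaussian_eq_axisGaussian {v : OrthonormalBasis ι ℝ (EuclideanSpace ℝ ι)} {y : ι → ℝ}
    {M : Matrix ι ι ℝ} (hM : Mᵀ = M) (hv : ∀ i, M *ᵥ (v i).ofLp = y i • (v i).ofLp) (z : ℂ)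
    (x : EuclideanSpace ℝ ι) :
    quadGaussian z M x = axisGaussian v (fun i => z * y i) x := by
  have h1 : ∀ i, ⟪v i, WithLp.toLp 2 (M *ᵥ x.ofLp)⟫ = y i * ⟪v i, x⟫ := fun i => by
    rw [inner_eq_dotProduct, inner_eq_dotProduct, WithLp.ofLp_toLp, Matrix.dotProduct_mulVec,
      ← Matrix.mulVec_transpose, hM, hv, smul_dotProduct, smul_eq_mul]
  have h2 : x.ofLp ⬝ᵥ M *ᵥ x.ofLp = ∑ i, y i * ⟪v i, x⟫ ^ 2 := by
    have h := v.sum_inner_mul_inner x (WithLp.toLp 2 (M *ᵥ x.ofLp))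
    rw [inner_eq_dotProduct x (WithLp.toLp 2 _), WithLp.ofLp_toLp] at h
    rw [← h]
    refine Finset.sum_congr rfl fun i _ => ?_
    rw [h1, real_inner_comm]
    ring
  rw [quadGaussian, axisGaussian, h2, Complex.ofReal_sum, Finset.mul_sum]
  congr 2
  refine Finset.sum_congr rfl fun i _ => ?_
  push_cast
  ring

/-- The pairs of a direction `u` of the complex time and a quadratic form for which the Gaussian
heat kernel is defined: imaginary times and nondegenerate forms, or positive times and positive
definite forms. -/
def Admissible (u : ℂ) (M : Matrix ι ι ℝ) : Prop :=
  (u = Complex.I ∧ Mᵀ = M ∧ M.det ≠ 0) ∨ (u = 1 ∧ M.PosDef)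

namespace Admissible

variable {u : ℂ} {M : Matrix ι ι ℝ}

theorem isHermitian (h : Admissible u M) : M.IsHermitian := by
  rcases h with h | h
  · rw [Matrix.IsHermitian, Matrix.conjTranspose_eq_transpose_of_trivial, h.2.1]
  · exact h.2.isHermitian

theorem transpose_eq (h : Admissible u M) : Mᵀ = M := by
  have h1 := h.isHermitian
  rwa [Matrix.IsHermitian, Matrix.conjTranspose_eq_transpose_of_trivial] at h1

theorem det_ne_zero (h : Admissible u M) : M.det ≠ 0 := by
  rcases h with h | h
  · exact h.2.2
  · exact h.2.det_pos.ne'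

theorem ne_zero (h : Admissible u M) : u ≠ 0 := by
  rcases h with h | h <;> simp [h.1]

theorem inv (h : Admissible u M) : Admissible u M⁻¹ := by
  rcases h with h | h
  · refine Or.inl ⟨h.1, by rw [Matrix.transpose_nonsing_inv, h.2.1], ?_⟩
    rw [Matrix.det_nonsing_inv, Ring.inverse_eq_inv']
    exact inv_ne_zero h.2.2
  · exact Or.inr ⟨h.1, h.2.inv⟩

theorem eigenvalues_ne_zero (h : Admissible u M) (i : ι) : h.isHermitian.eigenvalues i ≠ 0 := by
  intro h0
  have h1 := h.det_ne_zero
  rw [h.isHermitian.det_eq_prod_eigenvalues] at h1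
  exact h1 (Finset.prod_eq_zero (Finset.mem_univ i) (by rw [h0]; rfl))

theorem re_mul_nonneg (h : Admissible u M) {r : ℝ} (hr : 0 ≤ r) (x : ι → ℝ) :
    0 ≤ ((r * u) * ((x ⬝ᵥ M *ᵥ x : ℝ) : ℂ)).re := by
  rcases h with h | h
  · simp [h.1]
  · rw [h.1, mul_one, ← Complex.ofReal_mul, Complex.ofReal_re]
    exact mul_nonneg hr (by simpa using h.2.posSemidef.dotProduct_mulVec_nonneg x)

theorem re_inv_mul_nonneg (h : Admissible u M) {r : ℝ} (hr : 0 ≤ r) (x : ι → ℝ) :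
    0 ≤ ((r * u⁻¹) * ((x ⬝ᵥ M *ᵥ x : ℝ) : ℂ)).re := by
  rcases h with h | h
  · simp [h.1]
  · rw [h.1, inv_one, mul_one, ← Complex.ofReal_mul, Complex.ofReal_re]
    exact mul_nonneg hr (by simpa using h.2.posSemidef.dotProduct_mulVec_nonneg x)

theorem re_inv_mul_eigenvalues_nonneg (h : Admissible u M) {r : ℝ} (hr : 0 ≤ r) (i : ι) :
    0 ≤ ((r * u⁻¹) * (h.isHermitian.eigenvalues i : ℂ)).re := by
  have hcases := h
  rcases hcases with ⟨rfl, -⟩ | ⟨rfl, h'⟩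
  · simp
  · rw [inv_one, mul_one, ← Complex.ofReal_mul, Complex.ofReal_re]
    exact mul_nonneg hr (h'.eigenvalues_pos i).le

/-- The argument of `u` is `0` or `π/2`, that of an eigenvalue `0` or `π`, the latter only when `u =
i`. Their difference stays in `(-π, π]`, so principal logarithms subtract; this fixes the branch in
`invSqrtDet`. -/
theorem cpow_eigenvalues (h : Admissible u M) {r : ℝ} (hr : 0 < r) (i : ι) :
    (r * u) ^ (-(1 / 2) : ℂ) * (r * u / (h.isHermitian.eigenvalues i : ℂ)) ^ (1 / 2 : ℂ) =
      (h.isHermitian.eigenvalues i : ℂ) ^ (-(1 / 2) : ℂ) := by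
  have hx := Complex.ofReal_ne_zero.mpr (h.eigenvalues_ne_zero i)
  have hru : (r : ℂ) * u ≠ 0 := mul_ne_zero (Complex.ofReal_ne_zero.mpr hr.ne') h.ne_zero
  have harg : -Real.pi < Complex.arg (r * u) - Complex.arg (h.isHermitian.eigenvalues i : ℂ) ∧
      Complex.arg (r * u) - Complex.arg (h.isHermitian.eigenvalues i : ℂ) ≤ Real.pi := by
    rw [Complex.arg_real_mul u hr]
    have hpi := Real.pi_pos
    have hcases := h
    rcases hcases with ⟨rfl, -⟩ | ⟨rfl, h'⟩
    · rw [Complex.arg_I]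
      rcases le_or_gt 0 (h.isHermitian.eigenvalues i) with h0 | h0
      · rw [Complex.arg_ofReal_of_nonneg h0]
        constructor <;> linarith
      · rw [Complex.arg_ofReal_of_neg h0]
        constructor <;> linarith
    · rw [Complex.arg_one, Complex.arg_ofReal_of_nonneg (h'.eigenvalues_pos i).le]
      constructor <;> linarith
  have hlog : Complex.log (r * u / (h.isHermitian.eigenvalues i : ℂ)) =
      Complex.log (r * u) - Complex.log (h.isHermitian.eigenvalues i : ℂ) := by
    rw [← Complex.log_exp (x := Complex.log (r * u) - Complex.log _)
      (by rw [Complex.sub_im, Complex.log_im, Complex.log_im]; exact harg.1)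
      (by rw [Complex.sub_im, Complex.log_im, Complex.log_im]; exact harg.2), Complex.exp_sub, Complex.exp_log hru, Complex.exp_log hx]
  rw [Complex.cpow_def_of_ne_zero hru, Complex.cpow_def_of_ne_zero hx,
    Complex.cpow_def_of_ne_zero (div_ne_zero hru hx), hlog, ← Complex.exp_add]
  congr 1
  ring

theorem invSqrtDet_eq (h : Admissible u M) :
    invSqrtDet M = ∏ i, (h.isHermitian.eigenvalues i : ℂ) ^ (-(1 / 2) : ℂ) := by
  rw [invSqrtDet, h.isHermitian.roots_charpoly_eq_eigenvalues, Multiset.map_map]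
  rfl

/-- Parseval's identity against the Gaussian heat kernel. -/
theorem integral_quadGaussian (h : Admissible u M) {s : ℝ} (hs : 0 < s)
    (F : 𝓢(EuclideanSpace ℝ ι, ℂ)) :
    (4 * (Real.pi : ℂ) * (u * s)) ^ (-((Fintype.card ι : ℕ) : ℂ) / 2) *
        ∫ k, F k * quadGaussian (((1 / (4 * s) : ℝ) : ℂ) * u⁻¹) M k =
      invSqrtDet M * ∫ ξ, (𝓕⁻ F) ξ * quadGaussian (((4 * Real.pi ^ 2 * s : ℝ) : ℂ) * u) M⁻¹ ξ := by
  have hu := h.ne_zero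
  have hs' : (s : ℂ) ≠ 0 := Complex.ofReal_ne_zero.mpr hs.ne'
  have hx := h.eigenvalues_ne_zero
  have hpi : 0 < 4 * Real.pi * s := by positivity
  have hv := h.isHermitian.mulVec_eigenvectorBasis
  have hv' : ∀ i, M⁻¹ *ᵥ (h.isHermitian.eigenvectorBasis i).ofLp =
      (h.isHermitian.eigenvalues i)⁻¹ • (h.isHermitian.eigenvectorBasis i).ofLp := fun i => by
    have h1 := congrArg (fun y => (h.isHermitian.eigenvalues i)⁻¹ • M⁻¹ *ᵥ y) (hv i)
    simp only [Matrix.mulVec_mulVec, Matrix.nonsing_inv_mul _ (isUnit_iff_ne_zero.mpr h.det_ne_zero),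
      Matrix.one_mulVec, Matrix.mulVec_smul, smul_smul, inv_mul_cancel₀ (hx i), one_smul] at h1
    exact h1.symm
  have hwidth : ∀ i, ((1 / (4 * s) : ℝ) : ℂ) * u⁻¹ * (h.isHermitian.eigenvalues i : ℂ) ≠ 0 :=
    fun i => mul_ne_zero (mul_ne_zero (Complex.ofReal_ne_zero.mpr (by positivity))
      (inv_ne_zero hu)) (Complex.ofReal_ne_zero.mpr (hx i))
  simp only [quadGaussian_eq_axisGaussian h.transpose_eq hv,
    quadGaussian_eq_axisGaussian h.inv.transpose_eq hv']
  rw [integral_mul_axisGaussian _ (fun i => h.re_inv_mul_eigenvalues_nonneg (by positivity) i)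
    hwidth, ← mul_assoc]
  have h1 : ∀ i, (Real.pi : ℂ) ^ 2 /
      (((1 / (4 * s) : ℝ) : ℂ) * u⁻¹ * (h.isHermitian.eigenvalues i : ℂ)) =
      ((4 * Real.pi ^ 2 * s : ℝ) : ℂ) * u * (((h.isHermitian.eigenvalues i)⁻¹ : ℝ) : ℂ) := fun i => by
    have := Complex.ofReal_ne_zero.mpr (hx i)
    push_cast
    field_simp
  have h2 : ∀ i, (Real.pi : ℂ) /
      (((1 / (4 * s) : ℝ) : ℂ) * u⁻¹ * (h.isHermitian.eigenvalues i : ℂ)) =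
      ((4 * Real.pi * s : ℝ) : ℂ) * u / (h.isHermitian.eigenvalues i : ℂ) := fun i => by
    have := Complex.ofReal_ne_zero.mpr (hx i)
    push_cast
    field_simp
  simp only [h1, h2]
  congr 1
  have h3 : (4 * (Real.pi : ℂ) * (u * s)) = ((4 * Real.pi * s : ℝ) : ℂ) * u := by
    push_cast
    ring
  have h4 : -((Fintype.card ι : ℕ) : ℂ) / 2 = ((Fintype.card ι : ℕ) : ℂ) * (-(1 / 2) : ℂ) := by ring
  rw [h3, h4, Complex.cpow_nat_mul, h.invSqrtDet_eq, ← Finset.card_univ, ← Finset.prod_const,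
    ← Finset.prod_mul_distrib]
  exact Finset.prod_congr rfl fun i _ => h.cpow_eigenvalues hpi i

end Admissible

omit [DecidableEq ι] in
theorem continuous_quadGaussian :
    Continuous fun q : ℂ × Matrix ι ι ℝ × EuclideanSpace ℝ ι => quadGaussian q.1 q.2.1 q.2.2 := by
  unfold quadGaussian
  simp only [dotProduct, Matrix.mulVec]
  fun_prop

omit [DecidableEq ι] in
theorem tendsto_integral_mul_quadGaussian {α : Type*} {l : Filter α} [l.IsCountablyGenerated]
    {z : α → ℂ} {z₀ : ℂ} (hz : Filter.Tendsto z l (𝓝 z₀)) {M : α → Matrix ι ι ℝ}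
    {M₀ : Matrix ι ι ℝ} (hM : Filter.Tendsto M l (𝓝 M₀))
    (hre : ∀ᶠ a in l, ∀ x : ι → ℝ, 0 ≤ (z a * ((x ⬝ᵥ M a *ᵥ x : ℝ) : ℂ)).re)
    (F : 𝓢(EuclideanSpace ℝ ι, ℂ)) :
    Filter.Tendsto (fun a => ∫ k, F k * quadGaussian (z a) (M a) k) l
      (𝓝 (∫ k, F k * quadGaussian z₀ M₀ k)) := by
  refine tendsto_integral_filter_of_dominated_convergence (fun k => ‖F k‖)
    (Filter.Eventually.of_forall fun a => (F.continuous.mul (continuous_quadGaussian.comp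
      (continuous_const.prodMk (continuous_const.prodMk continuous_id)))).aestronglyMeasurable)
    (hre.mono fun a ha => Filter.Eventually.of_forall fun k => ?_) F.integrable.norm
    (Filter.Eventually.of_forall fun k => Filter.Tendsto.const_mul _
      ((continuous_quadGaussian.tendsto (z₀, M₀, k)).comp
        (hz.prodMk_nhds (hM.prodMk_nhds tendsto_const_nhds))))
  rw [norm_mul]
  refine mul_le_of_le_one_right (norm_nonneg _) ?_
  rw [quadGaussian, Complex.norm_exp, Real.exp_le_one_iff, Complex.neg_re, neg_nonpos]
  exact ha k.ofLp

theorem tendsto_matrix_inv {α : Type*} {l : Filter α} {M : α → Matrix ι ι ℝ} {M₀ : Matrix ι ι ℝ}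
    (hM : Filter.Tendsto M l (𝓝 M₀)) (hdet : M₀.det ≠ 0) :
    Filter.Tendsto (fun a => (M a)⁻¹) l (𝓝 M₀⁻¹) :=
  (continuousAt_inv ((Matrix.isUnit_iff_isUnit_det _).mpr (isUnit_iff_ne_zero.mpr hdet))).tendsto.comp
    hM

/-- On the Fourier side the coefficient tends to `0` while `(M s)⁻¹` converges, so the Gaussian
tends to `1` and the integral to that of `𝓕⁻ F`. -/
theorem tendsto_integral_dual {u : ℂ} {M : ℝ → Matrix ι ι ℝ} {M₀ : Matrix ι ι ℝ}
    (hM : Filter.Tendsto M (𝓝[>] 0) (𝓝 M₀)) (hdet : M₀.det ≠ 0)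
    (had : ∀ᶠ s in 𝓝[>] 0, Admissible u (M s)) (F : 𝓢(EuclideanSpace ℝ ι, ℂ)) :
    Filter.Tendsto (fun s : ℝ => ∫ ξ, (𝓕⁻ F) ξ *
      quadGaussian (((4 * Real.pi ^ 2 * s : ℝ) : ℂ) * u) (M s)⁻¹ ξ) (𝓝[>] 0) (𝓝 (F 0)) := by
  have hz : Filter.Tendsto (fun s : ℝ => ((4 * Real.pi ^ 2 * s : ℝ) : ℂ) * u) (𝓝[>] 0) (𝓝 0) := by
    have h : Continuous fun s : ℝ => ((4 * Real.pi ^ 2 * s : ℝ) : ℂ) * u := by fun_prop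
    have h1 := h.tendsto 0
    simp only [mul_zero, Complex.ofReal_zero, zero_mul] at h1
    exact h1.mono_left nhdsWithin_le_nhds
  have h := tendsto_integral_mul_quadGaussian hz (tendsto_matrix_inv hM hdet) ?_ (𝓕⁻ F)
  · convert! h using 2
    rw [← integral_fourierInv]
    simp [quadGaussian]
  · filter_upwards [had, self_mem_nhdsWithin] with s hs (hpos : 0 < s) x
    exact hs.inv.re_mul_nonneg (by positivity) x

omit [DecidableEq ι] in
theorem exists_schwartz_apply_zero : ∃ F : 𝓢(EuclideanSpace ℝ ι, ℂ), F 0 = 1 := by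
  obtain ⟨φ⟩ : Nonempty (ContDiffBump (0 : EuclideanSpace ℝ ι)) := ⟨1, 2, one_pos, one_lt_two⟩
  have hc : HasCompactSupport fun x => ((φ x : ℝ) : ℂ) :=
    φ.hasCompactSupport.comp_left (g := Complex.ofReal) Complex.ofReal_zero
  have hd : ContDiff ℝ ∞ fun x => ((φ x : ℝ) : ℂ) := Complex.ofRealCLM.contDiff.comp φ.contDiff
  refine ⟨hc.toSchwartzMap hd, ?_⟩
  have h : φ 0 = 1 := φ.one_of_mem_closedBall (Metric.mem_closedBall_self φ.rIn_pos.le)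
  change ((φ 0 : ℝ) : ℂ) = 1
  rw [h, Complex.ofReal_one]

/-- Parseval's identity at a fixed imaginary time writes `invSqrtDet` as a quotient of two integrals
continuous in the form. This avoids following eigenvalues of an indefinite matrix. -/
theorem tendsto_invSqrtDet {α : Type*} {l : Filter α} [l.IsCountablyGenerated]
    {M : α → Matrix ι ι ℝ} {M₀ : Matrix ι ι ℝ}
    (hM : Filter.Tendsto M l (𝓝 M₀)) (hsymm₀ : M₀ᵀ = M₀) (hdet : M₀.det ≠ 0)
    (hsymm : ∀ᶠ a in l, (M a)ᵀ = M a) :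
    Filter.Tendsto (fun a => invSqrtDet (M a)) l (𝓝 (invSqrtDet M₀)) := by
  obtain ⟨F, hF⟩ := exists_schwartz_apply_zero (ι := ι)
  have had₀ : Admissible Complex.I M₀ := Or.inl ⟨rfl, hsymm₀, hdet⟩
  have hlim := tendsto_integral_dual (u := Complex.I) (M := fun _ => M₀) tendsto_const_nhds hdet
    (Filter.Eventually.of_forall fun _ => had₀) F
  -- A time is fixed at which the denominator at `M₀` is nonzero; it exists because the dual
  -- integral tends to `F 0 = 1`.
  have hne := hlim.eventually_ne (hF.trans_ne one_ne_zero)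
  obtain ⟨s, hs, hpos⟩ := (hne.and self_mem_nhdsWithin).exists
  replace hpos : 0 < s := hpos
  have hdet' : ∀ᶠ a in l, (M a).det ≠ 0 :=
    ((continuous_id.matrix_det.tendsto M₀).comp hM).eventually_ne hdet
  have had : ∀ᶠ a in l, Admissible Complex.I (M a) := by
    filter_upwards [hsymm, hdet'] with a h1 h2
    exact Or.inl ⟨rfl, h1, h2⟩
  have hnum := (tendsto_integral_mul_quadGaussian
    (tendsto_const_nhds (x := ((1 / (4 * s) : ℝ) : ℂ) * Complex.I⁻¹)) hM
    (had.mono fun a h x => h.re_inv_mul_nonneg (by positivity) x) F).const_mul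
      ((4 * (Real.pi : ℂ) * (Complex.I * s)) ^ (-((Fintype.card ι : ℕ) : ℂ) / 2))
  have hden := tendsto_integral_mul_quadGaussian
    (tendsto_const_nhds (x := ((4 * Real.pi ^ 2 * s : ℝ) : ℂ) * Complex.I))
    (tendsto_matrix_inv hM hdet)
    (had.mono fun a h x => h.inv.re_mul_nonneg (by positivity) x) (𝓕⁻ F)
  have h := hnum.div hden hs
  rw [had₀.integral_quadGaussian hpos, mul_div_cancel_right₀ _ hs] at h
  refine h.congr' ?_
  filter_upwards [had, hden.eventually_ne hs] with a ha hne
  rw [Pi.div_apply, ha.integral_quadGaussian hpos, mul_div_cancel_right₀ _ hne]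

/-- The Gaussian heat kernel of a convergent family of quadratic forms tends to a multiple of the
Dirac distribution. -/
theorem tendsto_integral_quadGaussian {u : ℂ} {M : ℝ → Matrix ι ι ℝ} {M₀ : Matrix ι ι ℝ}
    (hM : Filter.Tendsto M (𝓝[>] 0) (𝓝 M₀)) (hsymm₀ : M₀ᵀ = M₀) (hdet : M₀.det ≠ 0)
    (had : ∀ᶠ s in 𝓝[>] 0, Admissible u (M s)) (F : 𝓢(EuclideanSpace ℝ ι, ℂ)) :
    Filter.Tendsto (fun s : ℝ =>
      (4 * (Real.pi : ℂ) * (u * s)) ^ (-((Fintype.card ι : ℕ) : ℂ) / 2) *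
        ∫ k, F k * quadGaussian (((1 / (4 * s) : ℝ) : ℂ) * u⁻¹) (M s) k)
      (𝓝[>] 0) (𝓝 (invSqrtDet M₀ * F 0)) := by
  have h1 := tendsto_invSqrtDet hM hsymm₀ hdet (had.mono fun s h => h.transpose_eq)
  refine (h1.mul (tendsto_integral_dual hM hdet had F)).congr' ?_
  filter_upwards [had, self_mem_nhdsWithin] with s hs hpos
  exact (hs.integral_quadGaussian hpos F).symm

end

end CurvatureGroup

/-! ### The initial condition of the scalar kernel. -/

namespace CurvatureGroup

noncomputable section

open Matrix MeasureTheory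
open scoped Matrix.Norms.Operator

variable {ι : Type*} [Fintype ι] [DecidableEq ι]

theorem sinhSqrt_zero : sinhSqrt ℝ (0 : Matrix ι ι ℝ) = 1 := by
  simp [sinhSqrt, powerSum_zero, sinhCoeff]

theorem coshSqrt_zero : coshSqrt ℝ (0 : Matrix ι ι ℝ) = 1 := by
  simp [coshSqrt, powerSum_zero, coshCoeff]

-- Compactness of the unit sphere makes positivity uniform near `M₀`, and scaling extends it to all
-- nonzero vectors.
omit [DecidableEq ι] in
theorem eventually_posDef {α : Type*} {l : Filter α} {M : α → Matrix ι ι ℝ} {M₀ : Matrix ι ι ℝ}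
    (hM : Filter.Tendsto M l (𝓝 M₀)) (hpos : M₀.PosDef) (hsymm : ∀ a, (M a)ᵀ = M a) :
    ∀ᶠ a in l, (M a).PosDef := by
  have hc : Continuous fun q : Matrix ι ι ℝ × (ι → ℝ) => q.2 ⬝ᵥ q.1 *ᵥ q.2 := by
    simp only [dotProduct, Matrix.mulVec]
    fun_prop
  have h1 : ∀ᶠ N in 𝓝 M₀, ∀ x ∈ Metric.sphere (0 : ι → ℝ) 1, 0 < x ⬝ᵥ N *ᵥ x := by
    refine (isCompact_sphere _ _).eventually_forall_of_forall_eventually fun x hx => ?_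
    refine (hc.tendsto (M₀, x)).eventually (lt_mem_nhds ?_)
    have hx0 : x ≠ 0 := by
      rintro rfl
      simp at hx
    simpa using (Matrix.posDef_iff_dotProduct_mulVec.mp hpos).2 hx0
  filter_upwards [hM.eventually h1] with a ha
  refine Matrix.posDef_iff_dotProduct_mulVec.mpr ⟨?_, fun x hx => ?_⟩
  · rw [Matrix.IsHermitian, Matrix.conjTranspose_eq_transpose_of_trivial, hsymm]
  · have hn : 0 < ‖x‖ := norm_pos_iff.mpr hx
    have h2 := ha (‖x‖⁻¹ • x) (by simp [norm_smul, hn.ne'])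
    rw [smul_dotProduct, Matrix.mulVec_smul, dotProduct_smul, smul_eq_mul, smul_eq_mul,
      ← mul_assoc] at h2
    rw [star_trivial]
    exact pos_of_mul_pos_right h2 (by positivity)

namespace FlatForm

variable {G : QuadraticLieAlgebra ι} (b : FlatForm G)

theorem continuous_arg (σ : ℝ) : Continuous (b.arg σ) := by
  unfold arg
  fun_prop

theorem arg_zero (σ : ℝ) : b.arg σ 0 = 0 := by simp [arg]

theorem continuous_sinhSqrt_arg (σ : ℝ) : Continuous fun s => sinhSqrt ℝ (b.arg σ s) :=
  (continuous_powerSum factorialBound_sinhCoeff).comp (b.continuous_arg σ)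

theorem tendsto_detSinh (σ : ℝ) : Filter.Tendsto (b.detSinh σ) (𝓝[>] 0) (𝓝 1) := by
  have h := (b.continuous_sinhSqrt_arg σ).matrix_det.tendsto 0
  rw [arg_zero, sinhSqrt_zero, Matrix.det_one] at h
  exact h.mono_left nhdsWithin_le_nhds

theorem tendsto_quad (σ : ℝ) : Filter.Tendsto (b.quad σ) (𝓝[>] 0) (𝓝 G.form) := by
  have hsin := (b.continuous_sinhSqrt_arg σ).tendsto 0
  have hcos := ((continuous_powerSum (factorialBound_coshCoeff (𝕜 := ℝ))).comp (b.continuous_arg σ)).tendsto 0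
  have hcos' : Filter.Tendsto (fun s => coshSqrt ℝ (b.arg σ s)) (𝓝 0) (𝓝 1) := by
    rw [← coshSqrt_zero, ← b.arg_zero σ]
    exact hcos
  rw [arg_zero, sinhSqrt_zero] at hsin
  have hinv := tendsto_matrix_inv hsin (by simp)
  have h := (hcos'.mul hinv).const_mul G.form
  rw [inv_one, mul_one, mul_one] at h
  exact h.mono_left nhdsWithin_le_nhds

theorem eventually_detSinh_pos (σ : ℝ) : ∀ᶠ s in 𝓝[>] 0, 0 < b.detSinh σ s :=
  (b.tendsto_detSinh σ).eventually (lt_mem_nhds one_pos)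

theorem eventually_admissible_I (σ : ℝ) :
    ∀ᶠ s in 𝓝[>] 0, Admissible Complex.I (b.quad σ s) := by
  have h := ((continuous_id.matrix_det.tendsto G.form).comp (b.tendsto_quad σ)).eventually_ne
    G.form_det
  exact h.mono fun s hs => Or.inl ⟨rfl, b.transpose_quad σ s, hs⟩

theorem eventually_admissible_one (σ : ℝ) (hpos : G.form.PosDef) :
    ∀ᶠ s in 𝓝[>] 0, Admissible 1 (b.quad σ s) :=
  (eventually_posDef (b.tendsto_quad σ) hpos (b.transpose_quad σ)).mono fun _ hs =>
    Or.inr ⟨rfl, hs⟩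

/-- For `σ ≤ 0` the argument is a nonnegative multiple of `bᵀ b`. All terms of the series are
nonnegative forms and the first is the identity, so the kernel is zero. -/
theorem detSinh_ne_zero_of_nonpos {σ : ℝ} (hσ : σ ≤ 0) (s : ℝ) : b.detSinh σ s ≠ 0 := by
  have harg : b.arg σ s = (-(s ^ 2 * σ)) • (b.matᵀ * b.mat) := by
    rw [arg_eq_mul, b.transpose_eq, neg_mul, smul_neg, neg_smul, neg_neg, Matrix.mul_smul]
  have hnn : 0 ≤ -(s ^ 2 * σ) := by
    rw [← mul_neg]
    exact mul_nonneg (sq_nonneg s) (neg_nonneg.mpr hσ)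
  have hsd : (b.arg σ s).PosSemidef := by
    rw [harg]
    have h := Matrix.posSemidef_conjTranspose_mul_self b.mat
    rw [Matrix.conjTranspose_eq_transpose_of_trivial] at h
    exact h.smul hnn
  intro h0
  obtain ⟨x, hx, hx0⟩ := Matrix.exists_mulVec_eq_zero_iff.mpr h0
  have hsum : HasSum (fun m => sinhCoeff ℝ m * (x ⬝ᵥ (b.arg σ s ^ m) *ᵥ x))
      (x ⬝ᵥ sinhSqrt ℝ (b.arg σ s) *ᵥ x) := by
    have h := hasSum_powerSum (factorialBound_sinhCoeff (𝕜 := ℝ)) (b.arg σ s)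
    have hL : Continuous fun N : Matrix ι ι ℝ => x ⬝ᵥ N *ᵥ x := by
      simp only [dotProduct, Matrix.mulVec]
      fun_prop
    let L : Matrix ι ι ℝ →+ ℝ :=
      { toFun := fun N => x ⬝ᵥ N *ᵥ x
        map_zero' := by simp
        map_add' := fun N N' => by rw [Matrix.add_mulVec, dotProduct_add] }
    refine (congrArg (HasSum · _) (funext fun m => ?_)).mpr (h.map L hL)
    change _ = x ⬝ᵥ (sinhCoeff ℝ m • b.arg σ s ^ m) *ᵥ x
    rw [Matrix.smul_mulVec, dotProduct_smul, smul_eq_mul]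
  have hle := le_hasSum hsum 0 fun m _ => mul_nonneg (inv_nonneg.mpr (Nat.cast_nonneg _))
    (by simpa using (hsd.pow m).dotProduct_mulVec_nonneg x)
  rw [hx0, dotProduct_zero, pow_zero, Matrix.one_mulVec] at hle
  have hpos : 0 < x ⬝ᵥ x := by simpa using Matrix.dotProduct_star_self_pos_iff.mpr hx
  simp only [sinhCoeff, mul_zero, zero_add, Nat.factorial_one, Nat.cast_one, inv_one, one_mul] at hle
  exact absurd hle (not_le.mpr hpos)

/-- The scalar heat kernel tends to a multiple of the Dirac distribution. -/
theorem tendsto_integral_heat {u : ℂ} {σ : ℝ} (had : ∀ᶠ s in 𝓝[>] 0, Admissible u (b.quad σ s))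
    {f : (ι → ℝ) → ℂ} (hf : ContDiff ℝ ∞ f) (hcs : HasCompactSupport f)
    (hreg : ∀ k ∈ tsupport f, G.jac k ≠ 0) :
    Filter.Tendsto (fun s : ℝ => ∫ k, f k * b.heat u σ s k) (𝓝[>] 0)
      (𝓝 (invSqrtDet G.form * f 0)) := by
  -- The singular factor is absorbed into the test function, which stays smooth because `j` has no
  -- zero on the support of `f`.
  let F : (ι → ℝ) → ℂ := fun k => f k * ((G.jac k ^ (-(1 / 2) : ℝ) : ℝ) : ℂ)
  have hF : ContDiff ℝ ∞ F := by
    rw [contDiff_iff_contDiffAt]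
    intro k
    by_cases hk : k ∈ tsupport f
    · exact hf.contDiffAt.mul (Complex.ofRealCLM.contDiff.contDiffAt.comp k
        (G.contDiff_jac.contDiffAt.rpow_const_of_ne (hreg k hk)))
    · refine (contDiffAt_const (c := (0 : ℂ))).congr_of_eventuallyEq ?_
      filter_upwards [notMem_tsupport_iff_eventuallyEq.mp hk] with k' hk'
      simp [F, hk']
  have hFc : HasCompactSupport F := hcs.mul_right
  let T : EuclideanSpace ℝ ι ≃L[ℝ] (ι → ℝ) := EuclideanSpace.equiv ι ℝ
  have hFE : ContDiff ℝ ∞ fun x => F (T x) := hF.comp T.contDiff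
  have hFEc : HasCompactSupport fun x => F (T x) := hFc.comp_homeomorph T.toHomeomorph
  have h1 := tendsto_integral_quadGaussian (b.tendsto_quad σ) G.form_symm G.form_det had
    (hFEc.toSchwartzMap hFE)
  have hjac : G.jac 0 = 1 := by
    rw [QuadraticLieAlgebra.jac, map_zero, leftFun, powerSum_zero]
    simp [leftCoeff]
  have hF0 : (hFEc.toSchwartzMap hFE) 0 = f 0 := by
    change f (T 0) * ((G.jac (T 0) ^ (-(1 / 2) : ℝ) : ℝ) : ℂ) = f 0
    rw [map_zero, hjac, Real.one_rpow, Complex.ofReal_one, mul_one]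
  rw [hF0] at h1
  have h2 : Filter.Tendsto (fun s => ((b.detSinh σ s ^ (-(1 / 2) : ℝ) : ℝ) : ℂ)) (𝓝[>] 0)
      (𝓝 1) := by
    have h := (b.tendsto_detSinh σ).rpow_const (p := -(1 / 2)) (Or.inl one_ne_zero)
    rw [Real.one_rpow] at h
    have h' := (Complex.continuous_ofReal.tendsto 1).comp h
    rwa [Complex.ofReal_one] at h'
  have h3 : Filter.Tendsto (fun s : ℝ => Complex.exp
      (((-(1 / 4) * G.theta 1 1 1 : ℝ) : ℂ) * (u * s) / 6)) (𝓝[>] 0) (𝓝 1) := by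
    have hc : Continuous fun s : ℝ => Complex.exp
      (((-(1 / 4) * G.theta 1 1 1 : ℝ) : ℂ) * (u * s) / 6) := by fun_prop
    have h := hc.tendsto 0
    simp only [Complex.ofReal_zero, mul_zero, zero_div, Complex.exp_zero] at h
    exact h.mono_left nhdsWithin_le_nhds
  have h4 := (h2.mul h3).mul h1
  rw [one_mul, one_mul] at h4
  refine h4.congr' ?_
  filter_upwards [b.eventually_detSinh_pos σ, self_mem_nhdsWithin] with s hdet (hs : 0 < s)
  rw [← (PiLp.volume_preserving_toLp ι).integral_comp
    (MeasurableEquiv.toLp 2 (ι → ℝ)).measurableEmbedding, ← mul_assoc, ← integral_const_mul]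
  congr 1
  funext k
  change _ * (f k * ((G.jac k ^ (-(1 / 2) : ℝ) : ℝ) : ℂ) * _) = _
  -- Splitting the real power of the product uses `0 ≤ j`, also outside the support of `f`.
  rw [heat, exponent, Complex.exp_add, Real.mul_rpow (G.jac_nonneg k) hdet.le, quadGaussian]
  have hexp : -(((1 / (4 * s) : ℝ) : ℂ) * u⁻¹ * ((k ⬝ᵥ b.quad σ s *ᵥ k : ℝ) : ℂ)) =
      -(1 / (2 * (u * s)) * (1 / 2 * ((k ⬝ᵥ b.quad σ s *ᵥ k : ℝ) : ℂ))) := by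
    push_cast
    rw [one_div, one_div, mul_inv, mul_inv, mul_inv]
    ring
  rw [WithLp.ofLp_toLp, hexp, Complex.ofReal_mul (G.jac k ^ _)]
  ring

end FlatForm

end

end CurvatureGroup

/-! ### The initial condition of the operator-valued kernel. -/

namespace CurvatureGroup

noncomputable section

open Matrix MeasureTheory

theorem FlatForm.continuous_mul_heat {ι : Type*} [Fintype ι] [DecidableEq ι]
    {G : QuadraticLieAlgebra ι} (b : FlatForm G) {u : ℂ} {σ s : ℝ} (he : b.detSinh σ s ≠ 0)
    {f : (ι → ℝ) → ℂ} (hf : Continuous f) (hreg : ∀ k ∈ tsupport f, G.jac k ≠ 0) :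
    Continuous fun k => f k * b.heat u σ s k := by
  rw [continuous_iff_continuousAt]
  intro k
  by_cases hk : k ∈ tsupport f
  · exact hf.continuousAt.mul (b.contDiffAt_heat (n := 0) (hreg k hk) he).continuousAt
  · refine (continuousAt_const (y := (0 : ℂ))).congr ?_
    filter_upwards [notMem_tsupport_iff_eventuallyEq.mp hk] with k' hk'
    simp [hk']

namespace ParallelBundleCurvature

variable {n p : ℕ} {S : SymmetricSpaceCurvature n p} {W : Type*}
  [NormedAddCommGroup W] [InnerProductSpace ℂ W] [CompleteSpace W] [FiniteDimensional ℂ W]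
  (Ω : ParallelBundleCurvature S W)
  {κ : Type*} [Fintype κ] {e : OrthonormalBasis κ ℂ W} {b : κ → FlatForm S.curvatureAlgebra}

theorem tendsto_integral_Φ (hB : Ω.B = matDiag e fun α => Complex.I • (b α).mat.map Complex.ofReal)
    {u : ℂ} {σ : ℝ} (hσ : u ^ 2 = -σ)
    (had : ∀ α, ∀ᶠ s in 𝓝[>] 0, Admissible u ((b α).quad σ s))
    {f : (Idx n p → ℝ) → ℂ} (hf : ContDiff ℝ ∞ f) (hcs : HasCompactSupport f)
    (hreg : tsupport f ⊆ S.regular) :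
    Filter.Tendsto (fun s : ℝ => ∫ k, f k • Ω.Φ (u * s) k) (𝓝[>] 0)
      (𝓝 ((invSqrtDet S.γ * f 0) • (1 : W →L[ℂ] W))) := by
  have hlim : Filter.Tendsto (fun s : ℝ => diagHom e fun α => ∫ k, f k * (b α).heat u σ s k)
      (𝓝[>] 0) (𝓝 (diagHom e fun _ => invSqrtDet S.γ * f 0)) :=
    ((continuous_diagHom e).tendsto _).comp (tendsto_pi_nhds.mpr fun α =>
      (b α).tendsto_integral_heat (had α) hf hcs hreg)
  have hconst : (diagHom e fun _ => invSqrtDet S.γ * f 0) =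
      (invSqrtDet S.γ * f 0) • (1 : W →L[ℂ] W) := by
    rw [← Algebra.algebraMap_eq_smul_one, ← (diagHom e).commutes]
    rfl
  rw [← hconst]
  have hev : ∀ᶠ s in 𝓝[>] 0, ∀ α, 0 < (b α).detSinh σ s := by
    rw [Filter.eventually_all]
    exact fun α => (b α).eventually_detSinh_pos σ
  refine hlim.congr' (hev.mono fun s hs => ?_)
  have hint : ∀ α, Integrable fun k => f k * (b α).heat u σ s k := fun α =>
    ((b α).continuous_mul_heat (hs α).ne' hf.continuous hreg).integrable_of_hasCompactSupport
      hcs.mul_right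
  have h1 : ∀ k, f k • Ω.Φ (u * s) k = diagCLM e fun α => f k * (b α).heat u σ s k := fun k => by
    rw [Ω.Φ_eq hB hσ (fun α => (hs α).ne'), ← map_smul]
    rfl
  simp only [h1]
  rw [ContinuousLinearMap.integral_comp_comm _ (Integrable.of_eval hint), diagCLM_apply]
  congr 1
  funext α
  exact (eval_integral hint α).symm

end ParallelBundleCurvature

end

end CurvatureGroup

/-! ### The heat equation and the initial condition on both time axes. -/

theorem mainTheorem4 {n p : ℕ} (S : CurvatureGroup.SymmetricSpaceCurvature n p)
    {W : Type*} [NormedAddCommGroup W] [InnerProductSpace ℂ W] [CompleteSpace W]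
    [FiniteDimensional ℂ W] (Ω : CurvatureGroup.ParallelBundleCurvature S W) :
    -- the heat equation, for real positive times
    (∀ t : ℝ, 0 < t → ∀ k ∈ S.regular,
      ContDiffAt ℝ ∞ (Ω.Φ t) k ∧
      HasDerivAt (fun s : ℝ => Ω.Φ s k) (Ω.J2 (Ω.Φ t) k) t) ∧
    -- the heat equation, for the continuation to the positive imaginary axis `t = iτ`
    (∀ τ : ℝ, 0 < τ → ∀ k, IsUnit (Ω.detSinhc (Complex.I * τ) k) →
      ContDiffAt ℝ ∞ (Ω.Φ (Complex.I * τ)) k ∧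
      HasDerivAt (fun s : ℝ => Ω.Φ (Complex.I * s) k)
        (Complex.I • Ω.J2 (Ω.Φ (Complex.I * τ)) k) τ) ∧
    -- the initial condition as `t → 0+`, for positive definite `γ`
    (S.γ.PosDef → ∀ f : (CurvatureGroup.Idx n p → ℝ) → ℂ, ContDiff ℝ ∞ f →
      HasCompactSupport f → tsupport f ⊆ S.regular →
      Filter.Tendsto (fun t : ℝ => ∫ k, f k • Ω.Φ t k) (𝓝[>] 0)
        (𝓝 ((CurvatureGroup.invSqrtDet S.γ * f 0) • (1 : W →L[ℂ] W)))) ∧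
    -- the initial condition as `t = iτ → 0`, for `γ` of any signature
    (∀ f : (CurvatureGroup.Idx n p → ℝ) → ℂ, ContDiff ℝ ∞ f →
      HasCompactSupport f → tsupport f ⊆ S.regular →
      Filter.Tendsto (fun τ : ℝ => ∫ k, f k • Ω.Φ (Complex.I * τ) k) (𝓝[>] 0)
        (𝓝 ((CurvatureGroup.invSqrtDet S.γ * f 0) • (1 : W →L[ℂ] W)))) := by
  obtain ⟨m, e, b, hB⟩ := Ω.exists_diagonalization
  -- Real time is `u = 1`, `σ = -1`; imaginary time is `u = i`, `σ = 1`.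
  have hone : (1 : ℂ) ^ 2 = -((-1 : ℝ) : ℂ) := by simp
  have hI : Complex.I ^ 2 = -((1 : ℝ) : ℂ) := by simp
  refine ⟨fun t ht k hk => ?_, fun τ hτ k hu => ?_, fun hγ f hf hcs hreg => ?_,
    fun f hf hcs hreg => ?_⟩
  · have he : ∀ α, (b α).detSinh (-1) t ≠ 0 := fun α =>
      (b α).detSinh_ne_zero_of_nonpos (by norm_num) t
    have h1 := Ω.contDiffAt_Φ hB hone he ((S.mem_regular_iff k).mp hk)
    have h2 := Ω.hasDerivAt_Φ hB Complex.one_mem_slitPlane hone ht he ((S.mem_regular_iff k).mp hk)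
    simp only [one_mul, one_smul] at h1 h2
    exact ⟨h1, h2⟩
  -- For `W = 0` the eigenbasis is empty and invertibility of the determinant says nothing about
  -- `k`; but then all operators vanish.
  · rcases subsingleton_or_nontrivial W with hW | hW
    · have hΦ : ∀ g : (CurvatureGroup.Idx n p → ℝ) → (W →L[ℂ] W), g = fun _ => 0 := fun g =>
        Subsingleton.elim _ _
      refine ⟨?_, ?_⟩
      · rw [hΦ (Ω.Φ _)]
        exact contDiffAt_const
      · rw [Subsingleton.elim (Complex.I • Ω.J2 (Ω.Φ (Complex.I * τ)) k) 0,
          Subsingleton.elim (fun s : ℝ => Ω.Φ (Complex.I * s) k) fun _ => 0]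
        exact hasDerivAt_const τ 0
    · rw [Ω.detSinhc_eq hB hI, CurvatureGroup.isUnit_diagHom_iff] at hu
      have hne : ∀ α, S.curvatureAlgebra.jac k ≠ 0 ∧ (b α).detSinh 1 τ ≠ 0 := fun α =>
        mul_ne_zero_iff.mp (Complex.ofReal_ne_zero.mp (hu α))
      obtain ⟨α⟩ : Nonempty (Fin m) := e.toBasis.index_nonempty
      exact ⟨Ω.contDiffAt_Φ hB hI (fun α => (hne α).2) (hne α).1,
        Ω.hasDerivAt_Φ hB (Complex.mem_slitPlane_iff.mpr (Or.inr (by simp))) hI hτ (fun α => (hne α).2) (hne α).1⟩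
  · have h := Ω.tendsto_integral_Φ hB hone
      (fun α => (b α).eventually_admissible_one (-1) hγ) hf hcs hreg
    simpa only [one_mul] using h
  · exact Ω.tendsto_integral_Φ hB hI (fun α => (b α).eventually_admissible_I 1) hf hcs hreg
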